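/- A \emph{network} is a locally finite graph $G=(V,E)$ (multiple edges and self-loops allowed) with positive edge conductances $(c_e)_{e\in E}$; $c(v)$ denotes the total conductance of the oriented edges emanating from $v$. The random walk on $G$ is the Markov chain that from $v$ crosses an oriented edge emanating from $v$ chosen with probability proportional to its conductance, and $\mathbb{P}_v$ is its law when started from $v$. For $A\subseteq V$ let $\tau_A^+=\min\{t\ge 1: X_t\in A\}$. The network is \emph{transient} if $\mathbb{P}_v(\tau^+_{\{v\}}=\infty)>0$ for every $v\in V$, and the \emph{capacity} of a finite set $A\subseteq V$ is $\operatorname{Cap}(A)=\sum_{v\in A}c(v)\,\mathbb{P}_v(\tau_A^+=\infty)$. For a finite path $w=(w_0,\dots,w_m)$ put $\ell_0=0$ and $\ell_{k+1}=1+\max\{j\le m: w_j=w_{\ell_k}\}$, stopping the first time that this maximum equals $m$; the loop-erasure $\mathsf{LE}(w)$ is the path $(w_{\ell_0},w_{\ell_1},\dots)$. Write $X^n=(X_0,\dots,X_n)$, and write $\operatorname{Cap}$ of a path for the capacity of the set of vertices it visits. (1) Let $G$ be a transient, locally finite network, let $x\in V$, and let $X$ be a random walk on $G$ started from $x$. Then,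 for every $n\ge 0$, \[ \mathbb{E}\bigl[\operatorname{Cap}(\mathsf{LE}(X^n))\bigr]\;\ge\;\frac{1}{256}\,\mathbb{E}\bigl[\operatorname{Cap}(X^n)\bigr]. \] (2) There exist constants $0<c\le C<\infty$ such that, if $X$ is a simple random walk on the lattice $\mathbb{Z}^4$ (nearest-neighbour edges with unit conductances), started from any vertex, then \[ c\,\frac{n}{\log n}\;\le\;\mathbb{E}\bigl[\operatorname{Cap}(\mathsf{LE}(X^n))\bigr]\;\le\;C\,\frac{n}{\log n}\qquad\text{for every } n\ge 2 . \] -/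

import Mathlib

open MeasureTheory ProbabilityTheory

/-- A locally finite network with vertex set `V`. Multiple edges and self-loops are allowed.
`E` is the set of *oriented* edges: `e` goes from `src e` to `tgt e`, and `rev e` is the same edge
with the opposite orientation. A self-loop may be counted as one oriented edge (`rev e = e`)
or as two. -/
structure Network (V E : Type*) where
  src : E → V
  tgt : E → V
  rev : E → E
  rev_rev : ∀ e, rev (rev e) = e
  src_rev : ∀ e, src (rev e) = tgt e
  /-- the conductance of an edge -/
  cond : E → ℝ
  cond_pos : ∀ e, 0 < cond e
  cond_rev : ∀ e, cond (rev e) = cond e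
  /-- local finiteness -/
  finite_out : ∀ v, {e | src e = v}.Finite

namespace Network

variable {V E : Type*} (G : Network V E)

/-- The oriented edges emanating from `v`. -/
noncomputable def out (v : V) : Finset E := (G.finite_out v).toFinset

/-- `c(v)`, the total conductance of the oriented edges emanating from `v`. -/
noncomputable def vertexCond (v : V) : ℝ := ∑ e ∈ G.out v, G.cond e

theorem vertexCond_pos {v : V} (h : (G.out v).Nonempty) : 0 < G.vertexCond v :=
  Finset.sum_pos (fun e _ => G.cond_pos e) h

variable [MeasurableSpace V]

open Classical in
/-- The law of one step of the random walk from `v`: an oriented edge emanating from `v` is chosen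
with probability proportional to its conductance and crossed. (At an isolated vertex, which a
transient network does not have, the walk stays put.) -/
noncomputable def stepLaw (v : V) : Measure V :=
  if (G.out v).Nonempty then
    ∑ e ∈ G.out v, ENNReal.ofReal (G.cond e / G.vertexCond v) • Measure.dirac (G.tgt e)
  else Measure.dirac v

instance (v : V) : IsProbabilityMeasure (G.stepLaw v) := by
  unfold stepLaw
  split_ifs with h
  · constructor
    have hpos := G.vertexCond_pos h
    simp only [Measure.coe_finsetSum, Finset.sum_apply, Measure.smul_apply, measure_univ,
      smul_eq_mul, mul_one]
    rw [← ENNReal.ofReal_sum_of_nonneg fun e _ => (div_pos (G.cond_pos e) hpos).le,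
      ← Finset.sum_div]
    change ENNReal.ofReal (G.vertexCond v / G.vertexCond v) = 1
    rw [div_self hpos.ne', ENNReal.ofReal_one]
  · infer_instance

variable [DiscreteMeasurableSpace V]

/-- The transition kernel of the random walk, the next step being given the past up to
time `n`. -/
noncomputable def stepKernel (n : ℕ) : Kernel ((i : Finset.Iic n) → (fun _ : ℕ => V) i) V :=
  Kernel.comap (⟨G.stepLaw, Measurable.of_discrete⟩ : Kernel V V)
    (fun h => h ⟨n, Finset.mem_Iic.2 le_rfl⟩) (measurable_pi_apply _)

instance (n : ℕ) : IsMarkovKernel (G.stepKernel n) :=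
  ⟨fun h => inferInstanceAs
    (IsProbabilityMeasure (G.stepLaw (h ⟨n, Finset.mem_Iic.2 le_rfl⟩)))⟩

/-- The law `P_x`, on trajectories `ℕ → V`, of the random walk on `G` started from `x`. -/
noncomputable def walkLaw (x : V) : Measure (ℕ → V) :=
  Kernel.traj (X := fun _ : ℕ => V) G.stepKernel 0 (fun _ => x)

/-- `P_x(τ_A⁺ = ∞)`, the probability that the walk started from `x` does not visit `A` at any
positive time. -/
noncomputable def escapeProb (A : Set V) (x : V) : ℝ :=
  (G.walkLaw x).real {w | ∀ t, 1 ≤ t → w t ∉ A}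

/-- The network is transient: from every vertex, the walk has a positive probability of
never returning. -/
def IsTransient : Prop := ∀ v, 0 < G.escapeProb {v} v

/-- The capacity `∑_{x ∈ A} c(x) P_x(τ_A⁺ = ∞)` of a finite set `A` of vertices. -/
noncomputable def capacity (A : Finset V) : ℝ :=
  ∑ x ∈ A, G.vertexCond x * G.escapeProb (A : Set V) x

end Network

section LoopErasure

variable {V : Type*}

open Classical in
/-- The set of vertices visited by the path `w` stopped at time `m`. -/
noncomputable def pathVertices (w : ℕ → V) (m : ℕ) : Finset V :=
  (Finset.range (m + 1)).image w

open Classical in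
/-- `max {k ≤ m : w k = w i}`, for `i ≤ m`. -/
noncomputable def lastVisit (w : ℕ → V) (m i : ℕ) : ℕ :=
  Nat.findGreatest (fun k => w k = w i) m

/-- The times `ℓ_k` of the loop-erasure of the path `w` stopped at time `m`: `ℓ_0 = 0` and
`ℓ_{k+1} = 1 + max {j ≤ m : w j = w ℓ_k}`, the sequence terminating (value `none`) the first time
that this maximum equals `m`. -/
noncomputable def loopErasureTime (w : ℕ → V) (m : ℕ) : ℕ → Option ℕ
  | 0 => some 0
  | k + 1 => (loopErasureTime w m k).bind fun l =>
      if lastVisit w m l = m then none else some (1 + lastVisit w m l)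

/-- The `k`-th vertex `w ℓ_k` of the loop-erasure of the path `w` stopped at time `m`
(`none` after its end). -/
noncomputable def loopErasure (w : ℕ → V) (m k : ℕ) : Option V :=
  (loopErasureTime w m k).map w

open Classical in
/-- The set of vertices of the loop-erasure of the path `w` stopped at time `m`. -/
noncomputable def loopErasureVertices (w : ℕ → V) (m : ℕ) : Finset V :=
  (pathVertices w m).filter fun v => ∃ k, loopErasure w m k = some v

end LoopErasure

/-- The endpoint of the oriented lattice edge that leaves `x` in direction `i`, forwards or
backwards. -/
def latticeStep {d : ℕ} (x : Fin d → ℤ) (i : Fin d) (b : Bool) : Fin d → ℤ :=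
  x + Pi.single i (if b then 1 else -1)

theorem latticeStep_not {d : ℕ} (x : Fin d → ℤ) (i : Fin d) (b : Bool) :
    latticeStep (latticeStep x i b) i (!b) = x := by
  cases b <;> simp [latticeStep, add_assoc, ← Pi.single_add]

/-- The hypercubic lattice `ℤ^d` with nearest-neighbour edges and unit conductances. -/
def latticeNetwork (d : ℕ) : Network (Fin d → ℤ) ((Fin d → ℤ) × Fin d × Bool) where
  src e := e.1
  tgt e := latticeStep e.1 e.2.1 e.2.2
  rev e := (latticeStep e.1 e.2.1 e.2.2, e.2.1, !e.2.2)
  rev_rev e := by simp [latticeStep_not]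
  src_rev _ := rfl
  cond _ := 1
  cond_pos _ := one_pos
  cond_rev _ := rfl
  finite_out v := by
    refine (Set.finite_range fun p : Fin d × Bool => (v, p)).subset ?_
    rintro ⟨x, p⟩ rfl
    exact ⟨p, rfl⟩

/-!
Kill the walk at each step with probability `1 - lam`, and when it leaves a finite set `W`. Its
Green kernel is finite and its energy is a Dirichlet form; as `lam` tends to one and `W` exhausts
the network, its capacities decrease to those of the network.

For the comparison of the loop-erasure with the path, let `q m` be the charge that the equilibrium
measure of `X^n` puts on `X m` if `m` is the time of the first visit, and replace it by its
conditional expectation given `X m`. The mean mass is still the mean capacity of the path, and the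
mean energy is at most `16` times that: the energy is at most twice the sum over `m` of the charge
at `m` times the potential at `X m` of the charges from time `m` on. The conditional expectation of
this tail potential depends only on `X m`, so `q m` may be put back in front of it, and it is
dominated by the maximal function of the martingale of the full potential. The Cauchy-Schwarz
inequality for the Dirichlet form and Doob's `L²` inequality now bound the energy by `4` times the
geometric mean of the energy and the mean capacity.

Sweep the charge at each time `m` onto the part of `LE(X^m)` that survives until time `n`, which is
a part of `LE(X^n)`. This does not increase the energy, and on average it keeps half of the mass at
least, because two independent continuations of a path are equally likely to reach lower on its
loop-erasure. As a capacity is at least mass squared over energy, the constant is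
`(1 / 2) ^ 2 / 16 = 1 / 64`.

On `ℤ⁴` the `l`-step transition probabilities are at most a multiple of `1 / (l + 1) ^ 2`. The
occupation measure of the path has mass `n + 1` and mean energy of order `n log n`, whence the lower
bound on the capacity of the path. For the upper bound, sum the Green function seen from `X m` along
the even ones of the next `2 * n` steps. Its mean is of order `log n` and so is its variance, so by
Chebyshev's inequality it is less than half of its mean at `O(n / log n)` times `m` only, on
average. At the other vertices the last-exit decomposition, `∑ v, escape v * green v u ≤ 1`, summed
over the times of the path, bounds the total charge by `O(n / log n)`.
-/

/-! ### Expectations over paths -/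

section Pointwise

variable {R α β ι : Type*} [CommRing R] (L : (α → R) →ₗ[R] β → R)

theorem map_fun_zero (b : β) : L (fun _ => 0) b = 0 := congrFun (map_zero L) b

theorem map_fun_add (f g : α → R) (b : β) : L (fun a => f a + g a) b = L f b + L g b :=
  congrFun (map_add L f g) b

theorem map_fun_sub (f g : α → R) (b : β) : L (fun a => f a - g a) b = L f b - L g b :=
  congrFun (map_sub L f g) b

theorem map_fun_const_mul (c : R) (f : α → R) (b : β) : L (fun a => c * f a) b = c * L f b :=
  congrFun (map_smul L c f) b

theorem map_fun_sum (s : Finset ι) (f : ι → α → R) (b : β) :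
    L (fun a => ∑ i ∈ s, f i a) b = ∑ i ∈ s, L (f i) b := by
  have h : (fun a => ∑ i ∈ s, f i a) = ∑ i ∈ s, f i := by ext; simp
  rw [h, map_sum, Finset.sum_apply]

end Pointwise

/-- The pathwise form of Doob's `L²` inequality: for a submartingale `s`, the sum has nonnegative
expectation. -/
theorem sq_partialSups_add_le (s : ℕ → ℝ) (n : ℕ) :
    partialSups s n ^ 2 + 4 * ∑ m ∈ Finset.range n, partialSups s m * (s (m + 1) - s m) ≤
      4 * s n ^ 2 := by
  have telescoped : partialSups s n ^ 2 +
      2 * ∑ m ∈ Finset.range n, partialSups s m * (s (m + 1) - s m) ≤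
        2 * (partialSups s n * s n) := by
    induction n with
    | zero => simpa using by nlinarith [sq_nonneg (s 0)]
    | succ n ih =>
      rw [Finset.sum_range_succ, partialSups_add_one]
      rcases le_total (partialSups s n) (s (n + 1)) with h | h
      · rw [sup_eq_right.2 h]
        nlinarith [sq_nonneg (s (n + 1) - partialSups s n)]
      · rw [sup_eq_left.2 h]
        nlinarith
  nlinarith [sq_nonneg (partialSups s n - 2 * s n)]

namespace Network

variable {V E : Type*} (G : Network V E)

/-- The transition operator of the random walk: `avg f v` is the average of `f` over the neighbours
of `v`, weighted by the conductances of the edges from `v`. -/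
noncomputable def avg : (V → ℝ) →ₗ[ℝ] V → ℝ where
  toFun f v := (∑ e ∈ G.out v, G.cond e * f (G.tgt e)) / G.vertexCond v
  map_add' f g := by
    ext v
    simp only [Pi.add_apply, mul_add, Finset.sum_add_distrib, add_div]
  map_smul' c f := by
    ext v
    simp only [Pi.smul_apply, smul_eq_mul, mul_left_comm _ c, ← Finset.mul_sum, mul_div_assoc,
      RingHom.id_apply]

theorem avg_apply (f : V → ℝ) (v : V) :
    G.avg f v = (∑ e ∈ G.out v, G.cond e * f (G.tgt e)) / G.vertexCond v := rfl

theorem vertexCond_nonneg (v : V) : 0 ≤ G.vertexCond v :=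
  Finset.sum_nonneg fun e _ => (G.cond_pos e).le

theorem vertexCond_mul_avg (f : V → ℝ) (v : V) :
    G.vertexCond v * G.avg f v = ∑ e ∈ G.out v, G.cond e * f (G.tgt e) := by
  rcases (G.out v).eq_empty_or_nonempty with h | h
  · simp [avg_apply, vertexCond, h]
  · exact mul_div_cancel₀ _ (G.vertexCond_pos h).ne'

theorem avg_le_avg {f g : V → ℝ} {v : V} (h : ∀ e ∈ G.out v, f (G.tgt e) ≤ g (G.tgt e)) :
    G.avg f v ≤ G.avg g v :=
  div_le_div_of_nonneg_right (Finset.sum_le_sum fun e he =>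
    mul_le_mul_of_nonneg_left (h e he) (G.cond_pos e).le) (G.vertexCond_nonneg v)

theorem avg_congr {f g : V → ℝ} {v : V} (h : ∀ e ∈ G.out v, f (G.tgt e) = g (G.tgt e)) :
    G.avg f v = G.avg g v :=
  le_antisymm (G.avg_le_avg fun e he => (h e he).le) (G.avg_le_avg fun e he => (h e he).ge)

theorem avg_const {v : V} (hv : (G.out v).Nonempty) (c : ℝ) :
    G.avg (fun _ => c) v = c := by
  rw [avg_apply, ← Finset.sum_mul]
  exact mul_div_cancel_left₀ _ (G.vertexCond_pos hv).ne'

theorem avg_nonneg {f : V → ℝ} (h : ∀ v, 0 ≤ f v) (v : V) : 0 ≤ G.avg f v :=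
  (map_fun_zero G.avg v).ge.trans (G.avg_le_avg fun _ _ => h _)

theorem avg_pow_succ_apply (k : ℕ) (f : V → ℝ) (v : V) :
    (G.avg ^ (k + 1)) f v = G.avg ((G.avg ^ k) f) v := by
  rw [pow_succ', Module.End.mul_apply]

theorem avg_pow_le_avg_pow {f g : V → ℝ} (h : ∀ v, f v ≤ g v) (k : ℕ) (v : V) :
    (G.avg ^ k) f v ≤ (G.avg ^ k) g v := by
  induction k generalizing v with
  | zero => exact h v
  | succ k ih =>
    rw [avg_pow_succ_apply, avg_pow_succ_apply]
    exact G.avg_le_avg fun e _ => ih _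

theorem avg_pow_nonneg {f : V → ℝ} (h : ∀ v, 0 ≤ f v) (k : ℕ) (v : V) : 0 ≤ (G.avg ^ k) f v :=
  (map_fun_zero (G.avg ^ k) v).ge.trans (G.avg_pow_le_avg_pow h k v)

section PathExpectation

/-- The conditional expectation, given the walk up to time `m`, of a function of the walk up to
time `m + k`. It is computed by averaging over one step at a time, so that it involves no
measurability. -/
noncomputable def pathExp : ℕ → ℕ → ((ℕ → V) → ℝ) →ₗ[ℝ] (ℕ → V) → ℝ
  | _, 0 => LinearMap.id
  | m, k + 1 => LinearMap.pi fun w => LinearMap.proj (w m) ∘ₗ G.avg ∘ₗ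
      LinearMap.funLeft ℝ ℝ (Function.update w (m + 1)) ∘ₗ pathExp (m + 1) k

@[simp] theorem pathExp_zero (m : ℕ) (F : (ℕ → V) → ℝ) : G.pathExp m 0 F = F := rfl

theorem pathExp_succ (m k : ℕ) (F : (ℕ → V) → ℝ) (w : ℕ → V) :
    G.pathExp m (k + 1) F w =
      G.avg (fun u => G.pathExp (m + 1) k F (Function.update w (m + 1) u)) (w m) := rfl

/-- `w` follows edges of the network from time `m` to time `m + k`. -/
def IsPath (m k : ℕ) (w : ℕ → V) : Prop :=
  ∀ i, m ≤ i → i < m + k → ∃ e ∈ G.out (w i), G.tgt e = w (i + 1)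

theorem pathExp_le {m k : ℕ} {F F' : (ℕ → V) → ℝ} {w : ℕ → V}
    (h : ∀ w', (∀ i ≤ m, w' i = w i) → G.IsPath m k w' → F w' ≤ F' w') :
    G.pathExp m k F w ≤ G.pathExp m k F' w := by
  induction k generalizing m w with
  | zero => exact h w (fun _ _ => rfl) fun i hi hi' => absurd hi' (by omega)
  | succ k ih =>
    rw [pathExp_succ, pathExp_succ]
    refine G.avg_le_avg fun e he => ih fun w' hw' hp => h w' (fun i hi => ?_) fun i hi hi' => ?_
    · rw [hw' i (by omega), Function.update_of_ne (by omega)]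
    · rcases hi.eq_or_lt with rfl | hlt
      · refine ⟨e, ?_, ?_⟩
        · rwa [hw' _ (by omega), Function.update_of_ne (by omega)]
        · rw [hw' _ le_rfl, Function.update_self]
      · exact hp i hlt (by omega)

theorem pathExp_congr {m k : ℕ} {F F' : (ℕ → V) → ℝ} {w : ℕ → V}
    (h : ∀ w', (∀ i ≤ m, w' i = w i) → G.IsPath m k w' → F w' = F' w') :
    G.pathExp m k F w = G.pathExp m k F' w :=
  le_antisymm (G.pathExp_le fun w' h1 h2 => (h w' h1 h2).le)
    (G.pathExp_le fun w' h1 h2 => (h w' h1 h2).ge)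

theorem pathExp_const (hG : ∀ v, (G.out v).Nonempty) (m k : ℕ) (c : ℝ) (w : ℕ → V) :
    G.pathExp m k (fun _ => c) w = c := by
  induction k generalizing m w with
  | zero => rfl
  | succ k ih => simp only [pathExp_succ, ih, G.avg_const (hG _)]

theorem pathExp_nonneg {m k : ℕ} {F : (ℕ → V) → ℝ} {w : ℕ → V}
    (h : ∀ w', (∀ i ≤ m, w' i = w i) → G.IsPath m k w' → 0 ≤ F w') :
    0 ≤ G.pathExp m k F w :=
  (map_fun_zero (G.pathExp m k) w).ge.trans (G.pathExp_le h)

theorem dependsOn_pathExp {a m k : ℕ} {F : (ℕ → V) → ℝ} (h : DependsOn F (Set.Icc a (m + k)))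
    (ha : a ≤ m) : DependsOn (G.pathExp m k F) (Set.Icc a m) := by
  induction k generalizing m with
  | zero => exact h
  | succ k ih =>
    intro w w' hw
    rw [pathExp_succ, pathExp_succ, hw m ⟨ha, le_rfl⟩]
    refine G.avg_congr fun e _ => ?_
    refine ih (m := m + 1) (by rwa [add_right_comm, add_assoc]) (by omega) fun i hi => ?_
    rcases eq_or_ne i (m + 1) with rfl | hne
    · simp
    · rw [Function.update_of_ne hne, Function.update_of_ne hne]
      exact hw i ⟨hi.1, by have := hi.2; omega⟩

theorem pathExp_add (m k l : ℕ) (F : (ℕ → V) → ℝ) :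
    G.pathExp m (k + l) F = G.pathExp m k (G.pathExp (m + k) l F) := by
  induction k generalizing m with
  | zero => simp
  | succ k ih =>
    ext w
    rw [add_right_comm, pathExp_succ, pathExp_succ, ih, add_right_comm m 1 k, add_assoc m k 1]

theorem pathExp_split {m n : ℕ} (hmn : m ≤ n) (F : (ℕ → V) → ℝ) :
    G.pathExp 0 n F = G.pathExp 0 m (G.pathExp m (n - m) F) := by
  conv_lhs => rw [← Nat.add_sub_cancel' hmn, pathExp_add, zero_add]

theorem pathExp_mul_left {m k : ℕ} {H F : (ℕ → V) → ℝ} (hH : DependsOn H (Set.Iic m))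
    (w : ℕ → V) :
    G.pathExp m k (fun w => H w * F w) w = H w * G.pathExp m k F w := by
  rw [← map_fun_const_mul]
  exact G.pathExp_congr fun w' hw' _ => by rw [hH hw']

theorem pathExp_of_dependsOn (hG : ∀ v, (G.out v).Nonempty) {m k : ℕ} {H : (ℕ → V) → ℝ}
    (hH : DependsOn H (Set.Iic m)) (w : ℕ → V) : G.pathExp m k H w = H w := by
  simpa [pathExp_const G hG] using G.pathExp_mul_left (k := k) (F := fun _ => 1) hH w

theorem pathExp_zero_of_dependsOn (hG : ∀ v, (G.out v).Nonempty) {m n : ℕ} (hmn : m ≤ n)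
    {H : (ℕ → V) → ℝ} (hH : DependsOn H (Set.Iic m)) (w : ℕ → V) :
    G.pathExp 0 n H w = G.pathExp 0 m H w := by
  rw [G.pathExp_split hmn]
  exact G.pathExp_congr fun w' _ _ => G.pathExp_of_dependsOn hG hH w'

theorem pathExp_comp_apply (m k : ℕ) (f : V → ℝ) (w : ℕ → V) :
    G.pathExp m k (fun w => f (w (m + k))) w = (G.avg ^ k) f (w m) := by
  induction k generalizing m w with
  | zero => rfl
  | succ k ih =>
    rw [pathExp_succ, avg_pow_succ_apply]
    refine G.avg_congr fun e _ => ?_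
    have := ih (m + 1) (Function.update w (m + 1) (G.tgt e))
    rwa [Function.update_self, add_right_comm m 1 k] at this

end PathExpectation

section MaximalInequality

variable (hG : ∀ v, (G.out v).Nonempty) {n : ℕ} {F : (ℕ → V) → ℝ} (hF : DependsOn F (Set.Iic n))

include hF in
theorem dependsOn_abs_pathExp {m : ℕ} (hm : m ≤ n) :
    DependsOn (fun w => |G.pathExp m (n - m) F w|) (Set.Iic m) := fun w w' hw => by
  have hd : DependsOn F (Set.Icc 0 (m + (n - m))) := by
    rwa [Nat.add_sub_cancel' hm, ← bot_eq_zero, Set.Icc_bot]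
  exact congrArg _ (G.dependsOn_pathExp hd m.zero_le fun i hi => hw i hi.2)

include hG hF

theorem abs_pathExp_le_pathExp_abs {m : ℕ} (hm : m + 1 ≤ n) (w : ℕ → V) :
    |G.pathExp m (n - m) F w| ≤
      G.pathExp m (n - m) (fun w => |G.pathExp (m + 1) (n - (m + 1)) F w|) w := by
  have hsplit : n - m = 1 + (n - (m + 1)) := by omega
  rw [hsplit, pathExp_add, pathExp_add, G.pathExp_congr fun w' _ _ =>
    G.pathExp_of_dependsOn hG (G.dependsOn_abs_pathExp hF hm) w', abs_le]
  constructor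
  · rw [neg_le, ← neg_one_mul, ← map_fun_const_mul]
    exact G.pathExp_le fun w' _ _ => by rw [neg_one_mul]; exact neg_le_abs _
  · exact G.pathExp_le fun w' _ _ => le_abs_self _

theorem pathExp_sq_partialSups_le (w : ℕ → V) :
    G.pathExp 0 n (fun w => partialSups (fun m => |G.pathExp m (n - m) F w|) n ^ 2) w ≤
      4 * G.pathExp 0 n (fun w => F w ^ 2) w := by
  set S : ℕ → (ℕ → V) → ℝ := fun m w => |G.pathExp m (n - m) F w|
  have submartingale : ∀ m ∈ Finset.range n, 0 ≤ G.pathExp 0 n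
      (fun w => partialSups (fun m => S m w) m * (S (m + 1) w - S m w)) w := by
    intro m hm
    have hmn : m + 1 ≤ n := Finset.mem_range.1 hm
    have hmax : DependsOn (fun w => partialSups (fun m => S m w) m) (Set.Iic m) :=
      fun w w' hw => by
        simp only [partialSups_apply]
        exact Finset.sup'_congr _ rfl fun i hi => G.dependsOn_abs_pathExp hF
          ((Finset.mem_Iic.1 hi).trans (by omega)) fun j hj =>
            hw j (le_trans hj (Finset.mem_Iic.1 hi))
    rw [G.pathExp_split (by omega : m ≤ n)]
    refine G.pathExp_nonneg fun w' _ _ => ?_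
    rw [G.pathExp_mul_left hmax, map_fun_sub,
      G.pathExp_of_dependsOn hG (G.dependsOn_abs_pathExp hF (by omega))]
    refine mul_nonneg ((abs_nonneg _).trans
      (le_partialSups_of_le (fun m => S m w') m.zero_le)) (sub_nonneg.2 ?_)
    exact G.abs_pathExp_le_pathExp_abs hG hF hmn w'
  have pathwise := G.pathExp_le (m := 0) (k := n) (w := w) fun w' _ _ =>
    sq_partialSups_add_le (fun m => |G.pathExp m (n - m) F w'|) n
  simp only [map_fun_add, map_fun_const_mul, map_fun_sum, Nat.sub_self, pathExp_zero,
    sq_abs] at pathwise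
  linarith [Finset.sum_nonneg submartingale]

end MaximalInequality

section HittingProbability

open Classical in
/-- The probability that the walk from `v` visits `A` by time `N`. -/
noncomputable def hitProb (A : Set V) : ℕ → V → ℝ
  | 0, v => if v ∈ A then 1 else 0
  | N + 1, v => if v ∈ A then 1 else G.avg (hitProb A N) v

theorem hitProb_of_mem {A : Set V} (N : ℕ) {v : V} (h : v ∈ A) : G.hitProb A N v = 1 := by
  cases N <;> simp [hitProb, h]

theorem hitProb_zero_of_notMem {A : Set V} {v : V} (h : v ∉ A) : G.hitProb A 0 v = 0 := by
  simp [hitProb, h]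

theorem hitProb_succ_of_notMem {A : Set V} (N : ℕ) {v : V} (h : v ∉ A) :
    G.hitProb A (N + 1) v = G.avg (G.hitProb A N) v := by
  simp [hitProb, h]

theorem hitProb_nonneg (A : Set V) (N : ℕ) (v : V) : 0 ≤ G.hitProb A N v := by
  induction N generalizing v with
  | zero => by_cases h : v ∈ A <;> simp [hitProb, h]
  | succ N ih =>
    by_cases h : v ∈ A
    · simp [hitProb, h]
    · rw [hitProb_succ_of_notMem G N h]
      exact G.avg_nonneg ih v

theorem hitProb_le_one (hG : ∀ v, (G.out v).Nonempty) (A : Set V) (N : ℕ) (v : V) :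
    G.hitProb A N v ≤ 1 := by
  induction N generalizing v with
  | zero => by_cases h : v ∈ A <;> simp [hitProb, h]
  | succ N ih =>
    by_cases h : v ∈ A
    · simp [hitProb, h]
    · rw [hitProb_succ_of_notMem G N h, ← G.avg_const (hG v) 1]
      exact G.avg_le_avg fun e _ => ih _

theorem hitProb_le_succ (A : Set V) (N : ℕ) (v : V) :
    G.hitProb A N v ≤ G.hitProb A (N + 1) v := by
  induction N generalizing v with
  | zero =>
    by_cases h : v ∈ A
    · simp [hitProb, h]
    · rw [hitProb_zero_of_notMem G h]
      exact G.hitProb_nonneg A 1 v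
  | succ N ih =>
    by_cases h : v ∈ A
    · simp [hitProb, h]
    · rw [hitProb_succ_of_notMem G N h, hitProb_succ_of_notMem G _ h]
      exact G.avg_le_avg fun e _ => ih _

theorem monotone_hitProb (A : Set V) (v : V) : Monotone fun N => G.hitProb A N v :=
  monotone_nat_of_le_succ fun N => G.hitProb_le_succ A N v

open Classical in
theorem pathExp_hit (hG : ∀ v, (G.out v).Nonempty) (A : Set V) (m N : ℕ) (w : ℕ → V) :
    G.pathExp m N (fun w => if ∃ t, m ≤ t ∧ t ≤ m + N ∧ w t ∈ A then 1 else 0) w =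
      G.hitProb A N (w m) := by
  induction N generalizing m w with
  | zero =>
    have visits : (∃ t, m ≤ t ∧ t ≤ m + 0 ∧ w t ∈ A) ↔ w m ∈ A :=
      ⟨fun ⟨t, h1, h2, h3⟩ => by rwa [← Nat.le_antisymm h1 h2] at h3,
        fun h => ⟨m, le_rfl, le_rfl, h⟩⟩
    simp only [pathExp_zero, hitProb, visits]
  | succ N ih =>
    by_cases h : w m ∈ A
    · rw [hitProb_of_mem G _ h]
      refine (G.pathExp_congr fun w' hw' _ => ?_).trans (G.pathExp_const hG m (N + 1) 1 w)
      exact if_pos ⟨m, le_rfl, by omega, by rwa [hw' m le_rfl]⟩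
    · rw [hitProb_succ_of_notMem G N h, pathExp_succ]
      refine G.avg_congr fun e _ => ?_
      have hnext := ih (m + 1) (Function.update w (m + 1) (G.tgt e))
      rw [Function.update_self] at hnext
      rw [← hnext]
      refine G.pathExp_congr fun w' hw' _ => if_congr (Iff.intro ?_ ?_) rfl rfl
      · rintro ⟨t, h1, h2, h3⟩
        refine ⟨t, Nat.lt_of_le_of_ne h1 ?_, by omega, h3⟩
        rintro rfl
        rw [hw' m (by omega), Function.update_of_ne (by omega)] at h3
        exact h h3
      · rintro ⟨t, h1, h2, h3⟩
        exact ⟨t, by omega, by omega, h3⟩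

end HittingProbability

section Ball

open Classical in
/-- The vertices within graph distance `n` of `x`: the range of the walk up to time `n`. -/
noncomputable def ball (x : V) : ℕ → Finset V
  | 0 => {x}
  | n + 1 => ball x n ∪ (ball x n).biUnion fun v => (G.out v).image G.tgt

theorem self_mem_ball (x : V) (n : ℕ) : x ∈ G.ball x n := by
  induction n with
  | zero => simp [ball]
  | succ n ih => simp [ball, ih]

theorem ball_mono (x : V) : Monotone (G.ball x) :=
  monotone_nat_of_le_succ fun n => by classical rw [ball]; exact Finset.subset_union_left

theorem tgt_mem_ball_succ {x : V} {n : ℕ} {v : V} (hv : v ∈ G.ball x n) {e : E}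
    (he : e ∈ G.out v) : G.tgt e ∈ G.ball x (n + 1) := by
  classical
  rw [ball, Finset.mem_union]
  exact Or.inr (Finset.mem_biUnion.2 ⟨v, hv, Finset.mem_image_of_mem _ he⟩)

theorem ball_subset_ball {x v : V} {m : ℕ} (hv : v ∈ G.ball x m) (k : ℕ) :
    G.ball v k ⊆ G.ball x (m + k) := by
  classical
  induction k with
  | zero => exact Finset.singleton_subset_iff.2 hv
  | succ k ih =>
    rw [ball, ← add_assoc]
    refine Finset.union_subset (ih.trans (G.ball_mono x (m + k).le_succ)) fun u hu => ?_
    obtain ⟨z, hz, hu⟩ := Finset.mem_biUnion.1 hu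
    obtain ⟨e, he, rfl⟩ := Finset.mem_image.1 hu
    exact G.tgt_mem_ball_succ (ih hz) he

theorem ball_tgt_subset {v : V} {e : E} (he : e ∈ G.out v) (k : ℕ) :
    G.ball (G.tgt e) k ⊆ G.ball v (k + 1) :=
  add_comm 1 k ▸ G.ball_subset_ball (G.tgt_mem_ball_succ (G.self_mem_ball v 0) he) k

theorem IsPath.mem_ball {G : Network V E} {n : ℕ} {w : ℕ → V} (h : G.IsPath 0 n w) {i : ℕ}
    (hi : i ≤ n) : w i ∈ G.ball (w 0) i := by
  induction i with
  | zero => exact G.self_mem_ball _ _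
  | succ i ih =>
    obtain ⟨e, he, hte⟩ := h i (by omega) (by omega)
    rw [← hte]
    exact G.tgt_mem_ball_succ (ih (by omega)) he

theorem pathExp_le_of_mem_ball {x : V} {n : ℕ} {F F' : (ℕ → V) → ℝ}
    (h : ∀ w, (∀ m ≤ n, w m ∈ G.ball x m) → F w ≤ F' w) :
    G.pathExp 0 n F (fun _ => x) ≤ G.pathExp 0 n F' (fun _ => x) :=
  G.pathExp_le fun w hw hp => h w fun m hm => by
    have := hp.mem_ball hm
    rwa [hw 0 le_rfl] at this

theorem pathExp_congr_of_mem_ball {x : V} {n : ℕ} {F F' : (ℕ → V) → ℝ}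
    (h : ∀ w, (∀ m ≤ n, w m ∈ G.ball x m) → F w = F' w) :
    G.pathExp 0 n F (fun _ => x) = G.pathExp 0 n F' (fun _ => x) :=
  le_antisymm (G.pathExp_le_of_mem_ball fun w hw => (h w hw).le)
    (G.pathExp_le_of_mem_ball fun w hw => (h w hw).ge)

end Ball

end Network

theorem integral_traj_eq_integral_integral_traj_succ {X : ℕ → Type*} {F : Type*}
    [∀ n, MeasurableSpace (X n)] [NormedAddCommGroup F] [NormedSpace ℝ F]
    (κ : (n : ℕ) → Kernel (Π i : Finset.Iic n, X i) (X (n + 1))) [∀ n, IsMarkovKernel (κ n)] {m : ℕ}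
    {r : Π i : Finset.Iic m, X i} {f : (Π n, X n) → F} (hf : StronglyMeasurable f)
    (hf_int : Integrable f (Kernel.traj κ m r)) :
    ∫ y, f y ∂Kernel.traj κ m r =
      ∫ y, ∫ z, f z ∂Kernel.traj κ (m + 1) (Preorder.frestrictLe (m + 1)
        (Function.updateFinset y (Finset.Iic m) r)) ∂Kernel.traj κ m r := by
  have hmeas : StronglyMeasurable fun r => ∫ z, f z ∂Kernel.traj κ (m + 1) r :=
    hf.integral_kernel
  rw [← Kernel.integral_traj_partialTraj m.le_succ hf_int, ← Kernel.traj_map_frestrictLe_apply,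
    integral_map (Preorder.measurable_frestrictLe _).aemeasurable hmeas.aestronglyMeasurable]
  exact Kernel.integral_traj r
    (hmeas.comp_measurable (Preorder.measurable_frestrictLe _)).aestronglyMeasurable

namespace Network

variable {V E : Type*} (G : Network V E) [MeasurableSpace V]

theorem integral_stepLaw [DiscreteMeasurableSpace V] (hG : ∀ v, (G.out v).Nonempty) (f : V → ℝ)
    (v : V) : ∫ u, f u ∂G.stepLaw v = G.avg f v := by
  rw [stepLaw, if_pos (hG v), integral_finsetSum_measure, avg_apply, Finset.sum_div]
  · refine Finset.sum_congr rfl fun e _ => ?_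
    rw [integral_smul_measure, integral_dirac, ENNReal.toReal_ofReal, smul_eq_mul]
    · ring
    · exact div_nonneg (G.cond_pos e).le (G.vertexCond_nonneg v)
  · intro e _
    exact (integrable_dirac (by finiteness)).smul_measure ENNReal.ofReal_ne_top

variable [DiscreteMeasurableSpace V]

instance (x : V) : IsProbabilityMeasure (G.walkLaw x) := by
  unfold walkLaw; infer_instance

theorem integral_traj (hG : ∀ v, (G.out v).Nonempty) {m k : ℕ} {F : (ℕ → V) → ℝ}
    (hF : Measurable F) {C : ℝ} (hC : ∀ w, |F w| ≤ C) (hdep : DependsOn F (Set.Iic (m + k)))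
    (w : ℕ → V) :
    ∫ y, F y ∂Kernel.traj (X := fun _ => V) G.stepKernel m (Preorder.frestrictLe m w) =
      G.pathExp m k F w := by
  induction k generalizing m w with
  | zero =>
    rw [Kernel.integral_traj _ hF.aestronglyMeasurable]
    have hconst : ∀ y, F (Function.updateFinset y (Finset.Iic m) (Preorder.frestrictLe m w)) =
        F w := fun y => hdep fun i hi => by
      have : i ≤ m := hi
      simp [Function.updateFinset, this]
    simp [hconst]
  | succ k ih =>
    rw [add_comm k, ← add_assoc] at hdep
    have hnext : ∀ y, G.pathExp (m + 1) k F
        (Function.updateFinset y (Finset.Iic m) (Preorder.frestrictLe m w)) =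
          G.pathExp (m + 1) k F (Function.update w (m + 1) (y (m + 1))) := fun y => by
      refine G.dependsOn_pathExp (hdep.mono fun i hi => ⟨i.zero_le, hi⟩) (m + 1).zero_le
        fun i hi => ?_
      rcases eq_or_ne i (m + 1) with rfl | hne
      · simp [Function.updateFinset]
      · have : i ≤ m := by have := hi.2; omega
        simp [Function.updateFinset, hne, this]
    have hstep := Kernel.map_traj_succ_self (X := fun _ => V) (κ := G.stepKernel) (a := m)
    rw [integral_traj_eq_integral_integral_traj_succ _ hF.stronglyMeasurable
      (Integrable.of_bound hF.aestronglyMeasurable C (ae_of_all _ hC)), pathExp_succ]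
    simp only [ih hdep, hnext]
    rw [← G.integral_stepLaw hG, ← integral_map (φ := fun y : ℕ → V => y (m + 1))
      (f := fun u => G.pathExp (m + 1) k F (Function.update w (m + 1) u))
      (measurable_pi_apply _).aemeasurable Measurable.of_discrete.aestronglyMeasurable,
      ← Kernel.map_apply _ (measurable_pi_apply _), hstep]
    rfl

theorem integral_walkLaw_of_measurable (hG : ∀ v, (G.out v).Nonempty) (x : V) {n : ℕ}
    {F : (ℕ → V) → ℝ} (hF : Measurable F) {C : ℝ} (hC : ∀ w, |F w| ≤ C)
    (hdep : DependsOn F (Set.Iic n)) :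
    ∫ w, F w ∂G.walkLaw x = G.pathExp 0 n F fun _ => x :=
  G.integral_traj hG hF hC (by rwa [zero_add]) fun _ => x

theorem ae_walkLaw_mem_ball (hG : ∀ v, (G.out v).Nonempty) (x : V) (n : ℕ) :
    ∀ᵐ w ∂G.walkLaw x, ∀ i ≤ n, w i ∈ G.ball x n := by
  let S : Set (ℕ → V) := {w | ∀ i ≤ n, w i ∈ G.ball x n}
  have hmeas : MeasurableSet S := by
    have hS : S = ⋂ i ≤ n, (fun w : ℕ → V => w i) ⁻¹' G.ball x n := by
      ext w
      simp only [Set.mem_iInter]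
      rfl
    rw [hS]
    exact .iInter fun i => .iInter fun _ => measurable_pi_apply i .of_discrete
  have hdep : DependsOn (S.indicator (1 : (ℕ → V) → ℝ)) (Set.Iic n) := fun w w' h => by
    have : w ∈ S ↔ w' ∈ S := forall₂_congr fun i hi => by rw [h i hi]
    classical simp only [Set.indicator_apply, this, Pi.one_apply]
  have hbound : ∀ w, |S.indicator (1 : (ℕ → V) → ℝ) w| ≤ 1 := fun w => by
    by_cases h : w ∈ S <;> simp [h]
  have hone : (G.walkLaw x).real S = 1 := by
    rw [← integral_indicator_one hmeas, G.integral_walkLaw_of_measurable hG x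
      (measurable_one.indicator hmeas) hbound hdep, ← G.pathExp_const hG 0 n 1 fun _ => x]
    refine G.pathExp_congr fun w hw hp => Set.indicator_of_mem (fun i hi => ?_) 1
    exact G.ball_mono x hi (hw 0 le_rfl ▸ hp.mem_ball hi)
  refine (mem_ae_iff_prob_eq_one hmeas).2 ?_
  rwa [measureReal_def, ENNReal.toReal_eq_one_iff] at hone

theorem exists_measurable_eqOn {n : ℕ} {F : (ℕ → V) → ℝ} (hF : DependsOn F (Set.Iic n))
    (B : Finset V) :
    ∃ F' : (ℕ → V) → ℝ, Measurable F' ∧ (∃ C, ∀ w, |F' w| ≤ C) ∧ DependsOn F' (Set.Iic n) ∧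
      ∀ w, (∀ i ≤ n, w i ∈ B) → F w = F' w := by
  obtain ⟨f, rfl⟩ := dependsOn_iff_exists_comp.1 hF
  set T : Set (Set.Iic n → V) := Set.univ.pi fun _ => (B : Set V)
  have hT : T.Finite := Set.Finite.pi fun _ => B.finite_toSet
  obtain ⟨C, hC⟩ := (hT.image fun r => |f r|).bddAbove
  have hmeas : Measurable (T.indicator f) :=
    (measurable_const (a := (0 : ℝ))).measurable_of_countable_ne <| hT.countable.mono fun r hr =>
      Set.mem_of_indicator_ne_zero (Ne.symm hr)
  refine ⟨T.indicator f ∘ (Set.Iic n).domRestrict, hmeas.comp (by fun_prop), ⟨max C 0, fun w => ?_⟩,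
    fun w w' h => congrArg (T.indicator f) (funext fun i => h i.1 i.2), fun w hw => ?_⟩
  · by_cases h : (Set.Iic n).domRestrict w ∈ T
    · simp only [Function.comp_apply, Set.indicator_of_mem h]
      exact le_max_of_le_left (hC (Set.mem_image_of_mem _ h))
    · simp [h]
  · have h : (Set.Iic n).domRestrict w ∈ T := fun i _ => hw i.1 i.2
    simp only [Function.comp_apply, Set.indicator_of_mem h]

theorem integral_walkLaw (hG : ∀ v, (G.out v).Nonempty) (x : V) {n : ℕ} {F : (ℕ → V) → ℝ}
    (hF : DependsOn F (Set.Iic n)) :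
    AEStronglyMeasurable F (G.walkLaw x) ∧
      ∫ w, F w ∂G.walkLaw x = G.pathExp 0 n F fun _ => x := by
  obtain ⟨F', hmeas, ⟨C, hC⟩, hF', heq⟩ := exists_measurable_eqOn hF (G.ball x n)
  have hae : F =ᵐ[G.walkLaw x] F' := (G.ae_walkLaw_mem_ball hG x n).mono heq
  refine ⟨⟨F', hmeas.stronglyMeasurable, hae⟩, ?_⟩
  rw [integral_congr_ae hae, G.integral_walkLaw_of_measurable hG x hmeas hC hF']
  refine G.pathExp_congr fun w hw hp => (heq w fun i hi => ?_).symm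
  exact G.ball_mono x hi (hw 0 le_rfl ▸ hp.mem_ball hi)

theorem integral_eq_pathExp (hG : ∀ v, (G.out v).Nonempty) {x : V} {Ω : Type*}
    [MeasurableSpace Ω] {P : Measure Ω} {X : ℕ → Ω → V}
    (hX : HasLaw (fun ω t => X t ω) (G.walkLaw x) P) {n : ℕ} {F : (ℕ → V) → ℝ}
    (hF : DependsOn F (Set.Iic n)) :
    ∫ ω, F (fun t => X t ω) ∂P = G.pathExp 0 n F fun _ => x := by
  rw [← (G.integral_walkLaw hG x hF).2]
  exact hX.integral_comp (G.integral_walkLaw hG x hF).1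

theorem IsTransient.out_nonempty {G : Network V E} (h : G.IsTransient) (v : V) :
    (G.out v).Nonempty := by
  by_contra hv
  have stays : G.walkLaw v ((fun w : ℕ → V => w 1) ⁻¹' {v}ᶜ) = 0 := by
    have hstep := congrArg (fun κ => κ (fun _ => v) {v}ᶜ)
      (Kernel.map_traj_succ_self (X := fun _ : ℕ => V) (κ := G.stepKernel) (a := 0))
    rw [Kernel.map_apply' _ (measurable_pi_apply _) _ .of_discrete] at hstep
    refine hstep.trans ?_
    change G.stepLaw v {v}ᶜ = 0
    rw [stepLaw, if_neg hv, Measure.dirac_apply' _ .of_discrete]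
    simp
  refine (h v).ne' ?_
  rw [escapeProb, measureReal_eq_zero_iff]
  exact measure_mono_null (fun w hw => hw 1 le_rfl) stays

theorem measurableSet_avoid (A : Set V) (k : ℕ) :
    MeasurableSet {w : ℕ → V | ∀ t, 1 ≤ t → t ≤ k → w t ∉ A} := by
  simp only [Set.ofPred_forall]
  exact .iInter fun t => .iInter fun _ => .iInter fun _ =>
    measurable_pi_apply (X := fun _ : ℕ => V) t (.of_discrete (s := Aᶜ))

theorem measureReal_avoid (hG : ∀ v, (G.out v).Nonempty) (A : Set V) (v : V) (k : ℕ) :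
    (G.walkLaw v).real {w | ∀ t, 1 ≤ t → t ≤ k + 1 → w t ∉ A} =
      1 - G.avg (G.hitProb A k) v := by
  classical
  have hdep : DependsOn ({w : ℕ → V | ∀ t, 1 ≤ t → t ≤ k + 1 → w t ∉ A}.indicator
      (1 : (ℕ → V) → ℝ)) (Set.Iic (k + 1)) := fun w w' h => by
    have : (∀ t, 1 ≤ t → t ≤ k + 1 → w t ∉ A) ↔ ∀ t, 1 ≤ t → t ≤ k + 1 → w' t ∉ A :=
      forall₃_congr fun t _ ht => by rw [h t ht]
    simp [Set.indicator_apply, this]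
  rw [← integral_indicator_one (measurableSet_avoid A (k + 1)), (G.integral_walkLaw hG v hdep).2,
    pathExp_succ, ← G.avg_const (hG v) 1, ← map_fun_sub]
  refine G.avg_congr fun e _ => ?_
  have hhit := G.pathExp_hit hG A 1 k (Function.update (fun _ => v) 1 (G.tgt e))
  rw [Function.update_self] at hhit
  rw [zero_add, ← hhit, ← G.pathExp_const hG 1 k 1 (Function.update (fun _ => v) 1 (G.tgt e)),
    ← map_fun_sub]
  refine G.pathExp_congr fun w _ _ => ?_
  rw [G.pathExp_const hG]
  have havoid : (w ∈ {w : ℕ → V | ∀ t, 1 ≤ t → t ≤ k + 1 → w t ∉ A}) ↔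
      ¬∃ t, 1 ≤ t ∧ t ≤ 1 + k ∧ w t ∈ A := by
    simp [add_comm 1 k]
  by_cases h : ∃ t, 1 ≤ t ∧ t ≤ 1 + k ∧ w t ∈ A
  · rw [if_pos h, Set.indicator_of_notMem (by rwa [havoid, not_not]), sub_self]
  · rw [if_neg h, Set.indicator_of_mem (havoid.2 h), Pi.one_apply, sub_zero]

theorem tendsto_escapeProb (hG : ∀ v, (G.out v).Nonempty) (A : Set V) (v : V) :
    Filter.Tendsto (fun k => 1 - G.avg (G.hitProb A k) v) Filter.atTop
      (nhds (G.escapeProb A v)) := by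
  have hset : {w : ℕ → V | ∀ t, 1 ≤ t → w t ∉ A} =
      ⋂ k : ℕ, {w | ∀ t, 1 ≤ t → t ≤ k + 1 → w t ∉ A} := by
    ext w
    simp only [Set.mem_ofPred_eq, Set.mem_iInter]
    exact ⟨fun h k t h1 _ => h t h1, fun h t h1 => h t t h1 (by omega)⟩
  simp_rw [← G.measureReal_avoid hG A v]
  rw [escapeProb, hset]
  exact (ENNReal.tendsto_toReal (measure_ne_top _ _)).comp
    (tendsto_measure_iInter_atTop (fun k => (measurableSet_avoid A (k + 1)).nullMeasurableSet)
      (fun k l hkl w hw t h1 h2 => hw t h1 (by omega)) ⟨0, measure_ne_top _ _⟩)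

theorem escapeProb_nonneg (A : Set V) (v : V) : 0 ≤ G.escapeProb A v := measureReal_nonneg

theorem escapeProb_le_one (A : Set V) (v : V) : G.escapeProb A v ≤ 1 := measureReal_le_one

end Network

/-! ### Potential theory of the killed walk -/

namespace Network

variable {V E : Type*} (G : Network V E)

theorem mem_out {e : E} {v : V} : e ∈ G.out v ↔ G.src e = v := by simp [out]

theorem tgt_rev (e : E) : G.tgt (G.rev e) = G.src e := by rw [← G.src_rev, G.rev_rev]

/-- The Laplacian of the network in which the walk is killed at each step with probability
`1 - lam`. -/
noncomputable def killedLap (lam : ℝ) : (V → ℝ) →ₗ[ℝ] V → ℝ where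
  toFun f u := G.vertexCond u * (f u - lam * G.avg f u)
  map_add' f g := by ext u; simp only [map_add, Pi.add_apply]; ring
  map_smul' c f := by
    ext u; simp only [map_smul, Pi.smul_apply, smul_eq_mul, RingHom.id_apply]; ring

theorem killedLap_apply (lam : ℝ) (f : V → ℝ) (u : V) :
    G.killedLap lam f u = G.vertexCond u * (f u - lam * G.avg f u) := rfl

theorem nonneg_of_killedLap_nonneg (hG : ∀ v, (G.out v).Nonempty) (W : Finset V) {lam : ℝ}
    (h0 : 0 ≤ lam) (h1 : lam < 1) {A : Set V} {f : V → ℝ} (hoff : ∀ u ∉ W, 0 ≤ f u)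
    (hA : ∀ u ∈ W, u ∈ A → 0 ≤ f u) (hQ : ∀ u ∈ W, u ∉ A → 0 ≤ G.killedLap lam f u) (u : V) :
    0 ≤ f u := by
  by_contra! hu
  have huW : u ∈ W := by by_contra h; exact absurd (hoff u h) (not_le.2 hu)
  obtain ⟨v, hvW, hv⟩ := W.exists_min_image f ⟨u, huW⟩
  have hv0 : f v < 0 := (hv u huW).trans_lt hu
  have hvA : v ∉ A := fun h => absurd (hA v hvW h) (not_le.2 hv0)
  have hmin : ∀ z, f v ≤ f z := fun z => by
    by_cases hz : z ∈ W
    · exact hv z hz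
    · exact hv0.le.trans (hoff z hz)
  have havg : f v ≤ G.avg f v := by
    rw [← G.avg_const (hG v) (f v)]
    exact G.avg_le_avg fun e _ => hmin _
  have hlap : 0 ≤ f v - lam * G.avg f v :=
    (mul_nonneg_iff_of_pos_left (G.vertexCond_pos (hG v))).1 (hQ v hvW hvA)
  nlinarith [mul_le_mul_of_nonneg_left havg h0]

section Dirichlet

variable (W : Finset V) (lam : ℝ) (A : Set V) (b : V → ℝ)

/-- The Dirichlet problem in `W` for the killed Laplacian, with obstacle `A`; the datum `b` serves
both as the values on `A` and as the Laplacian on `W \ A`. -/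
def SolvesDirichlet (f : V → ℝ) : Prop :=
  (∀ u ∉ W, f u = 0) ∧ ∀ u ∈ W, (u ∈ A → f u = b u) ∧ (u ∉ A → G.killedLap lam f u = b u)

/-- The solution of the Dirichlet problem, an arbitrary function if there is none. -/
noncomputable def dirichletSol : V → ℝ := Classical.epsilon (G.SolvesDirichlet W lam A b)

theorem solvesDirichlet_dirichletSol (hG : ∀ v, (G.out v).Nonempty) {lam : ℝ} (h0 : 0 ≤ lam)
    (h1 : lam < 1) : G.SolvesDirichlet W lam A b (G.dirichletSol W lam A b) := by
  classical
  refine Classical.epsilon_spec ?_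
  let ext : (W → ℝ) →ₗ[ℝ] V → ℝ := Function.ExtendByZero.linearMap ℝ Subtype.val
  have ext_mem : ∀ f (u : W), ext f u = f u := fun f u =>
    Subtype.val_injective.extend_apply f 0 u
  have ext_notMem : ∀ f, ∀ u ∉ W, ext f u = 0 := fun f u hu =>
    Function.extend_apply' (f := (Subtype.val : W → V)) f 0 u fun ⟨v, hv⟩ => hu (hv ▸ v.2)
  let L : (W → ℝ) →ₗ[ℝ] W → ℝ := LinearMap.pi fun u =>
    LinearMap.proj (u : V) ∘ₗ (if (u : V) ∈ A then LinearMap.id else G.killedLap lam) ∘ₗ ext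
  have L_mem : ∀ f (u : W), (u : V) ∈ A → L f u = ext f u := fun f u hu => by simp [L, hu]
  have L_notMem : ∀ f (u : W), (u : V) ∉ A → L f u = G.killedLap lam (ext f) u :=
    fun f u hu => by simp [L, hu]
  have nonneg : ∀ f, L f = 0 → ∀ u, 0 ≤ ext f u := fun f hf =>
    G.nonneg_of_killedLap_nonneg hG W h0 h1 (A := A) (fun u hu => (ext_notMem f u hu).ge)
      (fun u hu huA => (L_mem f ⟨u, hu⟩ huA).symm.trans (congrFun hf _) |>.ge)
      fun u hu huA => (L_notMem f ⟨u, hu⟩ huA).symm.trans (congrFun hf _) |>.ge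
  have injective : Function.Injective L := by
    refine (injective_iff_map_eq_zero L).2 fun f hf => funext fun u => ?_
    have hneg := nonneg (-f) (by rw [map_neg, hf, neg_zero]) u
    rw [ext_mem] at hneg
    exact le_antisymm (neg_nonneg.1 hneg) (ext_mem f u ▸ nonneg f hf u)
  obtain ⟨f, hf⟩ := LinearMap.injective_iff_surjective.1 injective fun u => b u
  exact ⟨ext f, ext_notMem f, fun u hu => ⟨fun huA => by rw [← L_mem f ⟨u, hu⟩ huA, hf],
    fun huA => by rw [← L_notMem f ⟨u, hu⟩ huA, hf]⟩⟩

end Dirichlet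

section DirichletForm

variable (W : Finset V) (lam : ℝ)

/-- The Dirichlet form of the killed walk in `W`. It is symmetric and nonnegative only on the
functions that vanish off `W`. -/
noncomputable def dirForm : (V → ℝ) →ₗ[ℝ] (V → ℝ) →ₗ[ℝ] ℝ :=
  LinearMap.mk₂ ℝ (fun f h => ∑ u ∈ W, f u * G.killedLap lam h u)
    (fun f g h => by simp [add_mul, Finset.sum_add_distrib])
    (fun c f h => by simp [mul_assoc, Finset.mul_sum])
    (fun f g h => by simp [mul_add, Finset.sum_add_distrib])
    fun c f h => by simp [mul_left_comm, Finset.mul_sum]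

theorem dirForm_apply (f h : V → ℝ) :
    G.dirForm W lam f h = ∑ u ∈ W, f u * G.killedLap lam h u := rfl

open Classical in
/-- The rate at which the killed walk leaves `W` or is killed. -/
noncomputable def killRate (u : V) : ℝ :=
  G.vertexCond u - lam * ∑ e ∈ G.out u with G.tgt e ∈ W, G.cond e

open Classical in
/-- The oriented edges inside `W`. -/
noncomputable def innerEdges : Finset E :=
  (W.biUnion G.out).filter fun e => G.tgt e ∈ W

variable {W lam}

theorem mem_innerEdges {e : E} : e ∈ G.innerEdges W ↔ G.src e ∈ W ∧ G.tgt e ∈ W := by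
  classical
  simp [innerEdges, mem_out]

theorem killRate_nonneg (h1 : lam ≤ 1) (u : V) : 0 ≤ G.killRate W lam u := by
  classical
  refine sub_nonneg.2 (le_trans ?_ (Finset.sum_le_sum_of_subset_of_nonneg
    (Finset.filter_subset (fun e => G.tgt e ∈ W) (G.out u)) fun e _ _ => (G.cond_pos e).le))
  exact mul_le_of_le_one_left (Finset.sum_nonneg fun e _ => (G.cond_pos e).le) h1

open Classical in
theorem sum_innerEdges (φ : E → ℝ) :
    ∑ e ∈ G.innerEdges W, φ e = ∑ u ∈ W, ∑ e ∈ G.out u with G.tgt e ∈ W, φ e := by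
  have : G.innerEdges W = W.biUnion fun u => (G.out u).filter fun e => G.tgt e ∈ W := by
    ext e; simp [mem_innerEdges, mem_out]
  rw [this, Finset.sum_biUnion]
  intro u _ v _ huv
  rw [Function.onFun, Finset.disjoint_left]
  intro e he he'
  simp only [Finset.mem_filter, mem_out] at he he'
  exact huv (he.1.symm.trans he'.1)

theorem sum_innerEdges_rev (φ : E → ℝ) :
    ∑ e ∈ G.innerEdges W, φ (G.rev e) = ∑ e ∈ G.innerEdges W, φ e := by
  refine Finset.sum_nbij' G.rev G.rev (fun e he => ?_) (fun e he => ?_) (fun e _ => G.rev_rev e)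
    (fun e _ => G.rev_rev e) fun e _ => rfl
  all_goals
    rw [mem_innerEdges] at he ⊢
    rw [G.src_rev, G.tgt_rev]
    exact he.symm

theorem sum_innerEdges_mul_sub (f h : V → ℝ) :
    ∑ e ∈ G.innerEdges W,
      G.cond e * ((f (G.src e) - f (G.tgt e)) * (h (G.src e) - h (G.tgt e))) =
        2 * ∑ e ∈ G.innerEdges W, G.cond e * (f (G.src e) * (h (G.src e) - h (G.tgt e))) := by
  have hrev := G.sum_innerEdges_rev (W := W)
    fun e => G.cond e * (f (G.src e) * (h (G.src e) - h (G.tgt e)))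
  simp only [G.cond_rev, G.src_rev, G.tgt_rev] at hrev
  rw [two_mul]
  nth_rw 2 [← hrev]
  rw [← Finset.sum_add_distrib]
  exact Finset.sum_congr rfl fun e _ => by ring

open Classical in
theorem mul_killedLap (f : V → ℝ) {h : V → ℝ} (hh : ∀ u ∉ W, h u = 0) (u : V) :
    f u * G.killedLap lam h u = G.killRate W lam u * (f u * h u) +
      lam * ∑ e ∈ G.out u with G.tgt e ∈ W,
        G.cond e * (f (G.src e) * (h (G.src e) - h (G.tgt e))) := by
  have hsum : ∑ e ∈ G.out u, G.cond e * h (G.tgt e) =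
      ∑ e ∈ G.out u with G.tgt e ∈ W, G.cond e * h (G.tgt e) := by
    rw [Finset.sum_filter]
    refine Finset.sum_congr rfl fun e _ => ?_
    split_ifs with hW
    · rfl
    · rw [hh _ hW, mul_zero]
  have hinner : ∑ e ∈ G.out u with G.tgt e ∈ W,
      G.cond e * (f (G.src e) * (h (G.src e) - h (G.tgt e))) =
      f u * h u * ∑ e ∈ G.out u with G.tgt e ∈ W, G.cond e -
        f u * ∑ e ∈ G.out u with G.tgt e ∈ W, G.cond e * h (G.tgt e) := by
    rw [Finset.mul_sum, Finset.mul_sum, ← Finset.sum_sub_distrib]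
    refine Finset.sum_congr rfl fun e he => ?_
    rw [Finset.mem_filter, mem_out] at he
    rw [he.1]; ring
  rw [killedLap_apply, mul_sub, mul_left_comm _ lam, vertexCond_mul_avg, killRate, hsum, hinner]
  ring

theorem dirForm_eq (f : V → ℝ) {h : V → ℝ} (hh : ∀ u ∉ W, h u = 0) :
    G.dirForm W lam f h = ∑ u ∈ W, G.killRate W lam u * (f u * h u) +
      lam / 2 * ∑ e ∈ G.innerEdges W, G.cond e *
        ((f (G.src e) - f (G.tgt e)) * (h (G.src e) - h (G.tgt e))) := by
  classical
  rw [dirForm_apply, Finset.sum_congr rfl fun u _ => G.mul_killedLap f hh u,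
    Finset.sum_add_distrib, ← Finset.mul_sum, ← sum_innerEdges, sum_innerEdges_mul_sub]
  ring

theorem dirForm_comm {f h : V → ℝ} (hf : ∀ u ∉ W, f u = 0) (hh : ∀ u ∉ W, h u = 0) :
    G.dirForm W lam f h = G.dirForm W lam h f := by
  rw [dirForm_eq G f hh, dirForm_eq G h hf]
  simp only [mul_comm (f _) (h _), mul_comm (f _ - f _) (h _ - h _)]

theorem dirForm_self_nonneg (h0 : 0 ≤ lam) (h1 : lam ≤ 1) {f : V → ℝ} (hf : ∀ u ∉ W, f u = 0) :
    0 ≤ G.dirForm W lam f f := by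
  rw [dirForm_eq G f hf]
  exact add_nonneg
    (Finset.sum_nonneg fun u _ => mul_nonneg (G.killRate_nonneg h1 u) (mul_self_nonneg _))
    (mul_nonneg (by positivity) (Finset.sum_nonneg fun e _ =>
      mul_nonneg (G.cond_pos e).le (mul_self_nonneg _)))

theorem two_mul_dirForm_le (h0 : 0 ≤ lam) (h1 : lam ≤ 1) {f h : V → ℝ}
    (hf : ∀ u ∉ W, f u = 0) (hh : ∀ u ∉ W, h u = 0) (t : ℝ) :
    2 * t * G.dirForm W lam f h ≤ G.dirForm W lam f f + t ^ 2 * G.dirForm W lam h h := by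
  have hnonneg := G.dirForm_self_nonneg (W := W) h0 h1 (f := f - t • h)
    fun u hu => by simp [hf u hu, hh u hu]
  simp only [map_sub, map_smul, LinearMap.sub_apply, LinearMap.smul_apply, smul_eq_mul,
    G.dirForm_comm hh hf] at hnonneg
  linarith

end DirichletForm

section Potentials

variable (W : Finset V) (lam : ℝ)

open Classical in
/-- The Green kernel of the killed walk in `W`, with pole `v`. -/
noncomputable def green (v : V) : V → ℝ := G.dirichletSol W lam ∅ (Pi.single v 1)

/-- The balayage of `f` onto `A` for the killed walk in `W`: the function that agrees with `f` on
`A`, is harmonic on `W \ A` and vanishes off `W`. -/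
noncomputable def balayage (A : Set V) (f : V → ℝ) : V → ℝ := G.dirichletSol W lam A (A.indicator f)

/-- The probability that the killed walk in `W` visits `A`. -/
noncomputable def killedHit (A : Set V) : V → ℝ := G.balayage W lam A 1

/-- The capacity for the killed walk in `W`. -/
noncomputable def killedCap (A : Set V) : ℝ :=
  G.dirForm W lam (G.killedHit W lam A) (G.killedHit W lam A)

variable {W lam} (hG : ∀ v, (G.out v).Nonempty) (h0 : 0 ≤ lam) (h1 : lam < 1)

include hG h0 h1

theorem green_of_notMem {u : V} (v : V) (hu : u ∉ W) : G.green W lam v u = 0 := by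
  classical
  exact (G.solvesDirichlet_dirichletSol W ∅ (Pi.single v 1) hG h0 h1).1 u hu

open Classical in
theorem killedLap_green (v : V) {u : V} (hu : u ∈ W) :
    G.killedLap lam (G.green W lam v) u = (Pi.single v 1 : V → ℝ) u :=
  ((G.solvesDirichlet_dirichletSol W ∅ (Pi.single v 1) hG h0 h1).2 u hu).2 (Set.notMem_empty u)

theorem killedLap_green_nonneg (v : V) {u : V} (hu : u ∈ W) :
    0 ≤ G.killedLap lam (G.green W lam v) u := by
  classical
  rw [G.killedLap_green hG h0 h1 v hu]
  exact (Pi.single_nonneg.2 zero_le_one : (0 : V → ℝ) ≤ Pi.single v 1) u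

theorem green_nonneg (v u : V) : 0 ≤ G.green W lam v u :=
  G.nonneg_of_killedLap_nonneg hG W h0 h1 (A := ∅)
    (fun _ hu => (G.green_of_notMem hG h0 h1 v hu).ge) (fun _ _ h => h.elim)
    (fun _ hu _ => G.killedLap_green_nonneg hG h0 h1 v hu) u

theorem dirForm_green (f : V → ℝ) {v : V} (hv : v ∈ W) :
    G.dirForm W lam f (G.green W lam v) = f v := by
  classical
  rw [dirForm_apply, Finset.sum_congr rfl fun u hu => by rw [G.killedLap_green hG h0 h1 v hu]]
  simp [Pi.single_apply, hv]

theorem green_comm {u v : V} (hu : u ∈ W) (hv : v ∈ W) :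
    G.green W lam u v = G.green W lam v u := by
  rw [← G.dirForm_green hG h0 h1 (G.green W lam u) hv,
    ← G.dirForm_green hG h0 h1 (G.green W lam v) hu]
  exact G.dirForm_comm (fun z hz => G.green_of_notMem hG h0 h1 u hz)
    fun z hz => G.green_of_notMem hG h0 h1 v hz

theorem balayage_of_notMem (A : Set V) (f : V → ℝ) {u : V} (hu : u ∉ W) :
    G.balayage W lam A f u = 0 :=
  (G.solvesDirichlet_dirichletSol W A (A.indicator f) hG h0 h1).1 u hu

theorem balayage_of_mem {A : Set V} (f : V → ℝ) {u : V} (hu : u ∈ W) (hA : u ∈ A) :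
    G.balayage W lam A f u = f u :=
  (((G.solvesDirichlet_dirichletSol W A (A.indicator f) hG h0 h1).2 u hu).1 hA).trans
    (Set.indicator_of_mem hA f)

theorem killedLap_balayage {A : Set V} (f : V → ℝ) {u : V} (hu : u ∈ W) (hA : u ∉ A) :
    G.killedLap lam (G.balayage W lam A f) u = 0 :=
  (((G.solvesDirichlet_dirichletSol W A (A.indicator f) hG h0 h1).2 u hu).2 hA).trans
    (Set.indicator_of_notMem hA f)

theorem balayage_nonneg (A : Set V) {f : V → ℝ} (hf : ∀ u, 0 ≤ f u) (u : V) :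
    0 ≤ G.balayage W lam A f u :=
  G.nonneg_of_killedLap_nonneg hG W h0 h1 (A := A)
    (fun _ hu => (G.balayage_of_notMem hG h0 h1 A f hu).ge)
    (fun _ hu hA => (hf _).trans (G.balayage_of_mem hG h0 h1 f hu hA).ge)
    (fun _ hu hA => (G.killedLap_balayage hG h0 h1 f hu hA).ge) u

theorem balayage_le {A : Set V} {f g : V → ℝ} (hg : ∀ u, 0 ≤ g u) (hA : ∀ u ∈ A, f u ≤ g u)
    (hQ : ∀ u ∈ W, u ∉ A → 0 ≤ G.killedLap lam g u) (u : V) : G.balayage W lam A f u ≤ g u := by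
  refine sub_nonneg.1 (G.nonneg_of_killedLap_nonneg hG W h0 h1 (A := A)
    (f := fun u => g u - G.balayage W lam A f u) (fun u hu => ?_) (fun u hu huA => ?_)
    (fun u hu huA => ?_) u)
  · rw [G.balayage_of_notMem hG h0 h1 A f hu, sub_zero]
    exact hg u
  · rw [G.balayage_of_mem hG h0 h1 f hu huA]
    exact sub_nonneg.2 (hA u huA)
  · rw [map_fun_sub, G.killedLap_balayage hG h0 h1 f hu huA, sub_zero]
    exact hQ u hu huA

theorem killedLap_balayage_nonneg (A : Set V) {f : V → ℝ} (hf : ∀ u, 0 ≤ f u)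
    (hQ : ∀ u ∈ W, 0 ≤ G.killedLap lam f u) {u : V} (hu : u ∈ W) :
    0 ≤ G.killedLap lam (G.balayage W lam A f) u := by
  by_cases hA : u ∈ A
  · refine (hQ u hu).trans ?_
    rw [killedLap_apply, killedLap_apply, G.balayage_of_mem hG h0 h1 f hu hA]
    gcongr
    · exact G.vertexCond_nonneg u
    · exact G.avg_le_avg fun e _ =>
        G.balayage_le hG h0 h1 hf (fun _ _ => le_rfl) (fun v hv _ => hQ v hv) _
  · rw [G.killedLap_balayage hG h0 h1 f hu hA]

theorem dirForm_balayage_congr {A : Set V} (f : V → ℝ) {g h : V → ℝ}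
    (hgh : ∀ u ∈ W, u ∈ A → g u = h u) :
    G.dirForm W lam g (G.balayage W lam A f) = G.dirForm W lam h (G.balayage W lam A f) := by
  refine Finset.sum_congr rfl fun u hu => ?_
  by_cases hA : u ∈ A
  · rw [hgh u hu hA]
  · rw [G.killedLap_balayage hG h0 h1 f hu hA, mul_zero, mul_zero]

theorem dirForm_balayage_le (A : Set V) {f g : V → ℝ} (hf : ∀ u, 0 ≤ f u)
    (hfW : ∀ u ∉ W, f u = 0) (hfQ : ∀ u ∈ W, 0 ≤ G.killedLap lam f u) (hgW : ∀ u ∉ W, g u = 0)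
    (hgQ : ∀ u ∈ W, 0 ≤ G.killedLap lam g u) :
    G.dirForm W lam g (G.balayage W lam A f) ≤ G.dirForm W lam g f := by
  rw [G.dirForm_comm hgW fun u => G.balayage_of_notMem hG h0 h1 A f, G.dirForm_comm hgW hfW]
  exact Finset.sum_le_sum fun u hu => mul_le_mul_of_nonneg_right
    (G.balayage_le hG h0 h1 hf (fun _ _ => le_rfl) (fun v hv _ => hfQ v hv) u) (hgQ u hu)

theorem killedHit_of_notMem (A : Set V) {u : V} (hu : u ∉ W) : G.killedHit W lam A u = 0 :=
  G.balayage_of_notMem hG h0 h1 A 1 hu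

theorem killedHit_of_mem {A : Set V} {u : V} (hu : u ∈ W) (hA : u ∈ A) :
    G.killedHit W lam A u = 1 :=
  G.balayage_of_mem hG h0 h1 1 hu hA

theorem killedLap_killedHit {A : Set V} {u : V} (hu : u ∈ W) (hA : u ∉ A) :
    G.killedLap lam (G.killedHit W lam A) u = 0 :=
  G.killedLap_balayage hG h0 h1 1 hu hA

theorem killedHit_nonneg (A : Set V) (u : V) : 0 ≤ G.killedHit W lam A u :=
  G.balayage_nonneg hG h0 h1 A (fun _ => zero_le_one) u

omit h0 in
theorem killedLap_one_nonneg (u : V) : 0 ≤ G.killedLap lam 1 u :=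
  mul_nonneg (G.vertexCond_nonneg u) <| sub_nonneg.2 <| by
    simpa [Pi.one_def, G.avg_const (hG _)] using h1.le

theorem killedHit_le_one (A : Set V) (u : V) : G.killedHit W lam A u ≤ 1 :=
  G.balayage_le hG h0 h1 (fun _ => zero_le_one) (fun _ _ => le_rfl)
    (fun u _ _ => G.killedLap_one_nonneg hG h1 u) u

theorem killedLap_killedHit_nonneg (A : Set V) {u : V} (hu : u ∈ W) :
    0 ≤ G.killedLap lam (G.killedHit W lam A) u :=
  G.killedLap_balayage_nonneg hG h0 h1 A (fun _ => zero_le_one)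
    (fun u _ => G.killedLap_one_nonneg hG h1 u) hu

theorem abs_killedLap_killedHit_le (A : Set V) (u : V) :
    |G.killedLap lam (G.killedHit W lam A) u| ≤ G.vertexCond u := by
  have avg_nonneg : 0 ≤ G.avg (G.killedHit W lam A) u :=
    G.avg_nonneg (G.killedHit_nonneg hG h0 h1 A) u
  have avg_le_one : G.avg (G.killedHit W lam A) u ≤ 1 :=
    (G.avg_le_avg fun _ _ => G.killedHit_le_one hG h0 h1 A _).trans_eq (G.avg_const (hG u) 1)
  have hit_nonneg := G.killedHit_nonneg hG h0 h1 (W := W) A u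
  have hit_le_one := G.killedHit_le_one hG h0 h1 (W := W) A u
  rw [killedLap_apply, abs_mul, abs_of_nonneg (G.vertexCond_nonneg u)]
  refine mul_le_of_le_one_right (G.vertexCond_nonneg u) (abs_le.2 ⟨?_, ?_⟩)
  · linarith [mul_le_one₀ h1.le avg_nonneg avg_le_one]
  · linarith [mul_nonneg h0 avg_nonneg]

theorem dirForm_killedHit (f : V → ℝ) {A : Finset V} (hA : A ⊆ W) :
    G.dirForm W lam f (G.killedHit W lam A) =
      ∑ u ∈ A, f u * G.killedLap lam (G.killedHit W lam A) u := by
  refine (Finset.sum_subset hA fun u hu huA => ?_).symm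
  rw [G.killedLap_killedHit hG h0 h1 hu huA, mul_zero]

theorem dirForm_killedHit_balayage {A B : Set V} (hAB : A ⊆ B) {f : V → ℝ}
    (hf : ∀ u ∉ W, f u = 0) :
    G.dirForm W lam (G.killedHit W lam B) (G.balayage W lam A f) =
      G.dirForm W lam (G.killedHit W lam A) f := by
  have off : ∀ u ∉ W, G.killedHit W lam A u = 0 := fun u => G.killedHit_of_notMem hG h0 h1 A
  calc G.dirForm W lam (G.killedHit W lam B) (G.balayage W lam A f)
      = G.dirForm W lam (G.killedHit W lam A) (G.balayage W lam A f) :=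
        G.dirForm_balayage_congr hG h0 h1 f fun u hu hA => by
          rw [G.killedHit_of_mem hG h0 h1 hu hA, G.killedHit_of_mem hG h0 h1 hu (hAB hA)]
    _ = G.dirForm W lam (G.balayage W lam A f) (G.killedHit W lam A) :=
        G.dirForm_comm off fun u => G.balayage_of_notMem hG h0 h1 A f
    _ = G.dirForm W lam f (G.killedHit W lam A) :=
        G.dirForm_balayage_congr hG h0 h1 1 fun u hu hA => G.balayage_of_mem hG h0 h1 f hu hA
    _ = G.dirForm W lam (G.killedHit W lam A) f := G.dirForm_comm hf off

theorem killedCap_eq {A : Finset V} (hA : A ⊆ W) :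
    G.killedCap W lam A = ∑ u ∈ A, G.killedLap lam (G.killedHit W lam A) u := by
  rw [killedCap, G.dirForm_killedHit hG h0 h1 _ hA]
  exact Finset.sum_congr rfl fun u hu => by
    rw [G.killedHit_of_mem hG h0 h1 (hA hu) hu, one_mul]

-- When `ψ` is the potential of a measure carried by `A`, this bounds the capacity of `A` from below
-- by the mass and the energy of the measure.
theorem le_killedCap (A : Set V) {ψ : V → ℝ} (hψ : ∀ u ∉ W, ψ u = 0) (t : ℝ) :
    2 * t * G.dirForm W lam (G.killedHit W lam A) ψ - t ^ 2 * G.dirForm W lam ψ ψ ≤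
      G.killedCap W lam A := by
  rw [sub_le_iff_le_add]
  exact G.two_mul_dirForm_le h0 h1.le (fun _ => G.killedHit_of_notMem hG h0 h1 A) hψ t

end Potentials

end Network

/-! ### The loop-erasure of a stopped path -/

section LoopErasure

variable {V : Type*}

theorem le_lastVisit (w : ℕ → V) {m i : ℕ} (hi : i ≤ m) : i ≤ lastVisit w m i := by
  classical exact Nat.le_findGreatest hi rfl

theorem lastVisit_le (w : ℕ → V) (m i : ℕ) : lastVisit w m i ≤ m := by
  classical exact Nat.findGreatest_le m

theorem apply_lastVisit (w : ℕ → V) {m i : ℕ} (hi : i ≤ m) : w (lastVisit w m i) = w i := by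
  classical exact Nat.findGreatest_spec (P := fun k => w k = w i) hi rfl

theorem dependsOn_lastVisit {m i : ℕ} (hi : i ≤ m) :
    DependsOn (fun w : ℕ → V => lastVisit w m i) (Set.Iic m) := by
  have le : ∀ {w w' : ℕ → V}, (∀ j ∈ Set.Iic m, w j = w' j) →
      lastVisit w m i ≤ lastVisit w' m i := by
    classical
    intro w w' h
    refine Nat.le_findGreatest (lastVisit_le w m i) ?_
    rw [← h _ (lastVisit_le w m i), ← h i hi]
    exact apply_lastVisit w hi
  exact fun w w' h => le_antisymm (le h) (le fun j hj => (h j hj).symm)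

theorem lastVisit_eq_of_forall_ne {w : ℕ → V} {m n i : ℕ} (hmn : m ≤ n) (hi : i ≤ m)
    (h : ∀ t, m ≤ t → t ≤ n → w t ≠ w i) : lastVisit w n i = lastVisit w m i := by
  classical
  refine le_antisymm (Nat.le_findGreatest ?_ (apply_lastVisit w (hi.trans hmn)))
    (Nat.le_findGreatest ((lastVisit_le w m i).trans hmn) (apply_lastVisit w hi))
  by_contra! hlt
  exact h _ hlt.le (lastVisit_le w n i) (apply_lastVisit w (hi.trans hmn))

theorem loopErasureTime_succ {w : ℕ → V} {m k l : ℕ} (h : loopErasureTime w m k = some l) :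
    loopErasureTime w m (k + 1) =
      if lastVisit w m l = m then none else some (1 + lastVisit w m l) := by
  rw [loopErasureTime, h, Option.bind_some]

theorem loopErasureTime_le {w : ℕ → V} {m k l : ℕ} (h : loopErasureTime w m k = some l) :
    l ≤ m := by
  cases k with
  | zero =>
    obtain rfl : 0 = l := Option.some.inj h
    exact m.zero_le
  | succ k =>
    obtain ⟨j, -, hj⟩ := Option.bind_eq_some_iff.1 h
    split_ifs at hj with hlast
    obtain rfl := Option.some.inj hj
    have := lastVisit_le w m j
    omega

theorem loopErasure_eq_some {w : ℕ → V} {m k l : ℕ} (h : loopErasureTime w m k = some l) :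
    loopErasure w m k = some (w l) := by
  rw [loopErasure, h, Option.map_some]

theorem dependsOn_loopErasureTime (m k : ℕ) :
    DependsOn (fun w : ℕ → V => loopErasureTime w m k) (Set.Iic m) := by
  intro w w' h
  induction k with
  | zero => rfl
  | succ k ih =>
    simp only [loopErasureTime, ← ih]
    refine Option.bind_congr fun l hl => ?_
    have hlast : lastVisit w m l = lastVisit w' m l :=
      dependsOn_lastVisit (loopErasureTime_le hl) h
    rw [hlast]

theorem dependsOn_loopErasure (m k : ℕ) :
    DependsOn (fun w : ℕ → V => loopErasure w m k) (Set.Iic m) := by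
  intro w w' h
  have htime : loopErasureTime w m k = loopErasureTime w' m k := dependsOn_loopErasureTime m k h
  simp only [loopErasure, ← htime]
  exact Option.map_congr fun l hl => h l (loopErasureTime_le hl)

theorem exists_loopErasure_eq_of_loopErasureTime {w : ℕ → V} {m k l : ℕ}
    (h : loopErasureTime w m k = some l) : ∃ k, loopErasure w m k = some (w m) := by
  have hl := loopErasureTime_le h
  by_cases hlast : lastVisit w m l = m
  · exact ⟨k, by rw [loopErasure_eq_some h, ← apply_lastVisit w hl, hlast]⟩
  · exact exists_loopErasure_eq_of_loopErasureTime
      ((loopErasureTime_succ h).trans (if_neg hlast))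
termination_by m - l
decreasing_by
  have := le_lastVisit w hl
  have := lastVisit_le w m l
  omega

theorem exists_loopErasure_eq_last (w : ℕ → V) (m : ℕ) : ∃ k, loopErasure w m k = some (w m) :=
  exists_loopErasure_eq_of_loopErasureTime (k := 0) rfl

/-- The first `k + 1` vertices of the loop-erasure of `w` stopped at time `m`. -/
def loopErasurePrefix (w : ℕ → V) (m k : ℕ) : Set V :=
  {v | ∃ i ≤ k, loopErasure w m i = some v}

theorem loopErasurePrefix_mono (w : ℕ → V) (m : ℕ) : Monotone (loopErasurePrefix w m) :=
  fun _ _ hkl _ ⟨i, hi, h⟩ => ⟨i, hi.trans hkl, h⟩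

theorem dependsOn_loopErasurePrefix (m k : ℕ) :
    DependsOn (fun w : ℕ → V => loopErasurePrefix w m k) (Set.Iic m) := fun w w' h => by
  have herasure : ∀ i, loopErasure w m i = loopErasure w' m i :=
    fun i => dependsOn_loopErasure m i h
  simp only [loopErasurePrefix, herasure]

/-- The least index on the loop-erasure of `w` stopped at time `m` that is visited by `w` between
the times `m` and `n`. -/
noncomputable def survivingIndex (w : ℕ → V) (m n : ℕ) : ℕ :=
  sInf {k | ∃ t, m ≤ t ∧ t ≤ n ∧ w t ∈ loopErasurePrefix w m k}

theorem survivingIndex_le_iff (w : ℕ → V) {m n : ℕ} (hmn : m ≤ n) (k : ℕ) :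
    survivingIndex w m n ≤ k ↔ ∃ t, m ≤ t ∧ t ≤ n ∧ w t ∈ loopErasurePrefix w m k := by
  refine ⟨fun h => ?_, fun h => Nat.sInf_le h⟩
  obtain ⟨k', hk'⟩ := exists_loopErasure_eq_last w m
  obtain ⟨t, hmt, htn, ht⟩ := Nat.sInf_mem
    (s := {k | ∃ t, m ≤ t ∧ t ≤ n ∧ w t ∈ loopErasurePrefix w m k})
    ⟨k', m, le_rfl, hmn, k', le_rfl, hk'⟩
  exact ⟨t, hmt, htn, loopErasurePrefix_mono w m h ht⟩

theorem loopErasureTime_eq_of_le_survivingIndex (w : ℕ → V) {m n i : ℕ} (hmn : m ≤ n)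
    (hi : i ≤ survivingIndex w m n) : loopErasureTime w n i = loopErasureTime w m i := by
  induction i with
  | zero => rfl
  | succ i ih =>
    specialize ih (by omega)
    cases hl : loopErasureTime w m i with
    | none => simp only [loopErasureTime, ih, hl, Option.bind_none]
    | some l =>
      have hlm := loopErasureTime_le hl
      have hne : ∀ t, m ≤ t → t ≤ n → w t ≠ w l := fun t hmt htn ht =>
        absurd ((survivingIndex_le_iff w hmn i).2 ⟨t, hmt, htn, i, le_rfl,
          by rw [loopErasure_eq_some hl, ht]⟩) (by omega)
      have hlast : lastVisit w m l ≠ m := fun h =>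
        hne m le_rfl hmn (by rw [← apply_lastVisit w hlm, h])
      have := lastVisit_le w m l
      rw [loopErasureTime_succ hl, loopErasureTime_succ (ih.trans hl),
        lastVisit_eq_of_forall_ne hmn hlm hne, if_neg hlast, if_neg (by omega)]

theorem mem_pathVertices {w : ℕ → V} {n : ℕ} {v : V} :
    v ∈ pathVertices w n ↔ ∃ i ≤ n, w i = v := by
  classical
  simp [pathVertices]

theorem pathVertices_subset_iff {w : ℕ → V} {n : ℕ} {W : Finset V} :
    pathVertices w n ⊆ W ↔ ∀ m ≤ n, w m ∈ W := by
  simp [Finset.subset_iff, mem_pathVertices]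

/-- The part of the loop-erasure of `w` stopped at time `m` up to its lowest vertex visited by `w`
between the times `m` and `n`: the part that survives in the loop-erasure at time `n`. -/
def survivingPrefix (w : ℕ → V) (m n : ℕ) : Set V := loopErasurePrefix w m (survivingIndex w m n)

theorem survivingPrefix_subset (w : ℕ → V) {m n : ℕ} (hmn : m ≤ n) :
    survivingPrefix w m n ⊆ loopErasureVertices w n := by
  classical
  rintro v ⟨i, hi, hv⟩
  have hv' : loopErasure w n i = some v := by
    rwa [loopErasure, loopErasureTime_eq_of_le_survivingIndex w hmn hi]
  obtain ⟨l, hl, hlv⟩ := Option.map_eq_some_iff.1 hv'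
  exact Finset.mem_filter.2 ⟨mem_pathVertices.2 ⟨l, loopErasureTime_le hl, hlv⟩, i, hv'⟩

theorem dependsOn_survivingPrefix {m n : ℕ} (hmn : m ≤ n) :
    DependsOn (fun w : ℕ → V => survivingPrefix w m n) (Set.Iic n) := fun w w' h => by
  have hprefix (k : ℕ) : loopErasurePrefix w m k = loopErasurePrefix w' m k :=
    dependsOn_loopErasurePrefix m k fun i hi => h i (le_trans hi hmn)
  have hindex : survivingIndex w m n = survivingIndex w' m n :=
    eq_of_forall_ge_iff fun k => by
      rw [survivingIndex_le_iff w hmn, survivingIndex_le_iff w' hmn, hprefix]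
      exact exists_congr fun t => and_congr_right fun _ => and_congr_right fun ht => by rw [h t ht]
  simp only [survivingPrefix, hprefix, hindex]

theorem loopErasureVertices_subset (w : ℕ → V) (n : ℕ) :
    loopErasureVertices w n ⊆ pathVertices w n := by
  classical exact Finset.filter_subset _ _

theorem dependsOn_pathVertices (n : ℕ) :
    DependsOn (fun w : ℕ → V => pathVertices w n) (Set.Iic n) := fun w w' h => by
  ext v
  simp only [mem_pathVertices]
  exact exists_congr fun i => and_congr_right fun hi => by rw [h i hi]

theorem dependsOn_loopErasureVertices (n : ℕ) :
    DependsOn (fun w : ℕ → V => loopErasureVertices w n) (Set.Iic n) := fun w w' h => by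
  have hrange : pathVertices w n = pathVertices w' n := dependsOn_pathVertices n h
  have herasure : ∀ i, loopErasure w n i = loopErasure w' n i :=
    fun i => dependsOn_loopErasure n i h
  ext v
  simp only [loopErasureVertices, Finset.mem_filter, hrange, herasure]

open Classical in
theorem sum_pathVertices {M : Type*} [AddCommMonoid M] (w : ℕ → V) (n : ℕ) (f : V → M) :
    ∑ v ∈ pathVertices w n, f v =
      ∑ m ∈ Finset.range (n + 1), if ∀ i < m, w i ≠ w m then f (w m) else 0 := by
  induction n with
  | zero => simp [pathVertices]
  | succ n ih =>
    have hsucc : pathVertices w (n + 1) = insert (w (n + 1)) (pathVertices w n) := by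
      rw [pathVertices, Finset.range_add_one, Finset.image_insert, pathVertices]
    rw [Finset.sum_range_succ, ← ih, hsucc]
    by_cases h : w (n + 1) ∈ pathVertices w n
    · obtain ⟨i, hi, hw⟩ := mem_pathVertices.1 h
      rw [Finset.insert_eq_of_mem h, if_neg fun h' => h' i (by omega) hw, add_zero]
    · rw [Finset.sum_insert h, if_pos, add_comm]
      exact fun i hi hw => h (mem_pathVertices.2 ⟨i, by omega, hw⟩)

end LoopErasure

/-! ### Charges averaged given the present position -/

namespace Network

variable {V E : Type*} (G : Network V E)

/-- The probability that the walk ever visits `A`. -/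
noncomputable def hitEver (A : Set V) (v : V) : ℝ := ⨆ N, G.hitProb A N v

section KilledCapacity

variable (hG : ∀ v, (G.out v).Nonempty)
include hG

theorem tendsto_hitProb (A : Set V) (v : V) :
    Filter.Tendsto (fun N => G.hitProb A N v) Filter.atTop (nhds (G.hitEver A v)) :=
  tendsto_atTop_ciSup (G.monotone_hitProb A v)
    ⟨1, by rintro _ ⟨N, rfl⟩; exact G.hitProb_le_one hG A N v⟩

theorem tendsto_avg_hitProb (A : Set V) (v : V) :
    Filter.Tendsto (fun N => G.avg (G.hitProb A N) v) Filter.atTop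
      (nhds (G.avg (G.hitEver A) v)) := by
  simp only [avg_apply]
  exact (tendsto_finsetSum _ fun e _ => (G.tendsto_hitProb hG A _).const_mul _).div_const _

omit hG in
theorem hitEver_of_mem {A : Set V} {v : V} (h : v ∈ A) : G.hitEver A v = 1 := by
  simp only [hitEver, G.hitProb_of_mem _ h, ciSup_const]

theorem hitEver_of_notMem {A : Set V} {v : V} (h : v ∉ A) :
    G.hitEver A v = G.avg (G.hitEver A) v := by
  refine tendsto_nhds_unique
    ((Filter.tendsto_add_atTop_iff_nat 1).2 (G.tendsto_hitProb hG A v)) ?_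
  simp only [G.hitProb_succ_of_notMem _ h]
  exact G.tendsto_avg_hitProb hG A v

theorem hitEver_nonneg (A : Set V) (v : V) : 0 ≤ G.hitEver A v :=
  ge_of_tendsto' (G.tendsto_hitProb hG A v) fun N => G.hitProb_nonneg A N v

theorem escapeProb_eq [MeasurableSpace V] [DiscreteMeasurableSpace V] (A : Set V) (v : V) :
    G.escapeProb A v = 1 - G.avg (G.hitEver A) v :=
  tendsto_nhds_unique (G.tendsto_escapeProb hG A v)
    (tendsto_const_nhds.sub (G.tendsto_avg_hitProb hG A v))

variable {W : Finset V} {lam : ℝ} (h0 : 0 ≤ lam) (h1 : lam < 1)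
include h0 h1

theorem killedHit_le_hitEver (A : Set V) (u : V) : G.killedHit W lam A u ≤ G.hitEver A u := by
  refine G.balayage_le hG h0 h1 (G.hitEver_nonneg hG A)
    (fun u hu => (G.hitEver_of_mem hu).ge) (fun u _ huA => ?_) u
  rw [killedLap_apply, ← G.hitEver_of_notMem hG huA]
  exact mul_nonneg (G.vertexCond_nonneg u)
    (sub_nonneg.2 (mul_le_of_le_one_left (G.hitEver_nonneg hG A u) h1.le))

theorem killedHit_eq_of_notMem {A : Set V} {u : V} (hu : u ∈ W) (hA : u ∉ A) :
    G.killedHit W lam A u = lam * G.avg (G.killedHit W lam A) u :=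
  sub_eq_zero.1 ((mul_eq_zero.1 (G.killedLap_killedHit hG h0 h1 hu hA)).resolve_left
    (G.vertexCond_pos (hG u)).ne')

theorem pow_mul_hitProb_le (A : Set V) {N : ℕ} {v : V} (hW : G.ball v N ⊆ W) :
    lam ^ N * G.hitProb A N v ≤ G.killedHit W lam A v := by
  have hvW := hW (G.self_mem_ball v N)
  by_cases hA : v ∈ A
  · rw [G.killedHit_of_mem hG h0 h1 hvW hA, G.hitProb_of_mem N hA, mul_one]
    exact pow_le_one₀ h0 h1.le
  induction N generalizing v with
  | zero =>
    rw [G.hitProb_zero_of_notMem hA, mul_zero]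
    exact G.killedHit_nonneg hG h0 h1 A v
  | succ N ih =>
    rw [G.killedHit_eq_of_notMem hG h0 h1 hvW hA, G.hitProb_succ_of_notMem N hA, pow_succ',
      mul_assoc, ← map_fun_const_mul]
    refine mul_le_mul_of_nonneg_left (G.avg_le_avg fun e he => ?_) h0
    have hWe := (G.ball_tgt_subset he N).trans hW
    by_cases hAe : G.tgt e ∈ A
    · rw [G.killedHit_of_mem hG h0 h1 (hWe (G.self_mem_ball _ N)) hAe, G.hitProb_of_mem N hAe,
        mul_one]
      exact pow_le_one₀ h0 h1.le
    · exact ih hWe (hWe (G.self_mem_ball _ N)) hAe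

theorem killedCap_eq_sum {A : Finset V} (hA : A ⊆ W) : G.killedCap W lam A =
    ∑ u ∈ A, G.vertexCond u * (1 - lam * G.avg (G.killedHit W lam A) u) := by
  rw [G.killedCap_eq hG h0 h1 hA]
  exact Finset.sum_congr rfl fun u hu => by
    rw [killedLap_apply, G.killedHit_of_mem hG h0 h1 (hA hu) hu]

theorem killedCap_le {k : ℕ} {A : Finset V} (hA : ∀ u ∈ A, G.ball u (k + 1) ⊆ W) :
    G.killedCap W lam A ≤
      ∑ u ∈ A, G.vertexCond u * (1 - lam ^ (k + 1) * G.avg (G.hitProb A k) u) := by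
  rw [G.killedCap_eq_sum hG h0 h1 fun u hu => hA u hu (G.self_mem_ball u _)]
  refine Finset.sum_le_sum fun u hu => mul_le_mul_of_nonneg_left ?_ (G.vertexCond_nonneg u)
  rw [pow_succ', mul_assoc, ← map_fun_const_mul G.avg (lam ^ k)]
  refine sub_le_sub_left (mul_le_mul_of_nonneg_left (G.avg_le_avg fun e he => ?_) h0) 1
  exact G.pow_mul_hitProb_le hG h0 h1 A ((G.ball_tgt_subset he k).trans (hA u hu))

theorem capacity_le_killedCap [MeasurableSpace V] [DiscreteMeasurableSpace V] {A : Finset V}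
    (hA : A ⊆ W) : G.capacity A ≤ G.killedCap W lam A := by
  rw [capacity, G.killedCap_eq_sum hG h0 h1 hA]
  refine Finset.sum_le_sum fun u _ => mul_le_mul_of_nonneg_left ?_ (G.vertexCond_nonneg u)
  rw [G.escapeProb_eq hG]
  refine sub_le_sub_left ((mul_le_of_le_one_left ?_ h1.le).trans ?_) 1
  · exact G.avg_nonneg (G.killedHit_nonneg hG h0 h1 A) u
  · exact G.avg_le_avg fun e _ => G.killedHit_le_hitEver hG h0 h1 A _

end KilledCapacity

section PathExpectation

variable (hG : ∀ v, (G.out v).Nonempty)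
include hG

theorem pathExp_mul_pathExp {m n : ℕ} (hmn : m ≤ n) {H F : (ℕ → V) → ℝ}
    (hH : DependsOn H (Set.Iic m)) (hF : DependsOn F (Set.Iic n)) (w : ℕ → V) :
    G.pathExp 0 n (fun w => H w * F w) w =
      G.pathExp 0 n (fun w => H w * G.pathExp m (n - m) F w) w := by
  have hd : DependsOn (G.pathExp m (n - m) F) (Set.Iic m) := fun w w' hw => by
    refine G.dependsOn_pathExp (a := 0) ?_ m.zero_le fun i hi => hw i hi.2
    rwa [Nat.add_sub_cancel' hmn, ← bot_eq_zero, Set.Icc_bot]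
  rw [G.pathExp_split hmn, G.pathExp_split hmn]
  exact G.pathExp_congr fun w' _ _ => by
    rw [G.pathExp_mul_left hH, G.pathExp_mul_left hH, G.pathExp_of_dependsOn hG hd]

-- If `q` is the distribution function of `J` then the mean of `q J` is the probability that an
-- independent copy of `J` is at most `J`.
theorem half_le_pathExp_cdf {m l K : ℕ} {J : (ℕ → V) → ℕ} {q : ℕ → ℝ} {w : ℕ → V}
    (hJ : ∀ w', (∀ i ≤ m, w' i = w i) → J w' ≤ K)
    (hq : ∀ k, G.pathExp m l (fun w' => if J w' ≤ k then 1 else 0) w = q k) :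
    1 / 2 ≤ G.pathExp m l (fun w' => q (J w')) w := by
  have hqK : q K = 1 := (hq K).symm.trans <|
    (G.pathExp_congr fun w' hw' _ => if_pos (hJ w' hw')).trans (G.pathExp_const hG m l 1 w)
  have telescoped : ∀ j ≤ K,
      q j = 1 - ∑ k ∈ Finset.range K, (q (k + 1) - q k) * (if j ≤ k then 1 else 0) := fun j hj => by
    have hIco : (Finset.range K).filter (j ≤ ·) = Finset.Ico j K := by
      ext k; simp [and_comm]
    simp only [mul_ite, mul_one, mul_zero]
    rw [← Finset.sum_filter, hIco, Finset.sum_Ico_eq_sub _ hj, Finset.sum_range_sub,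
      Finset.sum_range_sub, hqK]
    ring
  have mean_eq : G.pathExp m l (fun w' => q (J w')) w =
      1 - ∑ k ∈ Finset.range K, (q (k + 1) - q k) * q k := by
    rw [G.pathExp_congr fun w' hw' _ => telescoped _ (hJ w' hw'), map_fun_sub,
      G.pathExp_const hG, map_fun_sum]
    simp only [map_fun_const_mul, hq]
  have hsum : ∑ k ∈ Finset.range K, (q (k + 1) - q k) * q k ≤
      ∑ k ∈ Finset.range K, (q (k + 1) ^ 2 - q k ^ 2) / 2 :=
    Finset.sum_le_sum fun k _ => by nlinarith [sq_nonneg (q (k + 1) - q k)]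
  rw [← Finset.sum_div, Finset.sum_range_sub fun k => q k ^ 2, hqK] at hsum
  rw [mean_eq]
  linarith [sq_nonneg (q 0)]

-- Two independent continuations of a path are equally likely to reach lower on its loop-erasure.
theorem half_le_pathExp_hitProb {m n : ℕ} (hmn : m ≤ n) (w : ℕ → V) :
    1 / 2 ≤ G.pathExp m (n - m)
      (fun w' => G.hitProb (survivingPrefix w' m n) (n - m) (w' m)) w := by
  classical
  have hprefix : ∀ k, ∀ w', (∀ i ≤ m, w' i = w i) →
      loopErasurePrefix w' m k = loopErasurePrefix w m k :=
    fun k w' hw' => dependsOn_loopErasurePrefix m k hw'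
  obtain ⟨K, hK⟩ := exists_loopErasure_eq_last w m
  have hbound : ∀ w', (∀ i ≤ m, w' i = w i) → survivingIndex w' m n ≤ K := fun w' hw' => by
    refine (survivingIndex_le_iff w' hmn K).2 ⟨m, le_rfl, hmn, ?_⟩
    rw [hprefix K w' hw', hw' m le_rfl]
    exact ⟨K, le_rfl, hK⟩
  refine (G.half_le_pathExp_cdf hG (q := fun k => G.hitProb (loopErasurePrefix w m k) (n - m) (w m))
    hbound fun k => ?_).trans_eq (G.pathExp_congr fun w' hw' _ => ?_)
  · rw [← G.pathExp_hit hG]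
    refine G.pathExp_congr fun w' hw' _ => ?_
    rw [Nat.add_sub_cancel' hmn]
    simp only [survivingIndex_le_iff w' hmn, hprefix k w' hw']
  · rw [survivingPrefix, hprefix _ w' hw', hw' m le_rfl]

end PathExpectation

section ConditionalMean

open Classical in
/-- The conditional expectation, given that the walk started from `x` is at `v` at time `m`, of a
function of the walk up to time `n`. -/
noncomputable def condMean (x : V) (m n : ℕ) (F : (ℕ → V) → ℝ) (v : V) : ℝ :=
  G.pathExp 0 n (fun w => F w * if w m = v then 1 else 0) (fun _ => x) /
    G.pathExp 0 n (fun w => if w m = v then 1 else 0) (fun _ => x)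

variable {x : V} {m n : ℕ} {F : (ℕ → V) → ℝ}

theorem condMean_nonneg (hF : ∀ w, (∀ i ≤ n, w i ∈ G.ball x i) → 0 ≤ F w) (v : V) :
    0 ≤ G.condMean x m n F v := by
  classical
  rw [condMean]
  refine div_nonneg ?_ (G.pathExp_nonneg fun w _ _ => by split_ifs <;> norm_num)
  exact (map_fun_zero (G.pathExp 0 n) _).ge.trans (G.pathExp_le_of_mem_ball fun w hw =>
    mul_nonneg (hF w hw) (by split_ifs <;> norm_num))

open Classical in
theorem condMean_mul {b : ℝ} {v : V} (hF : ∀ w, w m = v → |F w| ≤ b) :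
    G.condMean x m n F v * G.pathExp 0 n (fun w => if w m = v then 1 else 0) (fun _ => x) =
      G.pathExp 0 n (fun w => F w * if w m = v then 1 else 0) (fun _ => x) := by
  refine div_mul_cancel_of_imp fun h => ?_
  have hconst (c : ℝ) :
      G.pathExp 0 n (fun w => c * if w m = v then 1 else 0) (fun _ => x) = 0 := by
    rw [map_fun_const_mul, h, mul_zero]
  refine le_antisymm ((G.pathExp_le fun w _ _ => ?_).trans_eq (hconst b))
    ((hconst (-b)).ge.trans (G.pathExp_le fun w _ _ => ?_))
  all_goals split_ifs with hw
  · simpa using (abs_le.1 (hF w hw)).2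
  · simp
  · simpa using (abs_le.1 (hF w hw)).1
  · simp

open Classical in
theorem pathExp_mul_comp_apply (hm : m ≤ n) (F : (ℕ → V) → ℝ) (U : V → ℝ) :
    G.pathExp 0 n (fun w => F w * U (w m)) (fun _ => x) =
      ∑ v ∈ G.ball x m,
        U v * G.pathExp 0 n (fun w => F w * if w m = v then 1 else 0) (fun _ => x) := by
  simp only [← map_fun_const_mul]
  rw [← map_fun_sum]
  refine G.pathExp_congr_of_mem_ball fun w hw => ?_
  simp [hw m hm, mul_comm]

theorem pathExp_condMean_mul (hm : m ≤ n) {g : V → ℝ} (hF : ∀ w, |F w| ≤ g (w m)) (U : V → ℝ) :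
    G.pathExp 0 n (fun w => G.condMean x m n F (w m) * U (w m)) (fun _ => x) =
      G.pathExp 0 n (fun w => F w * U (w m)) (fun _ => x) := by
  classical
  rw [G.pathExp_mul_comp_apply hm, G.pathExp_mul_comp_apply hm]
  refine Finset.sum_congr rfl fun v _ => ?_
  rw [← G.condMean_mul (F := F) fun w hw => hw ▸ hF w,
    ← map_fun_const_mul (G.pathExp 0 n) (G.condMean x m n F v)]
  refine congrArg (U v * ·) (G.pathExp_congr fun w _ _ => ?_)
  split_ifs with hw
  · rw [hw]
  · rw [mul_zero, mul_zero]

end ConditionalMean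

section MeanCharge

variable (W : Finset V) (lam : ℝ) (x : V) (n : ℕ)

open Classical in
/-- The charge that the killed equilibrium measure of the path up to time `n` puts on the vertex
visited at time `m`, if this is the first visit. -/
noncomputable def charge (m : ℕ) (w : ℕ → V) : ℝ :=
  if ∀ i < m, w i ≠ w m then
    G.killedLap lam (G.killedHit W lam (pathVertices w n)) (w m) else 0

/-- The conditional expectation of the charge at time `m` given the position at time `m`. -/
noncomputable def meanCharge (m : ℕ) : V → ℝ := G.condMean x m n (G.charge W lam n m)

/-- The potential of the measure with charges `meanCharge` along the path. -/
noncomputable def meanPotential (w : ℕ → V) : V → ℝ :=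
  ∑ m ∈ Finset.range (n + 1), G.meanCharge W lam x n m (w m) • G.green W lam (w m)

variable {W lam x n}

theorem dependsOn_meanPotential (v : V) :
    DependsOn (fun w => G.meanPotential W lam x n w v) (Set.Iic n) := fun w w' h => by
  simp only [meanPotential, Finset.sum_apply]
  exact Finset.sum_congr rfl fun m hm => by rw [h m (Finset.mem_range_succ_iff.1 hm)]

variable (hG : ∀ v, (G.out v).Nonempty) (h0 : 0 ≤ lam) (h1 : lam < 1)
include hG h0 h1

theorem charge_nonneg {w : ℕ → V} {m : ℕ} (hm : w m ∈ W) : 0 ≤ G.charge W lam n m w := by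
  rw [charge]
  split_ifs
  · exact G.killedLap_killedHit_nonneg hG h0 h1 _ hm
  · exact le_rfl

theorem abs_charge_le (w : ℕ → V) (m : ℕ) : |G.charge W lam n m w| ≤ G.vertexCond (w m) := by
  rw [charge]
  split_ifs
  · exact G.abs_killedLap_killedHit_le hG h0 h1 _ _
  · exact abs_zero.trans_le (G.vertexCond_nonneg _)

theorem sum_charge_mul {w : ℕ → V} (hw : pathVertices w n ⊆ W) (f : V → ℝ) :
    ∑ m ∈ Finset.range (n + 1), G.charge W lam n m w * f (w m) =
      G.dirForm W lam f (G.killedHit W lam (pathVertices w n)) := by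
  classical
  rw [G.dirForm_killedHit hG h0 h1 f hw, sum_pathVertices]
  refine Finset.sum_congr rfl fun m _ => ?_
  rw [charge]
  split_ifs <;> ring

theorem sum_charge {w : ℕ → V} (hw : pathVertices w n ⊆ W) :
    ∑ m ∈ Finset.range (n + 1), G.charge W lam n m w = G.killedCap W lam (pathVertices w n) := by
  classical
  rw [G.killedCap_eq hG h0 h1 hw, sum_pathVertices]
  rfl

theorem pathExp_meanCharge_mul {m : ℕ} (hm : m ≤ n) (U : V → ℝ) :
    G.pathExp 0 n (fun w => G.meanCharge W lam x n m (w m) * U (w m)) (fun _ => x) =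
      G.pathExp 0 n (fun w => G.charge W lam n m w * U (w m)) (fun _ => x) :=
  G.pathExp_condMean_mul hm (fun w => G.abs_charge_le hG h0 h1 w m) U

theorem meanPotential_of_notMem (w : ℕ → V) {v : V} (hv : v ∉ W) :
    G.meanPotential W lam x n w v = 0 := by
  simp [meanPotential, G.green_of_notMem hG h0 h1 _ hv]

theorem dirForm_meanPotential {w : ℕ → V} (hw : ∀ m ≤ n, w m ∈ W) (f : V → ℝ) :
    G.dirForm W lam f (G.meanPotential W lam x n w) =
      ∑ m ∈ Finset.range (n + 1), G.meanCharge W lam x n m (w m) * f (w m) := by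
  simp only [meanPotential, map_sum, map_smul, smul_eq_mul]
  exact Finset.sum_congr rfl fun m hm => by
    rw [G.dirForm_green hG h0 h1 _ (hw m (Finset.mem_range_succ_iff.1 hm))]

variable (hW : G.ball x n ⊆ W)
include hW

theorem meanCharge_nonneg {m : ℕ} (hm : m ≤ n) (v : V) : 0 ≤ G.meanCharge W lam x n m v :=
  G.condMean_nonneg (fun _ hw =>
    G.charge_nonneg hG h0 h1 (hW (G.ball_mono x hm (hw m hm)))) v

theorem pathExp_sum_meanCharge :
    ∑ m ∈ Finset.range (n + 1),
      G.pathExp 0 n (fun w => G.meanCharge W lam x n m (w m)) (fun _ => x) =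
      G.pathExp 0 n (fun w => G.killedCap W lam (pathVertices w n)) (fun _ => x) := by
  rw [← G.pathExp_congr_of_mem_ball fun w hw => G.sum_charge hG h0 h1
    ((pathVertices_subset_iff.2 fun m hm => G.ball_mono x hm (hw m hm)).trans hW), map_fun_sum]
  refine Finset.sum_congr rfl fun m hm => ?_
  simpa using G.pathExp_meanCharge_mul (W := W) hG h0 h1 (Finset.mem_range_succ_iff.1 hm) fun _ => 1

theorem killedLap_meanPotential_nonneg (w : ℕ → V) {u : V} (hu : u ∈ W) :
    0 ≤ G.killedLap lam (G.meanPotential W lam x n w) u := by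
  simp only [meanPotential, map_sum, map_smul, Finset.sum_apply]
  exact Finset.sum_nonneg fun m hm => mul_nonneg
    (G.meanCharge_nonneg hG h0 h1 hW (Finset.mem_range_succ_iff.1 hm) _)
    (G.killedLap_green_nonneg hG h0 h1 _ hu)

end MeanCharge

end Network

/-! ### Comparison of energies -/

theorem abs_partialSups_abs_sub_le (a b : ℕ → ℝ) (n : ℕ) :
    |partialSups (fun m => |a m|) n - partialSups (fun m => |b m|) n| ≤
      partialSups (fun m => |a m - b m|) n := by
  have le_add (f g : ℕ → ℝ) : partialSups (fun m => |f m|) n ≤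
      partialSups (fun m => |f m - g m|) n + partialSups (fun m => |g m|) n :=
    partialSups_le _ _ _ fun m hm => by
      have hsub := le_partialSups_of_le (fun m => |f m - g m|) hm
      have hg := le_partialSups_of_le (fun m => |g m|) hm
      linarith [abs_sub_abs_le_abs_sub (f m) (g m)]
  refine abs_sub_le_iff.2 ⟨sub_le_iff_le_add.2 (le_add a b), sub_le_iff_le_add.2 ?_⟩
  simpa only [abs_sub_comm] using le_add b a

theorem sum_sum_le_two_mul_of_symm (n : ℕ) {a : ℕ → ℕ → ℝ} (ha : ∀ i < n, 0 ≤ a i i)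
    (hs : ∀ i < n, ∀ j < n, a i j = a j i) :
    ∑ i ∈ Finset.range n, ∑ j ∈ Finset.range n, a i j ≤
      2 * ∑ i ∈ Finset.range n, ∑ j ∈ Finset.Ico i n, a i j := by
  have hIco (i : ℕ) : Finset.Ico i n = (Finset.range n).filter (i ≤ ·) := by
    ext j; simp [and_comm]
  simp only [hIco, Finset.sum_filter]
  rw [two_mul]
  conv_rhs => enter [2]; rw [Finset.sum_comm]
  simp only [← Finset.sum_add_distrib]
  refine Finset.sum_le_sum fun i hi => Finset.sum_le_sum fun j hj => ?_
  rw [Finset.mem_range] at hi hj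
  rw [← hs i hi j hj]
  rcases lt_trichotomy i j with h | rfl | h
  · simp [h.le, h.not_ge]
  · simp [ha i hi]
  · simp [h.le, h.not_ge]

namespace Network

variable {V E : Type*} (G : Network V E)

section KilledComparison

variable (W : Finset V) (lam : ℝ) (x : V) (n : ℕ)

/-- The maximal function of the martingale of conditional expectations of the potential. -/
noncomputable def maxPotential (w : ℕ → V) (v : V) : ℝ :=
  partialSups (fun m => |G.pathExp m (n - m) (fun w => G.meanPotential W lam x n w v) w|) n

/-- The part of `meanPotential` due to the charges at times from `m` on. -/
noncomputable def tailPotential (m : ℕ) (w : ℕ → V) : V → ℝ :=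
  ∑ j ∈ Finset.Ico m (n + 1), G.meanCharge W lam x n j (w j) • G.green W lam (w j)

/-- The modification of `meanPotential` in which the charge at time `m` is swept onto the part of
the loop-erasure at time `m` that survives until time `n`. -/
noncomputable def sweptPotential (w : ℕ → V) : V → ℝ :=
  ∑ m ∈ Finset.range (n + 1), G.meanCharge W lam x n m (w m) •
    G.balayage W lam (survivingPrefix w m n) (G.green W lam (w m))

variable {W lam x n} (hG : ∀ v, (G.out v).Nonempty) (h0 : 0 ≤ lam) (h1 : lam < 1)
include hG h0 h1

theorem maxPotential_of_notMem (w : ℕ → V) {v : V} (hv : v ∉ W) :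
    G.maxPotential W lam x n w v = 0 := by
  simp only [maxPotential, G.meanPotential_of_notMem hG h0 h1 _ hv, map_fun_zero, abs_zero]
  exact congrFun (Monotone.partialSups_eq (f := fun _ : ℕ => (0 : ℝ)) monotone_const) n

omit h0 h1 in
theorem pathExp_sq_maxPotential_sub_le (u v : V) :
    G.pathExp 0 n (fun w => (G.maxPotential W lam x n w u - G.maxPotential W lam x n w v) ^ 2)
      (fun _ => x) ≤
    4 * G.pathExp 0 n (fun w =>
      (G.meanPotential W lam x n w u - G.meanPotential W lam x n w v) ^ 2) (fun _ => x) := by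
  refine le_trans (G.pathExp_le fun w _ _ => ?_) (G.pathExp_sq_partialSups_le hG
    (F := fun w => G.meanPotential W lam x n w u - G.meanPotential W lam x n w v)
    (fun w w' h => congrArg₂ (· - ·) (G.dependsOn_meanPotential u h)
      (G.dependsOn_meanPotential v h)) _)
  simp only [map_fun_sub]
  rw [← sq_abs]
  exact pow_le_pow_left₀ (abs_nonneg _) (abs_partialSups_abs_sub_le _ _ n) 2

theorem pathExp_dirForm_maxPotential_le :
    G.pathExp 0 n (fun w => G.dirForm W lam (G.maxPotential W lam x n w)
      (G.maxPotential W lam x n w)) (fun _ => x) ≤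
    4 * G.pathExp 0 n (fun w => G.dirForm W lam (G.meanPotential W lam x n w)
      (G.meanPotential W lam x n w)) (fun _ => x) := by
  have hmax (w : ℕ → V) := G.dirForm_eq (W := W) (lam := lam)
    (G.maxPotential W lam x n w) (h := G.maxPotential W lam x n w)
    fun u => G.maxPotential_of_notMem hG h0 h1 w
  have hmean (w : ℕ → V) := G.dirForm_eq (W := W) (lam := lam)
    (G.meanPotential W lam x n w) (h := G.meanPotential W lam x n w)
    fun u => G.meanPotential_of_notMem hG h0 h1 w
  simp only [hmax, hmean, map_fun_add, map_fun_sum, map_fun_const_mul, ← sq, mul_add,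
    Finset.mul_sum]
  refine add_le_add (Finset.sum_le_sum fun u _ => ?_) (Finset.sum_le_sum fun e _ => ?_)
  · rw [mul_left_comm]
    exact mul_le_mul_of_nonneg_left
      (G.pathExp_sq_partialSups_le hG (G.dependsOn_meanPotential u) _) (G.killRate_nonneg h1.le u)
  · rw [mul_left_comm 4, mul_left_comm 4]
    exact mul_le_mul_of_nonneg_left (mul_le_mul_of_nonneg_left
      (G.pathExp_sq_maxPotential_sub_le hG _ _) (G.cond_pos e).le) (by positivity)

theorem sweptPotential_of_notMem (w : ℕ → V) {v : V} (hv : v ∉ W) :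
    G.sweptPotential W lam x n w v = 0 := by
  simp [sweptPotential, G.balayage_of_notMem hG h0 h1 _ _ hv]

theorem dirForm_killedHit_sweptPotential {w : ℕ → V} (hw : ∀ m ≤ n, w m ∈ W) :
    G.dirForm W lam (G.killedHit W lam (loopErasureVertices w n)) (G.sweptPotential W lam x n w) =
      ∑ m ∈ Finset.range (n + 1), G.meanCharge W lam x n m (w m) *
        G.killedHit W lam (survivingPrefix w m n) (w m) := by
  simp only [sweptPotential, map_sum, map_smul, smul_eq_mul]
  refine Finset.sum_congr rfl fun m hm => ?_
  have hmn := Finset.mem_range_succ_iff.1 hm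
  rw [G.dirForm_killedHit_balayage hG h0 h1 (survivingPrefix_subset w hmn)
    (fun u => G.green_of_notMem hG h0 h1 _), G.dirForm_green hG h0 h1 _ (hw m hmn)]

variable (hW : G.ball x n ⊆ W)
include hW

theorem tailPotential_le_meanPotential (m : ℕ) (w : ℕ → V) (v : V) :
    G.tailPotential W lam x n m w v ≤ G.meanPotential W lam x n w v := by
  simp only [tailPotential, meanPotential, Finset.sum_apply, Finset.range_eq_Ico]
  exact Finset.sum_le_sum_of_subset_of_nonneg (Finset.Ico_subset_Ico_left m.zero_le)
    fun j hj _ => mul_nonneg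
      (G.meanCharge_nonneg hG h0 h1 hW (Nat.le_of_lt_succ (Finset.mem_Ico.1 hj).2) _)
      (G.green_nonneg hG h0 h1 _ _)

-- The conditional expectation of `tailPotential` at the current position is a function of this
-- position, so that `meanCharge` may be replaced by `charge`.
theorem pathExp_meanCharge_mul_tailPotential_le {m : ℕ} (hm : m ≤ n) :
    G.pathExp 0 n (fun w => G.meanCharge W lam x n m (w m) * G.tailPotential W lam x n m w (w m))
      (fun _ => x) ≤
    G.pathExp 0 n (fun w => G.charge W lam n m w * G.maxPotential W lam x n w (w m))
      (fun _ => x) := by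
  set T : (ℕ → V) → ℝ := fun w => G.tailPotential W lam x n m w (w m)
  have hT : DependsOn T (Set.Icc m n) := fun w w' h => by
    simp only [T, tailPotential, Finset.sum_apply]
    refine Finset.sum_congr rfl fun j hj => ?_
    obtain ⟨hmj, hjn⟩ := Finset.mem_Ico.1 hj
    rw [h j ⟨hmj, Nat.le_of_lt_succ hjn⟩, h m ⟨le_rfl, hm⟩]
  have markov (w : ℕ → V) : G.pathExp m (n - m) T w = G.pathExp m (n - m) T fun _ => w m :=
    G.dependsOn_pathExp (by rwa [Nat.add_sub_cancel' hm]) le_rfl fun i hi => by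
      rw [le_antisymm hi.2 hi.1]
  have hH : DependsOn (fun w : ℕ → V => G.meanCharge W lam x n m (w m)) (Set.Iic m) :=
    fun w w' h => congrArg (G.meanCharge W lam x n m) (h m (le_refl m))
  rw [G.pathExp_mul_pathExp hG hm hH (hT.mono fun i hi => hi.2)]
  simp only [markov]
  rw [G.pathExp_meanCharge_mul hG h0 h1 hm fun v => G.pathExp m (n - m) T fun _ => v]
  simp only [← markov]
  refine G.pathExp_le_of_mem_ball fun w hw => mul_le_mul_of_nonneg_left ?_
    (G.charge_nonneg hG h0 h1 (hW (G.ball_mono x hm (hw m hm))))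
  calc G.pathExp m (n - m) T w
      ≤ G.pathExp m (n - m) (fun w' => G.meanPotential W lam x n w' (w m)) w :=
        G.pathExp_le fun w' hw' _ => by
          rw [← hw' m le_rfl]
          exact G.tailPotential_le_meanPotential hG h0 h1 hW m w' _
    _ ≤ |G.pathExp m (n - m) (fun w' => G.meanPotential W lam x n w' (w m)) w| := le_abs_self _
    _ ≤ G.maxPotential W lam x n w (w m) := le_partialSups_of_le
        (fun m' => |G.pathExp m' (n - m') (fun w' => G.meanPotential W lam x n w' (w m)) w|) hm

theorem dirForm_meanPotential_self_le {w : ℕ → V} (hw : ∀ m ≤ n, w m ∈ W) :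
    G.dirForm W lam (G.meanPotential W lam x n w) (G.meanPotential W lam x n w) ≤
      2 * ∑ m ∈ Finset.range (n + 1),
        G.meanCharge W lam x n m (w m) * G.tailPotential W lam x n m w (w m) := by
  have expand (i : ℕ) (s : Finset ℕ) : G.meanCharge W lam x n i (w i) *
      (∑ j ∈ s, G.meanCharge W lam x n j (w j) • G.green W lam (w j)) (w i) =
      ∑ j ∈ s, G.meanCharge W lam x n i (w i) *
        (G.meanCharge W lam x n j (w j) * G.green W lam (w j) (w i)) := by
    simp only [Finset.sum_apply, Pi.smul_apply, smul_eq_mul, Finset.mul_sum]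
  rw [G.dirForm_meanPotential hG h0 h1 hw]
  simp only [meanPotential, tailPotential, expand]
  refine sum_sum_le_two_mul_of_symm (n + 1) (fun i hi => ?_) fun i hi j hj => ?_
  · have hq := G.meanCharge_nonneg hG h0 h1 hW (Nat.le_of_lt_succ hi) (w i)
    exact mul_nonneg hq (mul_nonneg hq (G.green_nonneg hG h0 h1 _ _))
  · rw [G.green_comm hG h0 h1 (hw i (Nat.le_of_lt_succ hi)) (hw j (Nat.le_of_lt_succ hj))]
    exact mul_left_comm _ _ _

theorem pathExp_dirForm_meanPotential_le_dirForm_killedHit :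
    G.pathExp 0 n (fun w => G.dirForm W lam (G.meanPotential W lam x n w)
      (G.meanPotential W lam x n w)) (fun _ => x) ≤
    2 * G.pathExp 0 n (fun w => G.dirForm W lam (G.killedHit W lam (pathVertices w n))
      (G.maxPotential W lam x n w)) (fun _ => x) := by
  have mem_W {w : ℕ → V} (hw : ∀ m ≤ n, w m ∈ G.ball x m) {m : ℕ} (hm : m ≤ n) : w m ∈ W :=
    hW (G.ball_mono x hm (hw m hm))
  calc _ ≤ 2 * ∑ m ∈ Finset.range (n + 1), G.pathExp 0 n (fun w =>
          G.meanCharge W lam x n m (w m) * G.tailPotential W lam x n m w (w m)) (fun _ => x) := by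
        rw [← map_fun_sum, ← map_fun_const_mul]
        exact G.pathExp_le_of_mem_ball fun w hw =>
          G.dirForm_meanPotential_self_le hG h0 h1 hW fun m => mem_W hw
    _ ≤ 2 * ∑ m ∈ Finset.range (n + 1), G.pathExp 0 n (fun w =>
          G.charge W lam n m w * G.maxPotential W lam x n w (w m)) (fun _ => x) :=
        mul_le_mul_of_nonneg_left (Finset.sum_le_sum fun m hm =>
          G.pathExp_meanCharge_mul_tailPotential_le hG h0 h1 hW (Finset.mem_range_succ_iff.1 hm))
          zero_le_two
    _ = _ := by
        rw [← map_fun_sum]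
        refine congrArg (2 * ·) (G.pathExp_congr_of_mem_ball fun w hw => ?_)
        rw [G.sum_charge_mul hG h0 h1 (pathVertices_subset_iff.2 fun m => mem_W hw), G.dirForm_comm
          (fun u => G.maxPotential_of_notMem hG h0 h1 w)
          (fun u => G.killedHit_of_notMem hG h0 h1 _)]

-- The maximal inequality allows the energy on the right of the Cauchy-Schwarz inequality to be
-- absorbed into the left-hand side.
theorem pathExp_dirForm_meanPotential_le :
    G.pathExp 0 n (fun w => G.dirForm W lam (G.meanPotential W lam x n w)
      (G.meanPotential W lam x n w)) (fun _ => x) ≤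
    16 * G.pathExp 0 n (fun w => G.killedCap W lam (pathVertices w n)) (fun _ => x) := by
  have cauchySchwarz : 2 * G.pathExp 0 n (fun w => G.dirForm W lam
      (G.killedHit W lam (pathVertices w n)) (G.maxPotential W lam x n w)) (fun _ => x) ≤
      8 * G.pathExp 0 n (fun w => G.killedCap W lam (pathVertices w n)) (fun _ => x) +
        1 / 8 * G.pathExp 0 n (fun w => G.dirForm W lam (G.maxPotential W lam x n w)
          (G.maxPotential W lam x n w)) (fun _ => x) := by
    simp only [← map_fun_const_mul, ← map_fun_add]
    refine G.pathExp_le fun w _ _ => ?_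
    have := G.two_mul_dirForm_le h0 h1.le
      (fun u => G.killedHit_of_notMem (W := W) hG h0 h1 (pathVertices w n : Set V))
      (fun u => G.maxPotential_of_notMem (x := x) (n := n) hG h0 h1 w) (1 / 8)
    rw [killedCap]
    linarith
  linarith [G.pathExp_dirForm_meanPotential_le_dirForm_killedHit hG h0 h1 hW,
    G.pathExp_dirForm_maxPotential_le (W := W) (x := x) (n := n) hG h0 h1]

theorem killedLap_sweptPotential_nonneg (w : ℕ → V) {u : V} (hu : u ∈ W) :
    0 ≤ G.killedLap lam (G.sweptPotential W lam x n w) u := by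
  simp only [sweptPotential, map_sum, map_smul, Finset.sum_apply]
  exact Finset.sum_nonneg fun m hm => mul_nonneg
    (G.meanCharge_nonneg hG h0 h1 hW (Finset.mem_range_succ_iff.1 hm) _)
    (G.killedLap_balayage_nonneg hG h0 h1 _ (G.green_nonneg hG h0 h1 _)
      (fun _ => G.killedLap_green_nonneg hG h0 h1 _) hu)

theorem dirForm_sweptPotential_le (w : ℕ → V) {g : V → ℝ} (hgW : ∀ u ∉ W, g u = 0)
    (hgQ : ∀ u ∈ W, 0 ≤ G.killedLap lam g u) :
    G.dirForm W lam g (G.sweptPotential W lam x n w) ≤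
      G.dirForm W lam g (G.meanPotential W lam x n w) := by
  simp only [sweptPotential, meanPotential, map_sum, map_smul]
  exact Finset.sum_le_sum fun m hm => mul_le_mul_of_nonneg_left
    (G.dirForm_balayage_le hG h0 h1 _ (G.green_nonneg hG h0 h1 _)
      (fun u => G.green_of_notMem hG h0 h1 _) (fun _ => G.killedLap_green_nonneg hG h0 h1 _)
      hgW hgQ)
    (G.meanCharge_nonneg hG h0 h1 hW (Finset.mem_range_succ_iff.1 hm) _)

theorem dirForm_sweptPotential_self_le (w : ℕ → V) :
    G.dirForm W lam (G.sweptPotential W lam x n w) (G.sweptPotential W lam x n w) ≤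
      G.dirForm W lam (G.meanPotential W lam x n w) (G.meanPotential W lam x n w) := by
  refine (G.dirForm_sweptPotential_le hG h0 h1 hW w
    (fun u => G.sweptPotential_of_notMem hG h0 h1 w)
    (fun u => G.killedLap_sweptPotential_nonneg hG h0 h1 hW w)).trans ?_
  rw [G.dirForm_comm (fun u => G.sweptPotential_of_notMem hG h0 h1 w)
    fun u => G.meanPotential_of_notMem hG h0 h1 w]
  exact G.dirForm_sweptPotential_le hG h0 h1 hW w
    (fun u => G.meanPotential_of_notMem hG h0 h1 w)
    (fun u => G.killedLap_meanPotential_nonneg hG h0 h1 hW w)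

theorem pow_mul_sum_hitProb_le {w : ℕ → V} (hw : ∀ m ≤ n, w m ∈ G.ball x m) :
    lam ^ n * ∑ m ∈ Finset.range (n + 1),
      G.meanCharge W lam x n m (w m) * G.hitProb (survivingPrefix w m n) (n - m) (w m) ≤
    G.dirForm W lam (G.killedHit W lam (loopErasureVertices w n))
      (G.sweptPotential W lam x n w) := by
  rw [G.dirForm_killedHit_sweptPotential hG h0 h1 fun m hm => hW (G.ball_mono x hm (hw m hm)),
    Finset.mul_sum]
  refine Finset.sum_le_sum fun m hm => ?_
  have hmn := Finset.mem_range_succ_iff.1 hm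
  have hball : G.ball (w m) (n - m) ⊆ W :=
    ((G.ball_subset_ball (hw m hmn) _).trans_eq (by rw [Nat.add_sub_cancel' hmn])).trans hW
  rw [mul_left_comm]
  refine mul_le_mul_of_nonneg_left (le_trans ?_ (G.pow_mul_hitProb_le hG h0 h1 _ hball))
    (G.meanCharge_nonneg hG h0 h1 hW hmn _)
  exact mul_le_mul_of_nonneg_right (pow_le_pow_of_le_one h0 h1.le (Nat.sub_le n m))
    (G.hitProb_nonneg _ _ _)

theorem pathExp_killedCap_div_two_le :
    G.pathExp 0 n (fun w => G.killedCap W lam (pathVertices w n)) (fun _ => x) / 2 ≤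
      G.pathExp 0 n (fun w => ∑ m ∈ Finset.range (n + 1), G.meanCharge W lam x n m (w m) *
        G.hitProb (survivingPrefix w m n) (n - m) (w m)) (fun _ => x) := by
  rw [← G.pathExp_sum_meanCharge hG h0 h1 hW, map_fun_sum, Finset.sum_div]
  refine Finset.sum_le_sum fun m hm => ?_
  have hmn := Finset.mem_range_succ_iff.1 hm
  have hH : DependsOn (fun w : ℕ → V => G.meanCharge W lam x n m (w m)) (Set.Iic m) :=
    fun w w' h => congrArg (G.meanCharge W lam x n m) (h m (le_refl m))
  have hF : DependsOn (fun w : ℕ → V => G.hitProb (survivingPrefix w m n) (n - m) (w m))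
      (Set.Iic n) := fun w w' h =>
    congrArg₂ (fun A => G.hitProb A (n - m)) (dependsOn_survivingPrefix hmn h) (h m hmn)
  rw [G.pathExp_mul_pathExp hG hmn hH hF, div_eq_inv_mul, ← map_fun_const_mul]
  refine G.pathExp_le fun w _ _ => ?_
  rw [mul_comm, ← one_div]
  exact mul_le_mul_of_nonneg_left (G.half_le_pathExp_hitProb hG hmn w)
    (G.meanCharge_nonneg hG h0 h1 hW hmn _)

theorem le_pathExp_killedCap_loopErasure :
    lam ^ (2 * n) / 64 *
      G.pathExp 0 n (fun w => G.killedCap W lam (pathVertices w n)) (fun _ => x) ≤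
    G.pathExp 0 n (fun w => G.killedCap W lam (loopErasureVertices w n)) (fun _ => x) := by
  -- This `t` maximizes the lower bound `t * lam ^ n - 16 * t ^ 2` on the ratio of the two sides.
  obtain ⟨t, ht0, ht⟩ : ∃ t, 0 ≤ t ∧ lam ^ n = 32 * t :=
    ⟨lam ^ n / 32, by positivity, (mul_div_cancel₀ _ (by norm_num)).symm⟩
  have variational := G.pathExp_le_of_mem_ball (n := n) (x := x) fun w hw => by
    have hcap := G.le_killedCap (W := W) hG h0 h1 (loopErasureVertices w n : Set V)
      (fun u => G.sweptPotential_of_notMem (x := x) (n := n) hG h0 h1 w) t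
    have hmass := mul_le_mul_of_nonneg_left (G.pow_mul_sum_hitProb_le hG h0 h1 hW hw)
      (mul_nonneg zero_le_two ht0)
    have henergy := mul_le_mul_of_nonneg_left
      (G.dirForm_sweptPotential_self_le hG h0 h1 hW w) (sq_nonneg t)
    exact (sub_le_sub hmass henergy).trans hcap
  simp only [map_fun_sub, map_fun_const_mul] at variational
  have hmass := mul_le_mul_of_nonneg_left (G.pathExp_killedCap_div_two_le hG h0 h1 hW)
    (by positivity : 0 ≤ 2 * t * lam ^ n)
  have henergy := mul_le_mul_of_nonneg_left (G.pathExp_dirForm_meanPotential_le hG h0 h1 hW)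
    (sq_nonneg t)
  rw [ht] at hmass variational
  rw [mul_comm 2 n, pow_mul, ht]
  linarith

end KilledComparison

theorem tendsto_pathExp {F : ℕ → (ℕ → V) → ℝ} {F' : (ℕ → V) → ℝ}
    (h : ∀ w, Filter.Tendsto (fun k => F k w) Filter.atTop (nhds (F' w))) (m N : ℕ) (w : ℕ → V) :
    Filter.Tendsto (fun k => G.pathExp m N (F k) w) Filter.atTop (nhds (G.pathExp m N F' w)) := by
  induction N generalizing m w with
  | zero => exact h w
  | succ N ih =>
    simp only [pathExp_succ, avg_apply]
    exact (tendsto_finsetSum _ fun e _ => (ih _ _).const_mul _).div_const _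

theorem sum_green_le (hG : ∀ v, (G.out v).Nonempty) {W : Finset V} {lam : ℝ} (h0 : 0 ≤ lam)
    (h1 : lam < 1) {ι : Type*} {s : Finset ι} {v : ι → V} {f : V → ℝ} (hf : ∀ u, 0 ≤ f u)
    (hQ : ∀ u, ∑ i ∈ s, Set.indicator {v i} 1 u ≤ G.killedLap 1 f u) (u : V) :
    ∑ i ∈ s, G.green W lam (v i) u ≤ f u := by
  classical
  rw [← sub_nonneg, ← Finset.sum_apply]
  refine G.nonneg_of_killedLap_nonneg hG W h0 h1 (A := ∅)
    (f := f - ∑ i ∈ s, G.green W lam (v i)) (fun u hu => ?_) (fun _ _ h => h.elim)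
    (fun u hu _ => ?_) u
  · simp [G.green_of_notMem hG h0 h1 _ hu, hf u]
  · have hgreen (i : ι) : G.killedLap lam (G.green W lam (v i)) u = Set.indicator {v i} 1 u := by
      rw [G.killedLap_green hG h0 h1 _ hu, Set.indicator_singleton, Pi.one_apply]
    simp only [map_sub, map_sum, Pi.sub_apply, Finset.sum_apply, hgreen, sub_nonneg]
    refine (hQ u).trans (mul_le_mul_of_nonneg_left ?_ (G.vertexCond_nonneg u))
    exact sub_le_sub_left (mul_le_mul_of_nonneg_right h1.le (G.avg_nonneg hf u)) _

section Capacity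

variable [MeasurableSpace V] [DiscreteMeasurableSpace V]

theorem capacity_nonneg (A : Finset V) : 0 ≤ G.capacity A :=
  Finset.sum_nonneg fun u _ => mul_nonneg (G.vertexCond_nonneg u) (G.escapeProb_nonneg _ u)

theorem dependsOn_capacity_pathVertices (n : ℕ) :
    DependsOn (fun w : ℕ → V => G.capacity (pathVertices w n)) (Set.Iic n) :=
  fun _ _ h => congrArg G.capacity (dependsOn_pathVertices n h)

theorem dependsOn_capacity_loopErasureVertices (n : ℕ) :
    DependsOn (fun w : ℕ → V => G.capacity (loopErasureVertices w n)) (Set.Iic n) :=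
  fun _ _ h => congrArg G.capacity (dependsOn_loopErasureVertices n h)

variable (hG : ∀ v, (G.out v).Nonempty)
include hG

theorem tendsto_pathExp_sum_sub (A : (ℕ → V) → Finset V) (n : ℕ) (w : ℕ → V) :
    Filter.Tendsto (fun k => G.pathExp 0 n
      (fun w => ∑ u ∈ A w, G.vertexCond u * (1 - G.avg (G.hitProb (A w) k) u)) w) Filter.atTop
      (nhds (G.pathExp 0 n (fun w => G.capacity (A w)) w)) :=
  G.tendsto_pathExp (fun w => tendsto_finsetSum _ fun u _ =>
    (G.tendsto_escapeProb hG (A w) u).const_mul _) 0 n w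

-- The killed walks decrease to the walk as `lam` tends to one and `W` exhausts the network.
theorem le_pathExp_capacity {x : V} {n r p : ℕ} {A : (ℕ → V) → Finset V}
    (hA : ∀ w, (∀ m ≤ n, w m ∈ G.ball x m) → A w ⊆ G.ball x r) {B : ℝ}
    (h : ∀ (lam : ℝ) (W : Finset V), 0 ≤ lam → lam < 1 → G.ball x r ⊆ W →
      lam ^ p * B ≤ G.pathExp 0 n (fun w => G.killedCap W lam (A w)) (fun _ => x)) :
    B ≤ G.pathExp 0 n (fun w => G.capacity (A w)) (fun _ => x) := by
  refine ge_of_tendsto' (G.tendsto_pathExp_sum_sub hG A n fun _ => x) fun k => ?_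
  have hle : ∀ lam : ℝ, 0 ≤ lam → lam < 1 → lam ^ p * B ≤ G.pathExp 0 n (fun w => ∑ u ∈ A w,
      G.vertexCond u * (1 - lam ^ (k + 1) * G.avg (G.hitProb (A w) k) u)) fun _ => x :=
    fun lam h0 h1 => by
      refine (h lam (G.ball x (r + (k + 1))) h0 h1 (G.ball_mono x (by omega))).trans ?_
      exact G.pathExp_le_of_mem_ball fun w hw => G.killedCap_le hG h0 h1 fun u hu =>
        G.ball_subset_ball (hA w hw hu) (k + 1)
  simp only [mul_sub, Finset.sum_sub_distrib, map_fun_sub, mul_left_comm _ (_ ^ _),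
    ← Finset.mul_sum, map_fun_const_mul] at hle ⊢
  simpa only [one_pow, one_mul] using ContinuousWithinAt.closure_le (x := (1 : ℝ))
    (s := Set.Ico 0 1) (by simp [closure_Ico]) (by fun_prop) (by fun_prop)
    fun lam hl => hle lam hl.1 hl.2

theorem le_pathExp_capacity_loopErasure (x : V) (n : ℕ) :
    1 / 64 * G.pathExp 0 n (fun w => G.capacity (pathVertices w n)) (fun _ => x) ≤
      G.pathExp 0 n (fun w => G.capacity (loopErasureVertices w n)) (fun _ => x) := by
  have path_subset {w : ℕ → V} (hw : ∀ m ≤ n, w m ∈ G.ball x m) : pathVertices w n ⊆ G.ball x n :=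
    pathVertices_subset_iff.2 fun m hm => G.ball_mono x hm (hw m hm)
  refine G.le_pathExp_capacity hG (r := n) (p := 2 * n)
    (fun w hw => (loopErasureVertices_subset w n).trans (path_subset hw)) fun lam W h0 h1 hW => ?_
  refine le_trans ?_ (G.le_pathExp_killedCap_loopErasure hG h0 h1 hW)
  rw [← mul_assoc, mul_one_div]
  exact mul_le_mul_of_nonneg_left (G.pathExp_le_of_mem_ball fun w hw =>
    G.capacity_le_killedCap hG h0 h1 ((path_subset hw).trans hW)) (by positivity)

theorem le_capacity {ι : Type*} {s : Finset ι} {v : ι → V} {x : V} {r : ℕ} {A : Finset V}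
    (hA : A ⊆ G.ball x r) (hv : ∀ i ∈ s, v i ∈ A) {f : V → ℝ} (hf : ∀ u, 0 ≤ f u)
    (hQ : ∀ u, ∑ i ∈ s, Set.indicator {v i} 1 u ≤ G.killedLap 1 f u) (t : ℝ) :
    2 * t * s.card - t ^ 2 * ∑ i ∈ s, f (v i) ≤ G.capacity A := by
  refine G.le_pathExp_capacity hG (x := x) (n := 0) (r := r) (p := 0) (A := fun _ => A)
    (fun _ _ => hA) fun lam W h0 h1 hW => ?_
  have hW' : ∀ i ∈ s, v i ∈ W := fun i hi => hW (hA (hv i hi))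
  set ψ : V → ℝ := ∑ i ∈ s, G.green W lam (v i) with hψ
  have hform (h : V → ℝ) : G.dirForm W lam h ψ = ∑ i ∈ s, h (v i) := by
    rw [hψ, map_sum]
    exact Finset.sum_congr rfl fun i hi => G.dirForm_green hG h0 h1 h (hW' i hi)
  have hcap := G.le_killedCap (W := W) hG h0 h1 A (ψ := ψ)
    (fun u hu => by simp [hψ, G.green_of_notMem hG h0 h1 _ hu]) t
  have hmass : ∑ i ∈ s, G.killedHit W lam A (v i) = s.card := by
    simp [Finset.sum_congr rfl fun i hi =>
      G.killedHit_of_mem (A := (A : Set V)) hG h0 h1 (hW' i hi) (hv i hi)]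
  have henergy : ∑ i ∈ s, ψ (v i) ≤ ∑ i ∈ s, f (v i) := Finset.sum_le_sum fun i _ => by
    simpa only [hψ, Finset.sum_apply] using G.sum_green_le hG h0 h1 hf hQ (v i)
  rw [hform, hform, hmass] at hcap
  rw [pow_zero, one_mul, pathExp_zero]
  exact (sub_le_sub_left (mul_le_mul_of_nonneg_left henergy (sq_nonneg t)) _).trans hcap

theorem integral_capacity_loopErasure_ge {x : V} {Ω : Type*} [MeasurableSpace Ω] {P : Measure Ω}
    {X : ℕ → Ω → V} (hX : HasLaw (fun ω t => X t ω) (G.walkLaw x) P) (n : ℕ) :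
    1 / 64 * ∫ ω, G.capacity (pathVertices (fun t => X t ω) n) ∂P ≤
      ∫ ω, G.capacity (loopErasureVertices (fun t => X t ω) n) ∂P := by
  rw [G.integral_eq_pathExp hG hX (G.dependsOn_capacity_pathVertices n),
    G.integral_eq_pathExp hG hX (G.dependsOn_capacity_loopErasureVertices n)]
  exact G.le_pathExp_capacity_loopErasure hG x n

end Capacity

end Network

/-! ### The heat kernel of the lattice -/

namespace Network

variable {V E : Type*} (G : Network V E)

theorem avg_pow_const (hG : ∀ v, (G.out v).Nonempty) (c : ℝ) (k : ℕ) (v : V) :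
    (G.avg ^ k) (fun _ => c) v = c :=
  (G.pathExp_comp_apply 0 k (fun _ => c) fun _ => v).symm.trans (G.pathExp_const hG 0 k c _)

theorem hasSum_avg_pow {ι : Type*} {f : ι → V → ℝ} {F : V → ℝ}
    (h : ∀ v, HasSum (fun i => f i v) (F v)) (k : ℕ) (v : V) :
    HasSum (fun i => (G.avg ^ k) (f i) v) ((G.avg ^ k) F v) := by
  induction k generalizing v with
  | zero => exact h v
  | succ k ih =>
    simp only [avg_pow_succ_apply, avg_apply]
    exact (hasSum_sum fun e _ => (ih _).mul_left _).div_const _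

theorem avg_pow_congr {f g : V → ℝ} {k : ℕ} {v : V} (h : ∀ u ∈ G.ball v k, f u = g u) :
    (G.avg ^ k) f v = (G.avg ^ k) g v := by
  induction k generalizing v with
  | zero => exact h v (G.self_mem_ball v 0)
  | succ k ih =>
    simp only [avg_pow_succ_apply]
    exact G.avg_congr fun e he => ih fun u hu => h u (G.ball_tgt_subset he k hu)

theorem hasSum_mul_avg_pow_single [DecidableEq V] (f : V → ℝ) (k : ℕ) (v : V) :
    HasSum (fun u => f u * (G.avg ^ k) (Pi.single u 1) v) ((G.avg ^ k) f v) := by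
  have hout : ∀ u ∉ G.ball v k, f u * (G.avg ^ k) (Pi.single u 1) v = 0 := fun u hu => by
    rw [G.avg_pow_congr (g := fun _ => 0) fun z hz =>
      Pi.single_eq_of_ne (ne_of_mem_of_not_mem hz hu) 1, map_fun_zero, mul_zero]
  convert hasSum_sum_of_ne_finset_zero (L := .unconditional V) hout using 1
  simp only [← map_fun_const_mul, ← map_fun_sum]
  refine G.avg_pow_congr fun z hz => ?_
  simp [Pi.single_apply, hz]

end Network

section LineKernel

/-- The `n`-step transition probabilities of the simple random walk on `ℤ` started from `0`. -/
noncomputable def lineKernel : ℕ → ℤ → ℝ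
  | 0, z => if z = 0 then 1 else 0
  | n + 1, z => (lineKernel n (z + 1) + lineKernel n (z - 1)) / 2

theorem lineKernel_of_lt {n : ℕ} {z : ℤ} (h : (n : ℤ) < z) : lineKernel n z = 0 := by
  induction n generalizing z with
  | zero => exact if_neg (by omega)
  | succ n ih => rw [lineKernel, ih (by omega), ih (by omega)]; norm_num

theorem lineKernel_sub_two_mul (n k : ℕ) : lineKernel n (n - 2 * k) = n.choose k / 2 ^ n := by
  induction n generalizing k with
  | zero =>
    cases k with
    | zero => simp [lineKernel]
    | succ k => rw [lineKernel, if_neg (by omega)]; simp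
  | succ n ih =>
    have hright : ((n + 1 : ℕ) : ℤ) - 2 * k - 1 = n - 2 * k := by push_cast; ring
    rw [lineKernel, hright, ih]
    cases k with
    | zero => rw [lineKernel_of_lt (by push_cast; omega)]; simp [pow_succ, div_eq_mul_inv, mul_comm]
    | succ k =>
      have hleft : ((n + 1 : ℕ) : ℤ) - 2 * (k + 1 : ℕ) + 1 = n - 2 * k := by push_cast; ring
      rw [hleft, ih, Nat.choose_succ_succ, pow_succ]
      push_cast
      ring

theorem lineKernel_of_odd {n : ℕ} {z : ℤ} (h : Odd (n - z)) : lineKernel n z = 0 := by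
  induction n generalizing z with
  | zero => exact if_neg (by rintro rfl; simp at h)
  | succ n ih =>
    push_cast at h
    rw [lineKernel, ih (by grind), ih (by grind)]
    norm_num

theorem centralBinom_div_sq_mul_le (m : ℕ) :
    ((m.centralBinom : ℝ) / 4 ^ m) ^ 2 * (2 * m + 1) ≤ 1 := by
  induction m with
  | zero => simp
  | succ m ih =>
    have hm : (0 : ℝ) < m + 1 := by positivity
    have hrec : ((m + 1).centralBinom : ℝ) / 4 ^ (m + 1) =
        (m.centralBinom : ℝ) / 4 ^ m * ((2 * m + 1) / (2 * (m + 1))) := by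
      have h : ((m : ℝ) + 1) * (m + 1).centralBinom = 2 * (2 * m + 1) * m.centralBinom := by
        exact_mod_cast Nat.succ_mul_centralBinom_succ m
      rw [eq_div_of_mul_eq hm.ne' ((mul_comm _ _).trans h), pow_succ]
      field
    calc (((m + 1).centralBinom : ℝ) / 4 ^ (m + 1)) ^ 2 * (2 * (m + 1 : ℕ) + 1)
        = (m.centralBinom / 4 ^ m) ^ 2 * (2 * m + 1) *
          ((2 * m + 1) * (2 * m + 3) / (2 * (m + 1)) ^ 2) := by
          rw [hrec]; push_cast; field
      _ ≤ 1 := by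
          refine mul_le_one₀ ih (by positivity) ?_
          rw [div_le_one (by positivity)]
          nlinarith

theorem choose_half_div_sq_mul_le (n : ℕ) :
    ((n.choose (n / 2) : ℝ) / 2 ^ n) ^ 2 * (n + 1) ≤ 1 := by
  rcases Nat.even_or_odd' n with ⟨m, rfl | rfl⟩
  · have h := centralBinom_div_sq_mul_le m
    rw [Nat.mul_div_cancel_left m two_pos, pow_mul]
    norm_num [Nat.centralBinom] at h ⊢
    exact h
  · have hchoose : (m + 1).centralBinom = 2 * (2 * m + 1).choose m := by
      rw [Nat.centralBinom, show 2 * (m + 1) = 2 * m + 1 + 1 by ring, Nat.choose_succ_succ,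
        Nat.choose_symm_half, ← two_mul]
    have heq : ((2 * m + 1).choose ((2 * m + 1) / 2) : ℝ) / 2 ^ (2 * m + 1) =
        ((m + 1).centralBinom : ℝ) / 4 ^ (m + 1) := by
      rw [hchoose, show (2 * m + 1) / 2 = m by omega, pow_succ, pow_mul, pow_succ]
      push_cast
      norm_num
      field
    rw [heq]
    refine le_trans (mul_le_mul_of_nonneg_left ?_ (sq_nonneg _))
      (centralBinom_div_sq_mul_le (m + 1))
    push_cast
    linarith

theorem lineKernel_sq_mul_le (n : ℕ) (z : ℤ) : lineKernel n z ^ 2 * (n + 1) ≤ 1 := by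
  rcases lt_or_ge (n : ℤ) z with hz | hz
  · norm_num [lineKernel_of_lt hz]
  rcases Int.even_or_odd (n - z) with ⟨k, hk⟩ | hodd
  · obtain ⟨k, rfl⟩ := Int.eq_ofNat_of_zero_le (show 0 ≤ k by omega)
    rw [show z = n - 2 * (k : ℤ) by omega, lineKernel_sub_two_mul]
    refine le_trans ?_ (choose_half_div_sq_mul_le n)
    gcongr
    exact Nat.choose_le_middle k n
  · norm_num [lineKernel_of_odd hodd]

end LineKernel

namespace latticeNetwork

variable {d : ℕ}

theorem sum_out (v : Fin d → ℤ) (φ : (Fin d → ℤ) × Fin d × Bool → ℝ) :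
    ∑ e ∈ (latticeNetwork d).out v, φ e = ∑ i, (φ (v, i, true) + φ (v, i, false)) := by
  have hout : (latticeNetwork d).out v = Finset.univ.image fun p : Fin d × Bool => (v, p) := by
    ext ⟨u, p⟩
    simp [Network.mem_out, latticeNetwork, eq_comm]
  rw [hout, Finset.sum_image fun p _ q _ h => (Prod.mk.inj h).2, Fintype.sum_prod_type]
  simp only [Fintype.sum_bool]

theorem out_nonempty [NeZero d] (v : Fin d → ℤ) : ((latticeNetwork d).out v).Nonempty :=
  ⟨(v, 0, true), (Network.mem_out _).2 rfl⟩

theorem vertexCond_eq (v : Fin d → ℤ) : (latticeNetwork d).vertexCond v = 2 * d := by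
  rw [Network.vertexCond, sum_out]
  simp only [latticeNetwork, Finset.sum_const, Finset.card_univ, Fintype.card_fin, nsmul_eq_mul]
  ring

theorem avg_eq (f : (Fin d → ℤ) → ℝ) (v : Fin d → ℤ) : (latticeNetwork d).avg f v =
    (∑ i, (f (v + Pi.single i 1) + f (v - Pi.single i 1))) / (2 * d) := by
  rw [Network.avg_apply, vertexCond_eq, sum_out]
  simp [latticeNetwork, latticeStep, Pi.single_neg, sub_eq_add_neg]

theorem avg_pow_comp_sub (f : (Fin d → ℤ) → ℝ) (z : Fin d → ℤ) (k : ℕ) (u : Fin d → ℤ) :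
    ((latticeNetwork d).avg ^ k) (fun y => f (z - y)) u =
      ((latticeNetwork d).avg ^ k) f (z - u) := by
  induction k generalizing u with
  | zero => rfl
  | succ k ih =>
    simp only [Network.avg_pow_succ_apply, avg_eq, ih]
    congr 1
    refine Finset.sum_congr rfl fun i _ => ?_
    rw [add_comm, sub_add_eq_sub_sub, sub_sub_eq_add_sub, add_sub_right_comm]

/-- The `l`-step transition probabilities of the simple random walk on `ℤ^d` started
from `0`. -/
noncomputable def heat (l : ℕ) : (Fin d → ℤ) → ℝ := ((latticeNetwork d).avg ^ l) (Pi.single 0 1)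

theorem heat_nonneg (l : ℕ) (z : Fin d → ℤ) : 0 ≤ heat l z :=
  Network.avg_pow_nonneg _ (fun u => by rw [Pi.single_apply]; split_ifs <;> norm_num) l z

theorem avg_pow_heat (k l : ℕ) : ((latticeNetwork d).avg ^ k) (heat l) = heat (k + l) := by
  rw [heat, heat, pow_add, Module.End.mul_apply]

theorem avg_pow_single (l : ℕ) (z u : Fin d → ℤ) :
    ((latticeNetwork d).avg ^ l) (Pi.single z 1) u = heat l (z - u) := by
  rw [heat, ← avg_pow_comp_sub]
  refine congrFun (congrArg _ (funext fun y => ?_)) u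
  simp only [Pi.single_apply, sub_eq_zero, eq_comm]

theorem heat_neg (l : ℕ) (z : Fin d → ℤ) : heat l (-z) = heat l z := by
  rw [← zero_sub, ← avg_pow_single, heat]

theorem hasSum_heat_mul (l : ℕ) (f : (Fin d → ℤ) → ℝ) (u : Fin d → ℤ) :
    HasSum (fun z => heat l z * f (u + z)) (((latticeNetwork d).avg ^ l) f u) := by
  rw [← (Equiv.addLeft (-u)).hasSum_iff]
  convert (latticeNetwork d).hasSum_mul_avg_pow_single f l u using 2 with z
  simp [avg_pow_single, mul_comm, neg_add_eq_sub]

theorem heat_two_mul_le (l : ℕ) (u : Fin d → ℤ) :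
    heat (2 * l) u ≤ heat (2 * l) (0 : Fin d → ℤ) := by
  have hcross : HasSum (fun z => heat l z * heat l (u + z)) (heat (2 * l) u) := by
    rw [two_mul, ← avg_pow_heat]
    exact hasSum_heat_mul l (heat l) u
  have hsq : HasSum (fun z : Fin d → ℤ => heat l z ^ 2) (heat (2 * l) (0 : Fin d → ℤ)) := by
    rw [two_mul, ← avg_pow_heat]
    simpa only [zero_add, sq] using hasSum_heat_mul l (heat l) 0
  have hshift : HasSum (fun z => heat l (u + z) ^ 2) (heat (2 * l) (0 : Fin d → ℤ)) :=
    ((Equiv.addLeft u).hasSum_iff (f := fun z => heat l z ^ 2)).2 hsq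
  calc heat (2 * l) u ≤ 1 / 2 * (heat (2 * l) (0 : Fin d → ℤ) + heat (2 * l) 0) :=
        hasSum_le (fun z => by linarith [two_mul_le_add_sq (heat l z) (heat l (u + z))])
          hcross ((hsq.add hshift).mul_left (1 / 2))
    _ = heat (2 * l) (0 : Fin d → ℤ) := by ring

end latticeNetwork

section FourDimensional

theorem prod_le_sum_pow_four (a : Fin 4 → ℝ) : ∏ i, a i ≤ 1 / 4 * ∑ i, a i ^ 4 := by
  simp only [Fin.sum_univ_four, Fin.prod_univ_four]
  nlinarith [sq_nonneg (a 0 * a 1 - a 2 * a 3), sq_nonneg (a 0 ^ 2 - a 1 ^ 2),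
    sq_nonneg (a 2 ^ 2 - a 3 ^ 2)]

theorem lineKernel_pow_four_le (n : ℕ) (z : ℤ) :
    lineKernel n z ^ 4 ≤ 1 / ((n : ℝ) + 1) ^ 2 := by
  rw [le_div_iff₀ (by positivity)]
  calc lineKernel n z ^ 4 * ((n : ℝ) + 1) ^ 2 = (lineKernel n z ^ 2 * (n + 1)) ^ 2 := by ring
    _ ≤ 1 := pow_le_one₀ (by positivity) (lineKernel_sq_mul_le n z)

theorem inv_sq_average_le {s : ℝ} (hs : 1 ≤ s) :
    1 / 4 * (1 / (s + 1) ^ 2) + 3 / 4 * (1 / s ^ 2) ≤ 1 / (s + 1 / 16) ^ 2 := by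
  have hsum : 1 / 4 * (1 / (s + 1) ^ 2) + 3 / 4 * (1 / s ^ 2) =
      (s ^ 2 + 3 * (s + 1) ^ 2) / (4 * (s ^ 2 * (s + 1) ^ 2)) := by
    field_simp
  rw [hsum, div_le_div_iff₀ (by positivity) (by positivity)]
  nlinarith [mul_nonneg (sub_nonneg.2 hs) (sub_nonneg.2 hs),
    mul_nonneg (mul_nonneg (sub_nonneg.2 hs) (sub_nonneg.2 hs)) (sub_nonneg.2 hs)]

namespace latticeNetwork

theorem avg_prod_lineKernel (n : Fin 4 → ℕ) (z : Fin 4 → ℤ) :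
    (latticeNetwork 4).avg (fun z => ∏ i, lineKernel (n i) (z i)) z =
      1 / 4 * ∑ j, ∏ i, lineKernel (Function.update n j (n j + 1) i) (z i) := by
  rw [avg_eq]
  simp only [Fin.sum_univ_four, Fin.prod_univ_four, Pi.add_apply, Pi.sub_apply, Pi.single_apply,
    Function.update_apply]
  simp [lineKernel]
  ring

-- A step of the walk is a step of the line in a uniformly chosen coordinate. Averaging over that
-- choice with the convexity gain of `inv_sq_average_le` spares us the concentration of the number
-- of steps made by each coordinate.
theorem avg_pow_prod_lineKernel_le (l : ℕ) (n : Fin 4 → ℕ) (z : Fin 4 → ℤ) :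
    ((latticeNetwork 4).avg ^ l) (fun z => ∏ i, lineKernel (n i) (z i)) z ≤
      1 / 4 * ∑ i, 1 / ((n i : ℝ) + 1 + l / 16) ^ 2 := by
  induction l generalizing n with
  | zero =>
    simpa using (prod_le_sum_pow_four fun i => lineKernel (n i) (z i)).trans
      (mul_le_mul_of_nonneg_left (Finset.sum_le_sum fun i _ => lineKernel_pow_four_le _ _)
        (by norm_num))
  | succ l ih =>
    have hstep : ∀ i, 1 / 4 * (1 / ((n i : ℝ) + 1 + 1 + l / 16) ^ 2) +
        3 / 4 * (1 / ((n i : ℝ) + 1 + l / 16) ^ 2) ≤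
        1 / ((n i : ℝ) + 1 + (l + 1 : ℕ) / 16) ^ 2 := fun i => by
      have hs : (1 : ℝ) ≤ n i + 1 + l / 16 := by
        linarith [(n i).cast_nonneg (α := ℝ), l.cast_nonneg (α := ℝ)]
      convert inv_sq_average_le hs using 3 <;> push_cast <;> ring
    calc ((latticeNetwork 4).avg ^ (l + 1)) (fun z => ∏ i, lineKernel (n i) (z i)) z
        = 1 / 4 * ∑ j, ((latticeNetwork 4).avg ^ l)
          (fun z => ∏ i, lineKernel (Function.update n j (n j + 1) i) (z i)) z := by
          rw [pow_succ, Module.End.mul_apply, ← map_fun_sum, ← map_fun_const_mul]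
          exact congrArg (fun f => ((latticeNetwork 4).avg ^ l) f z)
            (funext (avg_prod_lineKernel n))
      _ ≤ 1 / 4 * ∑ j : Fin 4,
          (1 / 4 * ∑ i, 1 / ((Function.update n j (n j + 1) i : ℝ) + 1 + l / 16) ^ 2) := by
          gcongr with j
          exact ih _
      _ = 1 / 4 * ∑ i, (1 / 4 * (1 / ((n i : ℝ) + 1 + 1 + l / 16) ^ 2) +
          3 / 4 * (1 / ((n i : ℝ) + 1 + l / 16) ^ 2)) := by
          simp only [Fin.sum_univ_four, Function.update_apply, reduceIte, Fin.reduceEq,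
            Nat.cast_add, Nat.cast_one]
          ring
      _ ≤ _ := by
          gcongr with i
          exact hstep i

theorem heat_le (l : ℕ) (z : Fin 4 → ℤ) : heat l z ≤ 256 / ((l : ℝ) + 1) ^ 2 := by
  have hzero : (fun z : Fin 4 → ℤ => ∏ i, lineKernel ((0 : Fin 4 → ℕ) i) (z i)) =
      Pi.single 0 1 := by
    ext z
    simp [lineKernel, Pi.single_apply, funext_iff, Finset.prod_ite_zero]
  calc heat l z ≤ 1 / 4 * ∑ i : Fin 4, 1 / (((0 : Fin 4 → ℕ) i : ℝ) + 1 + l / 16) ^ 2 := by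
        rw [heat, ← hzero]
        exact avg_pow_prod_lineKernel_le l 0 z
    _ = 256 / ((l : ℝ) + 16) ^ 2 := by
        simp only [Pi.zero_apply, Nat.cast_zero, zero_add, Finset.sum_const, Finset.card_univ,
          Fintype.card_fin, nsmul_eq_mul]
        push_cast
        field
    _ ≤ 256 / ((l : ℝ) + 1) ^ 2 := by
        gcongr
        norm_num

end latticeNetwork

end FourDimensional

/-! ### The Green function of the lattice -/

namespace Network

variable {V E : Type*} (G : Network V E)

theorem pathExp_apply (hG : ∀ v, (G.out v).Nonempty) {i j N : ℕ} (hij : i ≤ j) (hj : j ≤ i + N)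
    (f : V → ℝ) (w : ℕ → V) : G.pathExp i N (fun w => f (w j)) w = (G.avg ^ (j - i)) f (w i) := by
  obtain ⟨k, rfl⟩ := Nat.exists_eq_add_of_le hij
  obtain ⟨l, rfl⟩ := Nat.exists_eq_add_of_le (Nat.le_of_add_le_add_left hj)
  rw [pathExp_add, Nat.add_sub_cancel_left, ← pathExp_comp_apply]
  exact G.pathExp_congr fun w' _ _ =>
    G.pathExp_of_dependsOn hG (fun u u' h => by rw [h (i + k) (le_refl (i + k))]) w'

theorem pathExp_apply_mul_apply (hG : ∀ v, (G.out v).Nonempty) {i j k N : ℕ} (hij : i ≤ j)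
    (hjk : j ≤ k) (hk : k ≤ i + N) (f h : V → ℝ) (w : ℕ → V) :
    G.pathExp i N (fun w => f (w j) * h (w k)) w =
      (G.avg ^ (j - i)) (fun v => f v * (G.avg ^ (k - j)) h v) (w i) := by
  rw [← G.pathExp_apply hG hij (by omega : j ≤ i + (j - i)),
    show N = (j - i) + (i + N - j) by omega, pathExp_add, Nat.add_sub_cancel' hij]
  refine G.pathExp_congr fun w' _ _ => ?_
  rw [G.pathExp_mul_left (fun u u' hu => by rw [hu j (le_refl j)]),
    G.pathExp_apply hG hjk (by omega)]

end Network

section RealSums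

theorem sum_inv_sq_le (k N : ℕ) :
    ∑ l ∈ Finset.range N, 1 / (((l + k : ℕ) : ℝ) + 1) ^ 2 ≤ 2 / ((k : ℝ) + 1) := by
  have telescope : ∑ l ∈ Finset.range N, 1 / (((l + k : ℕ) : ℝ) + 1) ^ 2 ≤
      2 / ((k : ℝ) + 1) - 2 / ((N : ℝ) + k + 1) := by
    induction N with
    | zero => simp
    | succ N ih =>
      have hstep : 1 / (((N + k : ℕ) : ℝ) + 1) ^ 2 ≤
          2 / ((N : ℝ) + k + 1) - 2 / (((N + 1 : ℕ) : ℝ) + k + 1) := by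
        push_cast
        rw [div_sub_div _ _ (by positivity) (by positivity),
          div_le_div_iff₀ (by positivity) (by positivity)]
        have : (0 : ℝ) ≤ N + k := by positivity
        nlinarith
      rw [Finset.sum_range_succ]
      linarith
  exact telescope.trans (sub_le_self _ (by positivity))

section InvSqBound

variable {f : ℕ → ℝ} {C : ℝ} (hf : ∀ l, 0 ≤ f l) (hC : ∀ l : ℕ, f l ≤ C / ((l : ℝ) + 1) ^ 2)
include hf hC

theorem sum_range_add_le_of_le_inv_sq (k N : ℕ) :
    ∑ l ∈ Finset.range N, f (l + k) ≤ 2 * C / ((k : ℝ) + 1) := by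
  have hC0 : 0 ≤ C := by simpa using (hf 0).trans (hC 0)
  calc ∑ l ∈ Finset.range N, f (l + k)
      ≤ C * ∑ l ∈ Finset.range N, 1 / (((l + k : ℕ) : ℝ) + 1) ^ 2 := by
        simp only [Finset.mul_sum, mul_one_div]
        exact Finset.sum_le_sum fun l _ => hC (l + k)
    _ ≤ C * (2 / ((k : ℝ) + 1)) := mul_le_mul_of_nonneg_left (sum_inv_sq_le k N) hC0
    _ = 2 * C / ((k : ℝ) + 1) := by ring

theorem summable_of_le_inv_sq : Summable f :=
  summable_of_sum_range_le hf (sum_range_add_le_of_le_inv_sq hf hC 0)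

theorem tsum_add_le_of_le_inv_sq (k : ℕ) : ∑' l, f (l + k) ≤ 2 * C / ((k : ℝ) + 1) :=
  Real.tsum_le_of_sum_range_le (fun _ => hf _) (sum_range_add_le_of_le_inv_sq hf hC k)

end InvSqBound

theorem sum_range_inv_eq_harmonic (n : ℕ) :
    ∑ k ∈ Finset.range n, 1 / ((k : ℝ) + 1) = harmonic n := by
  simp [harmonic, one_div]

theorem one_le_harmonic_succ (n : ℕ) : (1 : ℝ) ≤ harmonic (n + 1) := by
  rw [← sum_range_inv_eq_harmonic]
  simpa using Finset.single_le_sum (f := fun k : ℕ => 1 / ((k : ℝ) + 1))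
    (fun _ _ => by positivity) (Finset.mem_range.2 n.succ_pos)

theorem harmonic_succ_le_mul_log {n : ℕ} (hn : 2 ≤ n) :
    (harmonic (n + 1) : ℝ) ≤ 4 * Real.log n := by
  have hn' : (2 : ℝ) ≤ n := by exact_mod_cast hn
  have hlog_succ : Real.log ((n + 1 : ℕ) : ℝ) ≤ 2 * Real.log n := by
    rw [← Real.log_rpow (by positivity)]
    refine Real.log_le_log (by positivity) ?_
    push_cast
    norm_num
    nlinarith
  linarith [harmonic_le_one_add_log (n + 1), Real.log_two_gt_d9,
    Real.log_le_log two_pos hn']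

theorem le_succ_div_harmonic {n : ℕ} (hn : 2 ≤ n) :
    1 / 4 * (n / Real.log n) ≤ ((n : ℝ) + 1) / harmonic (n + 1) := by
  have hH : (0 : ℝ) < harmonic (n + 1) := zero_lt_one.trans_le (one_le_harmonic_succ n)
  rw [div_mul_div_comm, one_mul]
  gcongr
  · linarith
  · exact harmonic_succ_le_mul_log hn

theorem succ_div_harmonic_le {n : ℕ} (hn : 2 ≤ n) :
    ((n : ℝ) + 1) / harmonic (n + 1) ≤ 2 * (n / Real.log n) := by
  have hn' : (2 : ℝ) ≤ n := by exact_mod_cast hn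
  have hlog : 0 < Real.log n := Real.log_pos (by linarith)
  have hle : Real.log n ≤ harmonic (n + 1) :=
    (Real.log_le_log (by linarith) (by push_cast; linarith)).trans (log_add_one_le_harmonic _)
  rw [← mul_div_assoc]
  gcongr
  linarith

end RealSums

namespace latticeNetwork

/-- The Green function of the simple random walk on `ℤ^d`; a junk value for recurrent walks,
where the series diverges. -/
noncomputable def greenFn {d : ℕ} (z : Fin d → ℤ) : ℝ := ∑' l, heat l z

theorem greenFn_nonneg {d : ℕ} (z : Fin d → ℤ) : 0 ≤ greenFn z :=
  tsum_nonneg fun l => heat_nonneg l z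

theorem greenFn_neg {d : ℕ} (z : Fin d → ℤ) : greenFn (-z) = greenFn z := by
  simp only [greenFn, heat_neg]

theorem greenFn_sub_comm {d : ℕ} (y z : Fin d → ℤ) : greenFn (y - z) = greenFn (z - y) := by
  rw [← neg_sub, greenFn_neg]

theorem hasSum_greenFn (z : Fin 4 → ℤ) : HasSum (fun l => heat l z) (greenFn z) :=
  (summable_of_le_inv_sq (fun l => heat_nonneg l z) (fun l => heat_le l z)).hasSum

theorem hasSum_avg_pow_greenFn (k : ℕ) (z : Fin 4 → ℤ) :
    HasSum (fun l => heat (l + k) z) (((latticeNetwork 4).avg ^ k) greenFn z) := by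
  simpa only [avg_pow_heat, add_comm k] using
    (latticeNetwork 4).hasSum_avg_pow hasSum_greenFn k z

theorem avg_pow_greenFn_le (k : ℕ) (z : Fin 4 → ℤ) :
    ((latticeNetwork 4).avg ^ k) greenFn z ≤ 512 / ((k : ℝ) + 1) := by
  rw [← (hasSum_avg_pow_greenFn k z).tsum_eq]
  exact (tsum_add_le_of_le_inv_sq (fun l => heat_nonneg l z) (fun l => heat_le l z) k).trans_eq
    (by norm_num)

theorem greenFn_sub_avg (z : Fin 4 → ℤ) :
    greenFn z - (latticeNetwork 4).avg greenFn z = (Pi.single 0 1 : (Fin 4 → ℤ) → ℝ) z := by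
  have h := (hasSum_nat_add_iff (f := fun l => heat l z) 1).1 (hasSum_avg_pow_greenFn 1 z)
  rw [(hasSum_greenFn z).unique h, pow_one, Finset.sum_range_one, add_sub_cancel_left]
  rfl

theorem killedLap_greenFn_sub (z u : Fin 4 → ℤ) :
    (latticeNetwork 4).killedLap 1 (fun u => greenFn (z - u)) u =
      8 * Set.indicator {z} 1 u := by
  have hshift := avg_pow_comp_sub (greenFn (d := 4)) z 1 u
  rw [pow_one] at hshift
  rw [Network.killedLap_apply, vertexCond_eq, one_mul, hshift, greenFn_sub_avg, Pi.single_apply,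
    Set.indicator_apply]
  norm_num [sub_eq_zero, eq_comm]

theorem le_capacity_pathVertices {x : Fin 4 → ℤ} {n : ℕ} {w : ℕ → Fin 4 → ℤ}
    (hw : ∀ m ≤ n, w m ∈ (latticeNetwork 4).ball x m) (t : ℝ) :
    2 * t * (n + 1) - t ^ 2 * (1 / 8 * ∑ i ∈ Finset.range (n + 1), ∑ j ∈ Finset.range (n + 1),
      greenFn (w j - w i)) ≤ (latticeNetwork 4).capacity (pathVertices w n) := by
  have h := (latticeNetwork 4).le_capacity out_nonempty (s := Finset.range (n + 1)) (v := w)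
    (x := x) (r := n) (A := pathVertices w n)
    (pathVertices_subset_iff.2 fun m hm => (latticeNetwork 4).ball_mono x hm (hw m hm))
    (fun i hi => mem_pathVertices.2 ⟨i, by simpa [Nat.lt_succ_iff] using hi, rfl⟩)
    (f := fun u => 1 / 8 * ∑ j ∈ Finset.range (n + 1), greenFn (w j - u))
    (fun u => mul_nonneg (by norm_num) (Finset.sum_nonneg fun j _ => greenFn_nonneg _))
    (fun u => ?_) t
  · simpa [Finset.mul_sum] using h
  · rw [map_fun_const_mul, map_fun_sum]
    simp only [killedLap_greenFn_sub, ← Finset.mul_sum]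
    exact le_of_eq (by ring)

theorem pathExp_greenFn_sub_le (x : Fin 4 → ℤ) {i j n : ℕ} (hij : i ≤ j) (hj : j ≤ n) :
    (latticeNetwork 4).pathExp 0 n (fun w => greenFn (w j - w i)) (fun _ => x) ≤
      512 / (((j - i : ℕ) : ℝ) + 1) := by
  rw [(latticeNetwork 4).pathExp_split (hij.trans hj)]
  refine ((latticeNetwork 4).pathExp_le fun w _ _ => ?_).trans
    ((latticeNetwork 4).pathExp_const out_nonempty _ _ _ _).le
  calc (latticeNetwork 4).pathExp i (n - i) (fun w => greenFn (w j - w i)) w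
      = (latticeNetwork 4).pathExp i (n - i) (fun w' => greenFn (w i - w' j)) w :=
        (latticeNetwork 4).pathExp_congr fun w' hw' _ => by
          rw [hw' i le_rfl, greenFn_sub_comm]
    _ = ((latticeNetwork 4).avg ^ (j - i)) greenFn (w i - w i) := by
        rw [(latticeNetwork 4).pathExp_apply out_nonempty hij (by omega)
          fun y => greenFn (w i - y), avg_pow_comp_sub]
    _ ≤ 512 / (((j - i : ℕ) : ℝ) + 1) := avg_pow_greenFn_le _ _

theorem pathExp_sum_greenFn_le (x : Fin 4 → ℤ) (n : ℕ) :
    (latticeNetwork 4).pathExp 0 n (fun w => ∑ i ∈ Finset.range (n + 1),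
      ∑ j ∈ Finset.range (n + 1), greenFn (w j - w i)) (fun _ => x) ≤
      1024 * (n + 1) * harmonic (n + 1) := by
  have hrow (i : ℕ) : ∑ j ∈ Finset.Ico i (n + 1),
      (latticeNetwork 4).pathExp 0 n (fun w => greenFn (w j - w i)) (fun _ => x) ≤
      512 * harmonic (n + 1) := by
    calc _ ≤ ∑ j ∈ Finset.Ico i (n + 1), 512 * (1 / (((j - i : ℕ) : ℝ) + 1)) :=
          Finset.sum_le_sum fun j hj => by
            obtain ⟨hij, hj⟩ := Finset.mem_Ico.1 hj
            rw [mul_one_div]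
            exact pathExp_greenFn_sub_le x hij (Nat.le_of_lt_succ hj)
      _ = 512 * ∑ k ∈ Finset.range (n + 1 - i), 1 / ((k : ℝ) + 1) := by
          simp only [Finset.sum_Ico_eq_sum_range, ← Finset.mul_sum, Nat.add_sub_cancel_left]
      _ ≤ 512 * harmonic (n + 1) := by
          rw [← sum_range_inv_eq_harmonic]
          gcongr
          exact Nat.sub_le _ _
  calc _ ≤ (latticeNetwork 4).pathExp 0 n (fun w => 2 * ∑ i ∈ Finset.range (n + 1),
        ∑ j ∈ Finset.Ico i (n + 1), greenFn (w j - w i)) (fun _ => x) :=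
        (latticeNetwork 4).pathExp_le fun w _ _ => sum_sum_le_two_mul_of_symm (n + 1)
          (fun i _ => greenFn_nonneg _) fun i _ j _ => greenFn_sub_comm _ _
    _ = 2 * ∑ i ∈ Finset.range (n + 1), ∑ j ∈ Finset.Ico i (n + 1),
        (latticeNetwork 4).pathExp 0 n (fun w => greenFn (w j - w i)) (fun _ => x) := by
        simp only [map_fun_const_mul, map_fun_sum]
    _ ≤ 2 * ∑ i ∈ Finset.range (n + 1), 512 * (harmonic (n + 1) : ℝ) := by
        gcongr with i
        exact hrow i
    _ = 1024 * (n + 1) * harmonic (n + 1) := by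
        rw [Finset.sum_const, Finset.card_range, nsmul_eq_mul]
        push_cast
        ring

theorem le_pathExp_capacity_pathVertices (x : Fin 4 → ℤ) (n : ℕ) :
    1 / 128 * (((n : ℝ) + 1) / harmonic (n + 1)) ≤ (latticeNetwork 4).pathExp 0 n
      (fun w => (latticeNetwork 4).capacity (pathVertices w n)) (fun _ => x) := by
  have hH := one_le_harmonic_succ n
  have h := (latticeNetwork 4).pathExp_le_of_mem_ball (x := x) (n := n) fun w hw =>
    le_capacity_pathVertices hw (1 / (128 * (harmonic (n + 1) : ℝ)))
  rw [map_fun_sub, (latticeNetwork 4).pathExp_const out_nonempty, map_fun_const_mul,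
    map_fun_const_mul] at h
  refine le_trans ?_ h
  calc 1 / 128 * (((n : ℝ) + 1) / harmonic (n + 1))
      = 2 * (1 / (128 * harmonic (n + 1))) * (n + 1) - (1 / (128 * harmonic (n + 1))) ^ 2 *
          (1 / 8 * (1024 * (n + 1) * harmonic (n + 1))) := by
        field
    _ ≤ _ := by
        gcongr
        exact pathExp_sum_greenFn_le x n

end latticeNetwork

namespace latticeNetwork

section LowerBound

variable {d : ℕ}

theorem sum_add_single_sq (z : Fin d → ℤ) (i : Fin d) (s : ℤ) :
    ∑ j, (((z + Pi.single i s : Fin d → ℤ) j : ℤ) : ℝ) ^ 2 =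
      ∑ j, (z j : ℝ) ^ 2 + 2 * s * z i + s ^ 2 := by
  have hterm (j : Fin d) : (((z + Pi.single i s : Fin d → ℤ) j : ℤ) : ℝ) ^ 2 =
      (z j : ℝ) ^ 2 + if j = i then 2 * s * (z i : ℝ) + s ^ 2 else 0 := by
    rcases eq_or_ne j i with rfl | hj
    · simp only [Pi.add_apply, Pi.single_eq_same, Int.cast_add, if_pos]
      ring
    · simp [hj]
  simp only [hterm, Finset.sum_add_distrib, Finset.sum_ite_eq', Finset.mem_univ, if_true]
  ring

theorem sq_sum_heat_le (l : ℕ) (B : Finset (Fin d → ℤ)) :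
    (∑ z ∈ B, heat l z) ^ 2 ≤ B.card * heat (2 * l) (0 : Fin d → ℤ) := by
  have h := hasSum_heat_mul l (heat l) (0 : Fin d → ℤ)
  simp only [avg_pow_heat, ← two_mul, zero_add, ← sq] at h
  refine sq_sum_le_card_mul_sum_sq.trans ?_
  gcongr
  exact sum_le_hasSum B (fun z _ => sq_nonneg _) h

variable [NeZero d]

theorem avg_pow_sum_sq (l : ℕ) (z : Fin d → ℤ) :
    ((latticeNetwork d).avg ^ l) (fun z => ∑ i, (z i : ℝ) ^ 2) z = ∑ i, (z i : ℝ) ^ 2 + l := by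
  induction l generalizing z with
  | zero => simp
  | succ l ih =>
    simp only [Network.avg_pow_succ_apply, ih, avg_eq, sub_eq_add_neg, ← Pi.single_neg,
      sum_add_single_sq]
    have hd : (d : ℝ) ≠ 0 := NeZero.ne _
    simp only [Finset.sum_add_distrib, ← Finset.mul_sum, Finset.sum_const, Finset.card_univ,
      Fintype.card_fin, nsmul_eq_mul]
    push_cast
    field_simp
    ring

theorem one_sub_le_sum_box_heat (l : ℕ) {M : ℕ} (hM : 0 < M) :
    1 - (l : ℝ) / M ^ 2 ≤
      ∑ z ∈ Fintype.piFinset fun _ : Fin d => Finset.Icc (-(M : ℤ)) M, heat l z := by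
  set B := Fintype.piFinset fun _ : Fin d => Finset.Icc (-(M : ℤ)) M with hB
  have hmass : HasSum (fun z : Fin d → ℤ => heat l z) 1 := by
    simpa only [mul_one, Network.avg_pow_const _ out_nonempty] using
      hasSum_heat_mul l (fun _ : Fin d → ℤ => 1) 0
  have hmoment : HasSum (fun z : Fin d → ℤ => heat l z * ∑ i, (z i : ℝ) ^ 2) l := by
    have h := hasSum_heat_mul l (fun z => ∑ i, (z i : ℝ) ^ 2) (0 : Fin d → ℤ)
    rw [avg_pow_sum_sq] at h
    simpa using h
  have hfar (z : Fin d → ℤ) (hz : z ∉ B) : (M : ℝ) ^ 2 ≤ ∑ i, (z i : ℝ) ^ 2 := by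
    simp only [hB, Fintype.mem_piFinset, Finset.mem_Icc, not_forall] at hz
    obtain ⟨i, hi⟩ := hz
    have habs : (M : ℤ) ≤ |z i| := by
      rw [le_abs]
      omega
    calc (M : ℝ) ^ 2 ≤ |(z i : ℝ)| ^ 2 := by
          gcongr
          exact_mod_cast habs
      _ = (z i : ℝ) ^ 2 := sq_abs _
      _ ≤ ∑ i, (z i : ℝ) ^ 2 := Finset.single_le_sum (f := fun i => (z i : ℝ) ^ 2)
          (fun i _ => sq_nonneg _) (Finset.mem_univ i)
  have h := sum_le_hasSum B (fun z hz => ?_) ((hmoment.div_const ((M : ℝ) ^ 2)).sub hmass)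
  · have hpos : 0 ≤ ∑ z ∈ B, heat l z * (∑ i, (z i : ℝ) ^ 2) / M ^ 2 := Finset.sum_nonneg
      fun z _ => div_nonneg (mul_nonneg (heat_nonneg l z) (by positivity)) (by positivity)
    rw [Finset.sum_sub_distrib] at h
    linarith
  · rw [sub_nonneg, mul_div_assoc]
    exact le_mul_of_one_le_right (heat_nonneg l z) ((one_le_div (by positivity)).2 (hfar z hz))

end LowerBound

-- A box of side of order `√l` carries half of the mass of `heat l`.
theorem heat_two_mul_zero_ge (l : ℕ) :
    1 / 5184 / ((l : ℝ) + 1) ^ 2 ≤ heat (2 * l) (0 : Fin 4 → ℤ) := by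
  set M : ℕ := Nat.sqrt (2 * l) + 1 with hM
  set B := Fintype.piFinset fun _ : Fin 4 => Finset.Icc (-(M : ℤ)) M with hB
  have hsqrt : Nat.sqrt (2 * l) * Nat.sqrt (2 * l) ≤ 2 * l := Nat.sqrt_le _
  have hcard : (B.card : ℝ) ≤ 1296 * ((l : ℝ) + 1) ^ 2 := by
    have hside : (2 * M + 1) ^ 2 ≤ 36 * (l + 1) := by
      rw [hM]
      nlinarith [sq_nonneg ((Nat.sqrt (2 * l) : ℤ) - 1)]
    have hcard_eq : B.card = (2 * M + 1) ^ 4 := by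
      rw [hB, Fintype.card_piFinset_const, Int.card_Icc]
      congr 1
      omega
    have hnat : B.card ≤ 1296 * (l + 1) ^ 2 :=
      calc B.card = ((2 * M + 1) ^ 2) ^ 2 := by rw [hcard_eq, ← pow_mul]
        _ ≤ (36 * (l + 1)) ^ 2 := Nat.pow_le_pow_left hside 2
        _ = 1296 * (l + 1) ^ 2 := by ring
    exact_mod_cast hnat
  have hmass : 1 / 2 ≤ ∑ z ∈ B, heat l z := by
    have hlM : 2 * (l : ℝ) ≤ (M : ℝ) ^ 2 := by
      rw [sq]
      exact_mod_cast (Nat.lt_succ_sqrt (2 * l)).le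
    have hratio : (l : ℝ) / M ^ 2 ≤ 1 / 2 := by
      rw [div_le_div_iff₀ (by positivity) two_pos]
      linarith
    linarith [one_sub_le_sum_box_heat (d := 4) l (M := M) (Nat.succ_pos _)]
  have hsq : (1 / 2 : ℝ) ^ 2 ≤ 1296 * ((l : ℝ) + 1) ^ 2 * heat (2 * l) (0 : Fin 4 → ℤ) :=
    calc (1 / 2 : ℝ) ^ 2 ≤ (∑ z ∈ B, heat l z) ^ 2 := by gcongr
      _ ≤ B.card * heat (2 * l) (0 : Fin 4 → ℤ) := sq_sum_heat_le l B
      _ ≤ _ := mul_le_mul_of_nonneg_right hcard (heat_nonneg _ _)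
  rw [div_le_iff₀ (by positivity)]
  linarith

end latticeNetwork

namespace latticeNetwork

theorem heat_two_mul_le_inv_sq (l : ℕ) (z : Fin 4 → ℤ) :
    heat (2 * l) z ≤ 256 / ((l : ℝ) + 1) ^ 2 := by
  refine (heat_le _ _).trans ?_
  have : (0 : ℝ) ≤ l := by positivity
  gcongr
  linarith

/-- The expected number of visits of the simple random walk on `ℤ⁴` from `0` to `z` at the even
times not before `2 * t`. Restricting to even times makes it largest at `z = 0`. -/
noncomputable def evenGreen (t : ℕ) (z : Fin 4 → ℤ) : ℝ := ∑' l, heat (2 * (l + t)) z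

theorem summable_heat_two_mul (z : Fin 4 → ℤ) : Summable fun l => heat (2 * l) z :=
  summable_of_le_inv_sq (fun _ => heat_nonneg _ z) fun l => heat_two_mul_le_inv_sq l z

theorem hasSum_evenGreen (t : ℕ) (z : Fin 4 → ℤ) :
    HasSum (fun l => heat (2 * (l + t)) z) (evenGreen t z) :=
  ((summable_nat_add_iff t).2 (summable_heat_two_mul z)).hasSum

theorem evenGreen_nonneg (t : ℕ) (z : Fin 4 → ℤ) : 0 ≤ evenGreen t z :=
  tsum_nonneg fun _ => heat_nonneg _ z

theorem evenGreen_le (t : ℕ) (z : Fin 4 → ℤ) : evenGreen t z ≤ 512 / ((t : ℝ) + 1) :=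
  (tsum_add_le_of_le_inv_sq (fun _ => heat_nonneg _ z) (fun l => heat_two_mul_le_inv_sq l z)
    t).trans_eq (by norm_num)

theorem evenGreen_zero_le_greenFn (z : Fin 4 → ℤ) : evenGreen 0 z ≤ greenFn z :=
  hasSum_le_inj (fun l => 2 * l) (mul_right_injective₀ two_ne_zero) (fun l _ => heat_nonneg l z)
    (fun _ => le_rfl) (hasSum_evenGreen 0 z) (hasSum_greenFn z)

theorem evenGreen_le_apply_zero (t : ℕ) (z : Fin 4 → ℤ) : evenGreen t z ≤ evenGreen t 0 :=
  hasSum_le (fun _ => heat_two_mul_le _ z) (hasSum_evenGreen t z) (hasSum_evenGreen t 0)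

theorem avg_pow_evenGreen (s t : ℕ) (z : Fin 4 → ℤ) :
    ((latticeNetwork 4).avg ^ (2 * s)) (evenGreen t) z = evenGreen (s + t) z := by
  rw [← ((latticeNetwork 4).hasSum_avg_pow (hasSum_evenGreen t) (2 * s) z).tsum_eq, evenGreen]
  simp only [avg_pow_heat, ← mul_add, add_left_comm s]

theorem inv_le_evenGreen (t : ℕ) : 1 / 20736 * (1 / ((t : ℝ) + 1)) ≤ evenGreen t 0 := by
  have hterm : ∀ l ∈ Finset.range (t + 1), 1 / 20736 * (1 / ((t : ℝ) + 1) ^ 2) ≤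
      heat (2 * (l + t)) (0 : Fin 4 → ℤ) := fun l hl => by
    have hlt : (l : ℝ) ≤ t := by exact_mod_cast Finset.mem_range_succ_iff.1 hl
    calc 1 / 20736 * (1 / ((t : ℝ) + 1) ^ 2) = 1 / 5184 / (2 * ((t : ℝ) + 1)) ^ 2 := by field
      _ ≤ 1 / 5184 / (((l + t : ℕ) : ℝ) + 1) ^ 2 := by
          gcongr
          push_cast
          linarith
      _ ≤ heat (2 * (l + t)) (0 : Fin 4 → ℤ) := heat_two_mul_zero_ge (l + t)
  calc 1 / 20736 * (1 / ((t : ℝ) + 1))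
      = (Finset.range (t + 1)).card • (1 / 20736 * (1 / ((t : ℝ) + 1) ^ 2)) := by
        rw [Finset.card_range, nsmul_eq_mul]
        push_cast
        field
    _ ≤ ∑ l ∈ Finset.range (t + 1), heat (2 * (l + t)) 0 :=
        Finset.card_nsmul_le_sum _ _ _ hterm
    _ ≤ evenGreen t 0 := sum_le_hasSum _ (fun l _ => heat_nonneg _ _) (hasSum_evenGreen t 0)

/-- The correlation of the even Green function, seen from `0`, at the times `2 * j` and
`2 * (j + t)` of the walk. -/
noncomputable def greenCorr (j t : ℕ) : ℝ :=
  ((latticeNetwork 4).avg ^ (2 * j)) (fun v => evenGreen 0 v * evenGreen t v) 0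

theorem greenCorr_le_mul (j t : ℕ) : greenCorr j t ≤ evenGreen j 0 * evenGreen t 0 := by
  calc greenCorr j t
      ≤ ((latticeNetwork 4).avg ^ (2 * j)) (fun v => evenGreen t 0 * evenGreen 0 v) 0 :=
        (latticeNetwork 4).avg_pow_le_avg_pow (fun v => by
          rw [mul_comm]
          exact mul_le_mul_of_nonneg_right (evenGreen_le_apply_zero t v) (evenGreen_nonneg 0 v)) _ _
    _ = evenGreen j 0 * evenGreen t 0 := by
        rw [map_fun_const_mul, avg_pow_evenGreen, add_zero, mul_comm]

theorem avg_pow_heat_mul_le {d : ℕ} (j l : ℕ) {h : (Fin d → ℤ) → ℝ} (hh : ∀ v, 0 ≤ h v) :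
    ((latticeNetwork d).avg ^ (2 * j)) (fun v => heat (2 * l) v * h v) 0 ≤
      heat (2 * j) (0 : Fin d → ℤ) * ((latticeNetwork d).avg ^ (2 * l)) h 0 := by
  refine hasSum_le (fun z => ?_) (hasSum_heat_mul (2 * j) _ 0)
    ((hasSum_heat_mul (2 * l) h 0).mul_left _)
  rw [zero_add]
  exact mul_le_mul_of_nonneg_right (heat_two_mul_le j z) (mul_nonneg (heat_nonneg _ _) (hh z))

theorem evenGreen_zero_le_sum_add (j : ℕ) (z : Fin 4 → ℤ) :
    evenGreen 0 z ≤ ∑ l ∈ Finset.range j, heat (2 * l) z + evenGreen j 0 := by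
  have hsplit := (summable_heat_two_mul z).sum_add_tsum_nat_add j
  calc evenGreen 0 z = ∑ l ∈ Finset.range j, heat (2 * l) z + evenGreen j z := hsplit.symm
    _ ≤ _ := by
        gcongr
        exact evenGreen_le_apply_zero j z

theorem greenCorr_le_sum (j t : ℕ) : greenCorr j t ≤
    ∑ l ∈ Finset.range j, heat (2 * j) (0 : Fin 4 → ℤ) * evenGreen (l + t) 0 +
      evenGreen j 0 * evenGreen (j + t) 0 := by
  calc greenCorr j t ≤ ((latticeNetwork 4).avg ^ (2 * j)) (fun v =>
        ∑ l ∈ Finset.range j, heat (2 * l) v * evenGreen t v +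
          evenGreen j 0 * evenGreen t v) 0 :=
        (latticeNetwork 4).avg_pow_le_avg_pow (fun v => by
          rw [← Finset.sum_mul, ← add_mul]
          exact mul_le_mul_of_nonneg_right (evenGreen_zero_le_sum_add j v)
            (evenGreen_nonneg t v)) _ _
    _ = ∑ l ∈ Finset.range j, ((latticeNetwork 4).avg ^ (2 * j)) (fun v =>
          heat (2 * l) v * evenGreen t v) 0 + evenGreen j 0 * evenGreen (j + t) 0 := by
        rw [map_fun_add, map_fun_sum, map_fun_const_mul, avg_pow_evenGreen]
    _ ≤ _ := by
        gcongr with l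
        simpa only [avg_pow_evenGreen] using avg_pow_heat_mul_le j l (evenGreen_nonneg t)

theorem greenCorr_le (j t : ℕ) : greenCorr j t ≤ 262144 / ((j : ℝ) + 1) ^ 2 +
    131072 / ((j : ℝ) + 1) ^ 2 * ∑ l ∈ Finset.range j, 1 / ((l : ℝ) + t + 1) := by
  have hfar : evenGreen j 0 * evenGreen (j + t) 0 ≤ 262144 / ((j : ℝ) + 1) ^ 2 :=
    calc evenGreen j 0 * evenGreen (j + t) 0
        ≤ 512 / ((j : ℝ) + 1) * (512 / ((j + t : ℕ) + 1)) :=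
          mul_le_mul (evenGreen_le j 0) (evenGreen_le _ 0) (evenGreen_nonneg _ 0) (by positivity)
      _ ≤ 512 / ((j : ℝ) + 1) * (512 / (j + 1)) := by
          gcongr
          exact Nat.le_add_right j t
      _ = 262144 / ((j : ℝ) + 1) ^ 2 := by field
  have hnear (l : ℕ) : heat (2 * j) (0 : Fin 4 → ℤ) * evenGreen (l + t) 0 ≤
      131072 / ((j : ℝ) + 1) ^ 2 * (1 / ((l : ℝ) + t + 1)) :=
    calc heat (2 * j) (0 : Fin 4 → ℤ) * evenGreen (l + t) 0
        ≤ 256 / ((j : ℝ) + 1) ^ 2 * (512 / ((l + t : ℕ) + 1)) :=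
          mul_le_mul (heat_two_mul_le_inv_sq j 0) (evenGreen_le _ 0) (evenGreen_nonneg _ 0)
            (by positivity)
      _ = _ := by
          push_cast
          field
  rw [add_comm, Finset.mul_sum]
  exact (greenCorr_le_sum j t).trans (add_le_add (Finset.sum_le_sum fun l _ => hnear l) hfar)

end latticeNetwork

theorem sum_sum_inv_add_le (N : ℕ) :
    ∑ t ∈ Finset.range N, ∑ l ∈ Finset.range N, 1 / ((l : ℝ) + t + 1) ≤ 2 * N := by
  induction N with
  | zero => simp
  | succ N ih =>
    have hrow : ∑ l ∈ Finset.range (N + 1), 1 / ((l : ℝ) + N + 1) ≤ 1 := by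
      calc ∑ l ∈ Finset.range (N + 1), 1 / ((l : ℝ) + N + 1)
          ≤ ∑ l ∈ Finset.range (N + 1), 1 / ((N : ℝ) + 1) := by
            gcongr
            linarith [Nat.cast_nonneg (α := ℝ) ‹ℕ›]
        _ = 1 := by
            rw [Finset.sum_const, Finset.card_range, nsmul_eq_mul]
            push_cast
            field
    have hcol : ∑ t ∈ Finset.range N, 1 / ((N : ℝ) + t + 1) ≤ 1 :=
      (Finset.sum_le_sum_of_subset_of_nonneg (Finset.range_mono N.le_succ)
        fun _ _ _ => by positivity).trans (by simpa only [add_comm (N : ℝ)] using hrow)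
    rw [Finset.sum_range_succ]
    simp only [Finset.sum_range_succ _ N, Finset.sum_add_distrib] at hrow ⊢
    push_cast
    linarith

namespace latticeNetwork

theorem sum_greenCorr_le (j : ℕ) :
    ∑ t ∈ Finset.range (j + 1), greenCorr j t ≤ 524288 * (1 / ((j : ℝ) + 1)) := by
  have hinv : ∑ t ∈ Finset.range (j + 1), ∑ l ∈ Finset.range j, 1 / ((l : ℝ) + t + 1) ≤
      2 * ((j + 1 : ℕ) : ℝ) :=
    (Finset.sum_le_sum fun t _ => Finset.sum_le_sum_of_subset_of_nonneg
      (Finset.range_mono j.le_succ) fun _ _ _ => by positivity).trans (sum_sum_inv_add_le (j + 1))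
  calc ∑ t ∈ Finset.range (j + 1), greenCorr j t
      ≤ ∑ t ∈ Finset.range (j + 1), (262144 / ((j : ℝ) + 1) ^ 2 +
          131072 / ((j : ℝ) + 1) ^ 2 * ∑ l ∈ Finset.range j, 1 / ((l : ℝ) + t + 1)) :=
        Finset.sum_le_sum fun t _ => greenCorr_le j t
    _ = (j + 1) * (262144 / ((j : ℝ) + 1) ^ 2) + 131072 / ((j : ℝ) + 1) ^ 2 *
          ∑ t ∈ Finset.range (j + 1), ∑ l ∈ Finset.range j, 1 / ((l : ℝ) + t + 1) := by
        rw [Finset.sum_add_distrib, ← Finset.mul_sum, Finset.sum_const, Finset.card_range,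
          nsmul_eq_mul]
        push_cast
        rfl
    _ ≤ (j + 1) * (262144 / ((j : ℝ) + 1) ^ 2) + 131072 / ((j : ℝ) + 1) ^ 2 *
          (2 * ((j + 1 : ℕ) : ℝ)) := by
        gcongr
    _ = 524288 * (1 / ((j : ℝ) + 1)) := by
        push_cast
        field

end latticeNetwork

/-! ### The Green function along the walk -/

theorem two_mul_sum_sum_Ico_mul_le_sq (a : ℕ → ℝ) (n : ℕ) :
    2 * ∑ i ∈ Finset.range n, ∑ j ∈ Finset.Ico (i + 1) n, a i * a j ≤
      (∑ i ∈ Finset.range n, a i) ^ 2 := by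
  rw [show ∑ i ∈ Finset.range n, ∑ j ∈ Finset.Ico (i + 1) n, a i * a j =
      ∑ j ∈ Finset.range n, ∑ i ∈ Finset.range j, a i * a j by
    simpa only [Finset.range_eq_Ico] using Finset.sum_Ico_Ico_comm' 0 n fun i j => a i * a j]
  induction n with
  | zero => simp
  | succ n ih =>
    rw [Finset.sum_range_succ, Finset.sum_range_succ, ← Finset.sum_mul]
    linarith [sq_nonneg (a n)]

namespace latticeNetwork

/-- The sum of `evenGreen 0`, seen from the position of the path `w` at time `m`, along the first
`n` even steps of `w` after that time. -/
noncomputable def greenAlong (n m : ℕ) (w : ℕ → Fin 4 → ℤ) : ℝ :=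
  ∑ k ∈ Finset.range (n + 1), evenGreen 0 (w m - w (m + 2 * k))

/-- The mean of `greenAlong n m` for the simple random walk. -/
noncomputable def meanGreenAlong (n : ℕ) : ℝ := ∑ k ∈ Finset.range (n + 1), evenGreen k 0

theorem greenAlong_nonneg (n m : ℕ) (w : ℕ → Fin 4 → ℤ) : 0 ≤ greenAlong n m w :=
  Finset.sum_nonneg fun _ _ => evenGreen_nonneg 0 _

theorem dependsOn_greenAlong (n m : ℕ) : DependsOn (greenAlong n m) (Set.Iic (m + 2 * n)) :=
  fun w w' h => Finset.sum_congr rfl fun k hk => by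
    have hkn := Finset.mem_range_succ_iff.1 hk
    rw [h m (Set.mem_Iic.2 (by omega)), h (m + 2 * k) (Set.mem_Iic.2 (by omega))]

theorem le_meanGreenAlong (n : ℕ) : 1 / 20736 * (harmonic (n + 1) : ℝ) ≤ meanGreenAlong n := by
  rw [← sum_range_inv_eq_harmonic, Finset.mul_sum]
  exact Finset.sum_le_sum fun k _ => inv_le_evenGreen k

theorem meanGreenAlong_pos (n : ℕ) : 0 < meanGreenAlong n :=
  lt_of_lt_of_le (by linarith [one_le_harmonic_succ n]) (le_meanGreenAlong n)

theorem pathExp_greenAlong (n m : ℕ) (w : ℕ → Fin 4 → ℤ) :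
    (latticeNetwork 4).pathExp m (2 * n) (greenAlong n m) w = meanGreenAlong n := by
  refine (map_fun_sum _ _ _ w).trans (Finset.sum_congr rfl fun k hk => ?_)
  have hkn := Finset.mem_range_succ_iff.1 hk
  calc (latticeNetwork 4).pathExp m (2 * n) (fun w => evenGreen 0 (w m - w (m + 2 * k))) w
      = (latticeNetwork 4).pathExp m (2 * n) (fun w' => evenGreen 0 (w m - w' (m + 2 * k))) w :=
        (latticeNetwork 4).pathExp_congr fun w' hw' _ => by rw [hw' m le_rfl]
    _ = evenGreen k 0 := by
        rw [(latticeNetwork 4).pathExp_apply out_nonempty (by omega) (by omega)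
          fun y => evenGreen 0 (w m - y), avg_pow_comp_sub, sub_self, Nat.add_sub_cancel_left,
          avg_pow_evenGreen, add_zero]

theorem pathExp_evenGreen_mul {n m i k : ℕ} (hik : i ≤ k) (hk : k ≤ n) (w : ℕ → Fin 4 → ℤ) :
    (latticeNetwork 4).pathExp m (2 * n) (fun w => evenGreen 0 (w m - w (m + 2 * i)) *
      evenGreen 0 (w m - w (m + 2 * k))) w = greenCorr i (k - i) := by
  calc _ = (latticeNetwork 4).pathExp m (2 * n) (fun w' =>
        evenGreen 0 (w m - w' (m + 2 * i)) * evenGreen 0 (w m - w' (m + 2 * k))) w :=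
        (latticeNetwork 4).pathExp_congr fun w' hw' _ => by rw [hw' m le_rfl]
    _ = ((latticeNetwork 4).avg ^ (2 * i))
          (fun y => evenGreen 0 (w m - y) * evenGreen (k - i) (w m - y)) (w m) := by
        rw [(latticeNetwork 4).pathExp_apply_mul_apply out_nonempty (by omega) (by omega)
          (by omega) (fun y => evenGreen 0 (w m - y)) fun y => evenGreen 0 (w m - y),
          Nat.add_sub_cancel_left, Nat.add_sub_add_left, ← Nat.mul_sub]
        simp only [avg_pow_comp_sub, avg_pow_evenGreen, add_zero]
    _ = greenCorr i (k - i) := by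
        rw [avg_pow_comp_sub (fun v => evenGreen 0 v * evenGreen (k - i) v), sub_self, greenCorr]

theorem greenCorr_nonneg (j t : ℕ) : 0 ≤ greenCorr j t :=
  (latticeNetwork 4).avg_pow_nonneg
    (fun v => mul_nonneg (evenGreen_nonneg 0 v) (evenGreen_nonneg t v)) _ _

theorem sum_Ico_greenCorr_le {i n : ℕ} (hi : i ≤ n) :
    ∑ k ∈ Finset.Ico i (n + 1), greenCorr i (k - i) ≤ 524288 * (1 / ((i : ℝ) + 1)) +
      ∑ t ∈ Finset.Ico (i + 1) (n + 1), evenGreen i 0 * evenGreen t 0 := by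
  calc ∑ k ∈ Finset.Ico i (n + 1), greenCorr i (k - i)
      = ∑ t ∈ Finset.range (n + 1 - i), greenCorr i t := by
        simp only [Finset.sum_Ico_eq_sum_range, Nat.add_sub_cancel_left]
    _ ≤ ∑ t ∈ Finset.range (n + 1), greenCorr i t :=
        Finset.sum_le_sum_of_subset_of_nonneg (Finset.range_mono (Nat.sub_le _ _))
          fun _ _ _ => greenCorr_nonneg i _
    _ = ∑ t ∈ Finset.range (i + 1), greenCorr i t +
          ∑ t ∈ Finset.Ico (i + 1) (n + 1), greenCorr i t :=
        (Finset.sum_range_add_sum_Ico _ (Nat.succ_le_succ hi)).symm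
    _ ≤ _ := add_le_add (sum_greenCorr_le i) (Finset.sum_le_sum fun t _ => greenCorr_le_mul i t)

theorem two_mul_sum_sum_greenCorr_le (n : ℕ) :
    2 * ∑ i ∈ Finset.range (n + 1), ∑ k ∈ Finset.Ico i (n + 1), greenCorr i (k - i) ≤
      meanGreenAlong n ^ 2 + 1048576 * harmonic (n + 1) := by
  have hrows := Finset.sum_le_sum fun i hi =>
    sum_Ico_greenCorr_le (n := n) (Finset.mem_range_succ_iff.1 hi)
  rw [Finset.sum_add_distrib, ← Finset.mul_sum, sum_range_inv_eq_harmonic] at hrows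
  have hsq := two_mul_sum_sum_Ico_mul_le_sq (fun i => evenGreen i 0) (n + 1)
  rw [← meanGreenAlong] at hsq
  linarith

theorem pathExp_greenAlong_sq_le (n m : ℕ) (w : ℕ → Fin 4 → ℤ) :
    (latticeNetwork 4).pathExp m (2 * n) (fun w => greenAlong n m w ^ 2) w ≤
      meanGreenAlong n ^ 2 + 1048576 * harmonic (n + 1) := by
  calc _ ≤ (latticeNetwork 4).pathExp m (2 * n) (fun w => 2 * ∑ i ∈ Finset.range (n + 1),
        ∑ k ∈ Finset.Ico i (n + 1), evenGreen 0 (w m - w (m + 2 * i)) *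
          evenGreen 0 (w m - w (m + 2 * k))) w :=
        (latticeNetwork 4).pathExp_le fun w' _ _ => by
          rw [greenAlong, sq, Finset.sum_mul_sum]
          exact sum_sum_le_two_mul_of_symm (n + 1) (fun i _ => mul_self_nonneg _)
            fun i _ k _ => mul_comm _ _
    _ = 2 * ∑ i ∈ Finset.range (n + 1), ∑ k ∈ Finset.Ico i (n + 1), greenCorr i (k - i) := by
        simp only [map_fun_const_mul, map_fun_sum]
        refine congrArg (2 * ·) (Finset.sum_congr rfl fun i _ => Finset.sum_congr rfl
          fun k hk => ?_)
        obtain ⟨hik, hkn⟩ := Finset.mem_Ico.1 hk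
        exact pathExp_evenGreen_mul hik (Nat.le_of_lt_succ hkn) w
    _ ≤ _ := two_mul_sum_sum_greenCorr_le n

theorem pathExp_greenAlong_sub_sq_le (n m : ℕ) (w : ℕ → Fin 4 → ℤ) :
    (latticeNetwork 4).pathExp m (2 * n) (fun w => (greenAlong n m w - meanGreenAlong n) ^ 2) w ≤
      1048576 * harmonic (n + 1) := by
  have hexpand : (fun w => (greenAlong n m w - meanGreenAlong n) ^ 2) = fun w =>
      greenAlong n m w ^ 2 - 2 * meanGreenAlong n * greenAlong n m w + meanGreenAlong n ^ 2 := by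
    funext w
    ring
  rw [hexpand, map_fun_add, map_fun_sub, (latticeNetwork 4).pathExp_const out_nonempty,
    map_fun_const_mul, pathExp_greenAlong]
  linarith [pathExp_greenAlong_sq_le n m w]

theorem pathExp_indicator_greenAlong_le (n m : ℕ) (w : ℕ → Fin 4 → ℤ) :
    (latticeNetwork 4).pathExp m (2 * n)
      (fun w => (Set.Iio (meanGreenAlong n / 2)).indicator 1 (greenAlong n m w)) w ≤
      4194304 * 20736 ^ 2 / harmonic (n + 1) := by
  have hH := one_le_harmonic_succ n
  have hmean := le_meanGreenAlong n
  have hpos := meanGreenAlong_pos n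
  set M := meanGreenAlong n
  have chebyshev (z : ℝ) : (Set.Iio (M / 2)).indicator 1 z ≤ 4 / M ^ 2 * (z - M) ^ 2 := by
    by_cases hz : z < M / 2
    · rw [Set.indicator_of_mem (Set.mem_Iio.2 hz), div_mul_eq_mul_div, Pi.one_apply,
        le_div_iff₀ (by positivity)]
      nlinarith
    · rw [Set.indicator_of_notMem (mt Set.mem_Iio.1 hz)]
      positivity
  calc _ ≤ (latticeNetwork 4).pathExp m (2 * n)
          (fun w => 4 / M ^ 2 * (greenAlong n m w - M) ^ 2) w :=
        (latticeNetwork 4).pathExp_le fun w' _ _ => chebyshev _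
    _ ≤ 4 / M ^ 2 * (1048576 * harmonic (n + 1)) := by
        rw [map_fun_const_mul]
        gcongr
        exact pathExp_greenAlong_sub_sq_le n m w
    _ ≤ 4 / (1 / 20736 * harmonic (n + 1)) ^ 2 * (1048576 * harmonic (n + 1)) := by gcongr
    _ = 4194304 * 20736 ^ 2 / harmonic (n + 1) := by field

end latticeNetwork

/-! ### Last exits -/

namespace Network

variable {V E : Type*} (G : Network V E) (hG : ∀ v, (G.out v).Nonempty)
include hG

theorem hitEver_le_one (A : Set V) (v : V) : G.hitEver A v ≤ 1 :=
  le_of_tendsto' (G.tendsto_hitProb hG A v) fun N => G.hitProb_le_one hG A N v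

variable [MeasurableSpace V] [DiscreteMeasurableSpace V]

theorem indicator_escapeProb_eq (A : Set V) :
    A.indicator (G.escapeProb A) = G.hitEver A - G.avg (G.hitEver A) := by
  funext v
  by_cases hv : v ∈ A
  · rw [Set.indicator_of_mem hv, G.escapeProb_eq hG, Pi.sub_apply, G.hitEver_of_mem hv]
  · rw [Set.indicator_of_notMem hv, Pi.sub_apply, G.hitEver_of_notMem hG hv, sub_self]

-- The `l`-th term is the probability that the walk from `u` is in `A` for the last time at `l`.
theorem sum_avg_pow_indicator_escapeProb_le_one (A : Set V) (u : V) (L : ℕ) :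
    ∑ l ∈ Finset.range L, (G.avg ^ l) (A.indicator (G.escapeProb A)) u ≤ 1 := by
  have hterm (l : ℕ) : (G.avg ^ l) (A.indicator (G.escapeProb A)) u =
      (G.avg ^ l) (G.hitEver A) u - (G.avg ^ (l + 1)) (G.hitEver A) u := by
    rw [G.indicator_escapeProb_eq hG, map_sub, Pi.sub_apply, pow_succ, Module.End.mul_apply]
  simp only [hterm, Finset.sum_range_sub']
  exact (sub_le_self _ (G.avg_pow_nonneg (G.hitEver_nonneg hG A) L u)).trans
    (G.hitEver_le_one hG A u)

end Network

namespace latticeNetwork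

theorem sum_escapeProb_mul_greenFn_le_one (A : Finset (Fin 4 → ℤ)) (u : Fin 4 → ℤ) :
    ∑ v ∈ A, (latticeNetwork 4).escapeProb (A : Set (Fin 4 → ℤ)) v * greenFn (v - u) ≤ 1 := by
  set esc := (latticeNetwork 4).escapeProb (A : Set (Fin 4 → ℤ))
  have hesc : (A : Set (Fin 4 → ℤ)).indicator esc = fun y => ∑ v ∈ A, esc v *
      (Pi.single v 1 : (Fin 4 → ℤ) → ℝ) y := by
    funext y
    simp [Set.indicator_apply, Pi.single_apply]
  have hterm (l : ℕ) : ∑ v ∈ A, esc v * heat l (v - u) =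
      ((latticeNetwork 4).avg ^ l) ((A : Set (Fin 4 → ℤ)).indicator esc) u := by
    simp only [hesc, map_fun_sum, map_fun_const_mul, ← avg_pow_single]
  refine le_of_tendsto' (hasSum_sum fun v _ =>
    (hasSum_greenFn (v - u)).mul_left (esc v)).tendsto_sum_nat fun L => ?_
  simp only [hterm]
  exact (latticeNetwork 4).sum_avg_pow_indicator_escapeProb_le_one out_nonempty _ u L

theorem greenAlong_le_sum_greenFn {n m : ℕ} (hm : m ≤ n) (w : ℕ → Fin 4 → ℤ) :
    greenAlong n m w ≤ ∑ s ∈ Finset.range (3 * n + 1), greenFn (w m - w s) := by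
  have himage : (Finset.range (n + 1)).image (fun k => m + 2 * k) ⊆ Finset.range (3 * n + 1) :=
    Finset.image_subset_iff.2 fun k hk => by
      rw [Finset.mem_range] at hk ⊢
      omega
  calc greenAlong n m w
      ≤ ∑ k ∈ Finset.range (n + 1), greenFn (w m - w (m + 2 * k)) :=
        Finset.sum_le_sum fun k _ => evenGreen_zero_le_greenFn _
    _ = ∑ s ∈ (Finset.range (n + 1)).image (fun k => m + 2 * k), greenFn (w m - w s) :=
        (Finset.sum_image (f := fun s => greenFn (w m - w s))
          fun a _ b _ (hab : m + 2 * a = m + 2 * b) => by omega).symm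
    _ ≤ _ := Finset.sum_le_sum_of_subset_of_nonneg himage fun _ _ _ => greenFn_nonneg _

section SmallTimes

variable {n : ℕ} {w : ℕ → Fin 4 → ℤ} {A : Finset (Fin 4 → ℤ)}

theorem sum_escapeProb_mul_greenAlong_le {τ : (Fin 4 → ℤ) → ℕ} (hτ : ∀ v ∈ A, τ v ≤ n)
    (hwτ : ∀ v ∈ A, w (τ v) = v) :
    ∑ v ∈ A, (latticeNetwork 4).escapeProb (A : Set (Fin 4 → ℤ)) v * greenAlong n (τ v) w ≤
      3 * n + 1 := by
  set esc := (latticeNetwork 4).escapeProb (A : Set (Fin 4 → ℤ))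
  calc ∑ v ∈ A, esc v * greenAlong n (τ v) w
      ≤ ∑ v ∈ A, ∑ s ∈ Finset.range (3 * n + 1), esc v * greenFn (v - w s) :=
        Finset.sum_le_sum fun v hv => by
          rw [← Finset.mul_sum]
          refine mul_le_mul_of_nonneg_left ?_ ((latticeNetwork 4).escapeProb_nonneg _ v)
          simpa only [hwτ v hv] using greenAlong_le_sum_greenFn (hτ v hv) w
    _ = ∑ s ∈ Finset.range (3 * n + 1), ∑ v ∈ A, esc v * greenFn (v - w s) := Finset.sum_comm
    _ ≤ ∑ s ∈ Finset.range (3 * n + 1), 1 :=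
        Finset.sum_le_sum fun s _ => sum_escapeProb_mul_greenFn_le_one A (w s)
    _ = 3 * n + 1 := by simp

theorem sum_indicator_greenAlong_le {τ : (Fin 4 → ℤ) → ℕ} (hτ : ∀ v ∈ A, τ v ≤ n)
    (hwτ : ∀ v ∈ A, w (τ v) = v) (θ : ℝ) :
    ∑ v ∈ A, (Set.Iio θ).indicator (1 : ℝ → ℝ) (greenAlong n (τ v) w) ≤
      ∑ m ∈ Finset.range (n + 1), (Set.Iio θ).indicator 1 (greenAlong n m w) := by
  rw [← Finset.sum_image (s := A) (g := τ)
    (f := fun m => (Set.Iio θ).indicator (1 : ℝ → ℝ) (greenAlong n m w))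
    fun a ha b hb hab => by rw [← hwτ a ha, ← hwτ b hb, hab]]
  exact Finset.sum_le_sum_of_subset_of_nonneg
    (Finset.image_subset_iff.2 fun v hv => Finset.mem_range_succ_iff.2 (hτ v hv))
    fun _ _ _ => Set.indicator_nonneg (fun _ _ => zero_le_one) _

theorem capacity_le_of_subset_pathVertices (hA : A ⊆ pathVertices w n) {θ : ℝ} (hθ : 0 < θ) :
    (latticeNetwork 4).capacity A ≤ 8 * ((3 * n + 1) / θ +
      ∑ m ∈ Finset.range (n + 1), (Set.Iio θ).indicator 1 (greenAlong n m w)) := by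
  have hvisit : ∀ v ∈ A, ∃ m ≤ n, w m = v := fun v hv => mem_pathVertices.1 (hA hv)
  choose! τ hτ hwτ using hvisit
  set esc := (latticeNetwork 4).escapeProb (A : Set (Fin 4 → ℤ)) with hesc
  have hcap : (latticeNetwork 4).capacity A = 8 * ∑ v ∈ A, esc v := by
    simp only [Network.capacity, vertexCond_eq, Finset.mul_sum, hesc]
    norm_num
  have hsplit : ∀ v ∈ A, esc v ≤ esc v * greenAlong n (τ v) w / θ +
      (Set.Iio θ).indicator 1 (greenAlong n (τ v) w) := fun v _ => by
    have hesc0 : 0 ≤ esc v := (latticeNetwork 4).escapeProb_nonneg _ v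
    by_cases h : greenAlong n (τ v) w < θ
    · rw [Set.indicator_of_mem (Set.mem_Iio.2 h)]
      exact ((latticeNetwork 4).escapeProb_le_one _ v).trans (le_add_of_nonneg_left
        (div_nonneg (mul_nonneg hesc0 (greenAlong_nonneg n _ w)) hθ.le))
    · rw [Set.indicator_of_notMem (mt Set.mem_Iio.1 h), add_zero, le_div_iff₀ hθ]
      exact mul_le_mul_of_nonneg_left (not_lt.1 h) hesc0
  rw [hcap]
  refine mul_le_mul_of_nonneg_left ((Finset.sum_le_sum hsplit).trans ?_) (by norm_num)
  rw [Finset.sum_add_distrib, ← Finset.sum_div]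
  exact add_le_add
    (div_le_div_of_nonneg_right (sum_escapeProb_mul_greenAlong_le hτ hwτ) hθ.le)
    (sum_indicator_greenAlong_le hτ hwτ θ)

end SmallTimes

theorem pathExp_zero_indicator_greenAlong_le {n m : ℕ} (hm : m ≤ n) (w : ℕ → Fin 4 → ℤ) :
    (latticeNetwork 4).pathExp 0 (3 * n)
      (fun w => (Set.Iio (meanGreenAlong n / 2)).indicator 1 (greenAlong n m w)) w ≤
      4194304 * 20736 ^ 2 / harmonic (n + 1) := by
  rw [(latticeNetwork 4).pathExp_zero_of_dependsOn out_nonempty (m := m + 2 * n) (by omega)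
      fun _ _ h => congrArg _ (dependsOn_greenAlong n m h),
    (latticeNetwork 4).pathExp_split (Nat.le_add_right m (2 * n)), Nat.add_sub_cancel_left]
  exact ((latticeNetwork 4).pathExp_le fun w' _ _ =>
    pathExp_indicator_greenAlong_le n m w').trans_eq
      ((latticeNetwork 4).pathExp_const out_nonempty ..)

theorem pathExp_capacity_loopErasure_le (x : Fin 4 → ℤ) (n : ℕ) :
    (latticeNetwork 4).pathExp 0 n
      (fun w => (latticeNetwork 4).capacity (loopErasureVertices w n)) (fun _ => x) ≤
      8 * (6 * 20736 + 4194304 * 20736 ^ 2) * ((n + 1) / harmonic (n + 1)) := by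
  have hH := one_le_harmonic_succ n
  have hmean := le_meanGreenAlong n
  set B : ℕ → (ℕ → Fin 4 → ℤ) → ℝ := fun m w =>
    (Set.Iio (meanGreenAlong n / 2)).indicator 1 (greenAlong n m w)
  have hgreen : (3 * (n : ℝ) + 1) / (meanGreenAlong n / 2) ≤
      3 * (n + 1) / (1 / 20736 * harmonic (n + 1) / 2) := by
    gcongr
    linarith
  calc (latticeNetwork 4).pathExp 0 n
          (fun w => (latticeNetwork 4).capacity (loopErasureVertices w n)) (fun _ => x)
      = (latticeNetwork 4).pathExp 0 (3 * n)
          (fun w => (latticeNetwork 4).capacity (loopErasureVertices w n)) (fun _ => x) :=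
        ((latticeNetwork 4).pathExp_zero_of_dependsOn out_nonempty (by omega)
          ((latticeNetwork 4).dependsOn_capacity_loopErasureVertices n) _).symm
    _ ≤ (latticeNetwork 4).pathExp 0 (3 * n) (fun w => 8 * ((3 * n + 1) / (meanGreenAlong n / 2) +
          ∑ m ∈ Finset.range (n + 1), B m w)) (fun _ => x) :=
        (latticeNetwork 4).pathExp_le fun w _ _ => capacity_le_of_subset_pathVertices
          (loopErasureVertices_subset w n) (half_pos (meanGreenAlong_pos n))
    _ = 8 * ((3 * n + 1) / (meanGreenAlong n / 2) + ∑ m ∈ Finset.range (n + 1),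
          (latticeNetwork 4).pathExp 0 (3 * n) (B m) (fun _ => x)) := by
        rw [map_fun_const_mul, map_fun_add, (latticeNetwork 4).pathExp_const out_nonempty,
          map_fun_sum]
    _ ≤ 8 * (3 * (n + 1) / (1 / 20736 * harmonic (n + 1) / 2) +
          ∑ m ∈ Finset.range (n + 1), 4194304 * 20736 ^ 2 / (harmonic (n + 1) : ℝ)) := by
        gcongr with m hm
        exact pathExp_zero_indicator_greenAlong_le (Finset.mem_range_succ_iff.1 hm) _
    _ = 8 * (6 * 20736 + 4194304 * 20736 ^ 2) * ((n + 1) / harmonic (n + 1)) := by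
        rw [Finset.sum_const, Finset.card_range, nsmul_eq_mul]
        push_cast
        field

section Law

variable {x : Fin 4 → ℤ} {Ω : Type*} [MeasurableSpace Ω] {P : Measure Ω} {X : ℕ → Ω → Fin 4 → ℤ}
  (hX : HasLaw (fun ω t => X t ω) ((latticeNetwork 4).walkLaw x) P) {n : ℕ} (hn : 2 ≤ n)
include hX hn

theorem le_integral_capacity_pathVertices : 1 / 512 * (n / Real.log n) ≤
    ∫ ω, (latticeNetwork 4).capacity (pathVertices (fun t => X t ω) n) ∂P := by
  rw [(latticeNetwork 4).integral_eq_pathExp out_nonempty hX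
    ((latticeNetwork 4).dependsOn_capacity_pathVertices n)]
  linarith [le_pathExp_capacity_pathVertices x n, le_succ_div_harmonic hn]

theorem integral_capacity_loopErasure_le :
    ∫ ω, (latticeNetwork 4).capacity (loopErasureVertices (fun t => X t ω) n) ∂P ≤
      16 * (6 * 20736 + 4194304 * 20736 ^ 2) * (n / Real.log n) := by
  rw [(latticeNetwork 4).integral_eq_pathExp out_nonempty hX
    ((latticeNetwork 4).dependsOn_capacity_loopErasureVertices n)]
  linarith [pathExp_capacity_loopErasure_le x n, succ_div_harmonic_le hn]

end Law

end latticeNetwork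

theorem mainTheorem5_general :
    (∀ {V : Type*} {E : Type*} [MeasurableSpace V] [DiscreteMeasurableSpace V]
      (G : Network V E), (∀ v, (G.out v).Nonempty) → ∀ (x : V)
      {Ω : Type*} [MeasurableSpace Ω] (P : Measure Ω) (X : ℕ → Ω → V),
      HasLaw (fun ω t => X t ω) (G.walkLaw x) P → ∀ n : ℕ,
      ∫ ω, G.capacity (loopErasureVertices (fun t => X t ω) n) ∂P ≥
        1 / 64 * ∫ ω, G.capacity (pathVertices (fun t => X t ω) n) ∂P) ∧
    (∃ c C : ℝ, 0 < c ∧ 0 < C ∧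
      ∀ (x : Fin 4 → ℤ) {Ω : Type*} [MeasurableSpace Ω] (P : Measure Ω)
        (X : ℕ → Ω → Fin 4 → ℤ),
      HasLaw (fun ω t => X t ω) ((latticeNetwork 4).walkLaw x) P → ∀ n : ℕ, 2 ≤ n →
      c * (n / Real.log n) ≤
          ∫ ω, (latticeNetwork 4).capacity (loopErasureVertices (fun t => X t ω) n) ∂P ∧
        ∫ ω, (latticeNetwork 4).capacity (loopErasureVertices (fun t => X t ω) n) ∂P ≤
          C * (n / Real.log n)) := by
  refine ⟨fun G hG x _ _ P X hX n => G.integral_capacity_loopErasure_ge hG hX n,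
    1 / 64 * (1 / 512), 16 * (6 * 20736 + 4194304 * 20736 ^ 2), by norm_num, by norm_num,
    fun x _ _ P X hX n hn => ⟨?_, latticeNetwork.integral_capacity_loopErasure_le hX hn⟩⟩
  rw [mul_assoc]
  exact (mul_le_mul_of_nonneg_left (latticeNetwork.le_integral_capacity_pathVertices hX hn)
    (by norm_num)).trans
    ((latticeNetwork 4).integral_capacity_loopErasure_ge latticeNetwork.out_nonempty hX n)

theorem mainTheorem5 :
    (∀ {V : Type*} {E : Type*} [MeasurableSpace V] [DiscreteMeasurableSpace V]
      (G : Network V E), G.IsTransient → ∀ (x : V)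
      {Ω : Type*} [MeasurableSpace Ω] (P : Measure Ω) (X : ℕ → Ω → V),
      HasLaw (fun ω t => X t ω) (G.walkLaw x) P → ∀ n : ℕ,
      ∫ ω, G.capacity (loopErasureVertices (fun t => X t ω) n) ∂P ≥
        1 / 256 * ∫ ω, G.capacity (pathVertices (fun t => X t ω) n) ∂P) ∧
    (∃ c C : ℝ, 0 < c ∧ 0 < C ∧
      ∀ (x : Fin 4 → ℤ) {Ω : Type*} [MeasurableSpace Ω] (P : Measure Ω)
        (X : ℕ → Ω → Fin 4 → ℤ),
      HasLaw (fun ω t => X t ω) ((latticeNetwork 4).walkLaw x) P → ∀ n : ℕ, 2 ≤ n →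
      c * (n / Real.log n) ≤
          ∫ ω, (latticeNetwork 4).capacity (loopErasureVertices (fun t => X t ω) n) ∂P ∧
        ∫ ω, (latticeNetwork 4).capacity (loopErasureVertices (fun t => X t ω) n) ∂P ≤
          C * (n / Real.log n)) :=
  mainTheorem5_general.imp (fun h _ _ _ _ G hT x _ _ P X hX n => (mul_le_mul_of_nonneg_right
    (by norm_num) (integral_nonneg fun _ => G.capacity_nonneg _)).trans
      (h G hT.out_nonempty x P X hX n)) id
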